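/- Let $T$ be a nonempty text of length $n$ over an integer alphabet. Let $\ell_k=(4/3)^{\lceil k/2\rceil-1}$ and let $\mathcal A_k$ be the set of grammar symbols $A$ with $|exp(A)|\le \ell_k$, where $exp(A)$ is the string of terminals to which $A$ expands. The locally consistent run-length grammar of $T$ is built as follows, for functions $\pi_k$ that order the distinct symbols of $S_{k-1}$. Let $S_0=T$. For odd $k$, $S_k$ is obtained from $S_{k-1}$ by replacing every maximal run of $t\ge 2$ equal symbols $B\in\mathcal A_k$ by a nonterminal $A$ with rule $A\to B^t$. For even $k$, $S_{k-1}$ is cut into blocks, a block ending before and after every symbol not in $\mathcal A_k$, after every position $i$ having both neighbours with $\pi_k(S_{k-1}[i-1])>\pi_k(S_{k-1}[i])<\pi_k(S_{k-1}[i+1])$, and at the end of $S_{k-1}$; every block $B_1\cdots B_t$ with $t\ge 2$ is replaced by a nonterminal $A$ with rule $A\to B_1\cdots B_t$. Equal right-hand sides get the same nonterminal. The process stops when $|S_k|=1$, and this symbol is the initial symbol. Let $g$ be the size of the grammar, where a rule $A\to B_1\cdots B_t$ has size $t$ and a rule $A\to B^t$ has size $2$. Let $\mathcal Y$ be the multiset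 that contains $exp(B_s)\cdots exp(B_t)$ for each rule $A\to B_1\cdots B_t$ and each $1<s\le t$, and $exp(B)^{t-1}$ for each rule $A\to B^t$. For a prime $p$ and a base $0<c<p$, let $\kappa(s_1\cdots s_m)=\sum_{i=1}^m s_i c^{i-1} \bmod p$ be the Karp--Rabin signature. Then, on a word RAM with words of $\Theta(\log(n+p))$ bits, there is a data structure of $O(g)$ words on which, given (the index in any fixed enumeration of $\mathcal Y$ of) a string $Y\in\mathcal Y$ and a length $1\le \ell\le |Y|$, the signature $\kappa(Y[1..\ell])$ of the length-$\ell$ prefix of $Y$ can be computed in time $O(1+\log \ell)$. The query algorithm and the constants hidden in the $O$- and $\Theta$-notation do not depend on $T$, the functions $\pi_k$, $p$, $c$, $Y$ or $\ell$. -/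

import Mathlib

noncomputable section

namespace LCG

/-! ### Symbols of a run-length grammar

A symbol is a terminal or a nonterminal, and a nonterminal is identified with the right-hand side
of its unique rule: `run B t` is the nonterminal `A` with rule `A → B ^ t`, and
`block [B₁, …, Bₜ]` is the nonterminal `A` with rule `A → B₁ ⋯ Bₜ`.  Letters are numbers. -/

/-- Grammar symbols. -/
inductive Sym : Type
  | term (a : ℕ) : Sym
  | run (B : Sym) (t : ℕ) : Sym
  | block (Bs : List Sym) : Sym

instance : DecidableEq Sym := Classical.decEq Sym

/-- `exp A`: the string of terminals to which the symbol `A` expands. -/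
def Sym.exp : Sym → List ℕ
  | .term a => [a]
  | .run B t => (List.replicate t B.exp).flatten
  | .block Bs => (Bs.map Sym.exp).flatten

/-- The expansion of a string of symbols. -/
def expand (Bs : List Sym) : List ℕ := (Bs.map Sym.exp).flatten

/-- The set of nonterminals of the grammar with initial symbol `A`, that is, the nonterminals
that label the nodes of the parse tree of `A`. -/
def Sym.nonterminals : Sym → Finset Sym
  | .term _ => ∅
  | .run B t => insert (.run B t) B.nonterminals
  | .block Bs => insert (.block Bs) ((Bs.map Sym.nonterminals).foldr (· ∪ ·) ∅)

/-- Size of the rule of a nonterminal: `t` for `A → B₁ ⋯ Bₜ` and `2` for `A → B ^ t`. -/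
def Sym.ruleSize : Sym → ℕ
  | .term _ => 0
  | .run _ _ => 2
  | .block Bs => Bs.length

/-- Size of the grammar with initial symbol `S`: the sum of the sizes of its rules. -/
def grammarSize (S : Sym) : ℕ := ∑ A ∈ S.nonterminals, A.ruleSize

/-- The strings that the rule of a nonterminal contributes to `𝒴`: for `A → B₁ ⋯ Bₜ` the strings
`exp(B_s) ⋯ exp(B_t)` with `1 < s ≤ t`, and for `A → B ^ t` the string `exp(B) ^ (t - 1)`. -/
def Sym.ruleY : Sym → Multiset (List ℕ)
  | .term _ => 0
  | .run B t => {expand (List.replicate (t - 1) B)}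
  | .block Bs => (Multiset.Ico 1 Bs.length).map fun s => expand (Bs.drop s)

/-- The multiset `𝒴` of the grammar with initial symbol `S`. -/
def multisetY (S : Sym) : Multiset (List ℕ) := S.nonterminals.val.bind Sym.ruleY

/-! ### The locally consistent grammar -/

/-- `ℓ_k = (4/3) ^ (⌈k/2⌉ - 1)`, for `k ≥ 1`. -/
def ell (k : ℕ) : ℚ := (4 / 3 : ℚ) ^ ((k + 1) / 2 - 1)

/-- Membership in `𝒜_k`: the symbols that can be grouped at level `k`. -/
def Active (k : ℕ) (A : Sym) : Prop := (A.exp.length : ℚ) ≤ ell k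

instance (k : ℕ) (A : Sym) : Decidable (Active k A) :=
  inferInstanceAs (Decidable ((A.exp.length : ℚ) ≤ ell k))

/-- The symbol that replaces a maximal run (a run of length 1 is left as it is). -/
def collapseRun : List Sym → List Sym
  | [] => []
  | [A] => [A]
  | A :: As => [.run A (As.length + 1)]

/-- `rle_k`: every maximal run of at least two equal symbols of `𝒜_k` is replaced by a
nonterminal. -/
def rle (k : ℕ) (S : List Sym) : List Sym :=
  (S.splitBy fun A B => decide (A = B ∧ Active k A)).flatMap collapseRun

/-- Does a block end between the consecutive symbols `A` and `B`, where `prev` is the symbol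
before `A` (if there is one)?  It does if `A` or `B` is not in `𝒜_k`, or if `A` is at a local
minimum for `π`. -/
def BlockEnd (π : Sym → ℕ) (k : ℕ) (prev : Option Sym) (A B : Sym) : Prop :=
  ¬ Active k A ∨ ¬ Active k B ∨ ∃ C ∈ prev, π C > π A ∧ π A < π B

instance (π : Sym → ℕ) (k : ℕ) (prev : Option Sym) (A B : Sym) :
    Decidable (BlockEnd π k prev A B) := by
  unfold BlockEnd; cases prev <;> simp <;> infer_instance

/-- The decomposition of a string into blocks; `prev` is the symbol before the string. -/
def blocks (π : Sym → ℕ) (k : ℕ) : Option Sym → List Sym → List (List Sym)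
  | _, [] => []
  | _, [A] => [[A]]
  | prev, A :: B :: S =>
    if BlockEnd π k prev A B then [A] :: blocks π k (some A) (B :: S)
    else (blocks π k (some A) (B :: S)).modifyHead (A :: ·)

/-- The symbol that replaces a block (a block of length 1 is left as it is). -/
def collapseBlock : List Sym → List Sym
  | [] => []
  | [A] => [A]
  | A :: As => [.block (A :: As)]

/-- `bc_k`: every block of at least two symbols is replaced by a nonterminal. -/
def bc (π : Sym → ℕ) (k : ℕ) (S : List Sym) : List Sym :=
  (blocks π k none S).flatMap collapseBlock

/-- The string `S_k` of level `k`, for the text `T` and the functions `π_k`. -/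
def level (π : ℕ → Sym → ℕ) (T : List ℕ) : ℕ → List Sym
  | 0 => T.map .term
  | k + 1 => if Odd (k + 1) then rle (k + 1) (level π T k) else bc (π (k + 1)) (k + 1) (level π T k)

/-- `S` is the initial symbol of the locally consistent grammar built for `T` with functions
`π_k` that order the distinct symbols of `S_{k-1}`: some level `S_h` is the single symbol `S`. -/
structure IsGrammar (π : ℕ → Sym → ℕ) (T : List ℕ) (S : Sym) : Prop where
  injOn : ∀ k, Set.InjOn (π (k + 1)) {A | A ∈ level π T k}
  final : ∃ h, level π T h = [S]

/-! ### Karp–Rabin signatures -/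

/-- `κ(s₁ ⋯ s_m) = ∑ᵢ sᵢ c^(i-1) mod p`. -/
def karpRabin (p c : ℕ) (s : List ℕ) : ℕ :=
  (∑ i : Fin s.length, s[i] * c ^ (i : ℕ)) % p

/-! ### Word RAM -/

/-- Binary operations on words. -/
inductive Op : Type
  | add | sub | mul | div | mod | and | or | xor | shl | shr

/-- The value of an operation on words of `w` bits: arithmetic is modulo `2 ^ w`. -/
def Op.eval (w : ℕ) : Op → ℕ → ℕ → ℕ
  | .add, a, b => (a + b) % 2 ^ w
  | .sub, a, b => (a + 2 ^ w - b) % 2 ^ w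
  | .mul, a, b => (a * b) % 2 ^ w
  | .div, a, b => a / b
  | .mod, a, b => a % b
  | .and, a, b => a &&& b
  | .or, a, b => a ||| b
  | .xor, a, b => a ^^^ b
  | .shl, a, b => (a <<< b) % 2 ^ w
  | .shr, a, b => a >>> b

/-- Instructions; the arguments `d`, `a`, `b` are names of registers, `t` is a position in the
program. -/
inductive Instr : Type
  /-- `R[d] := v` -/
  | const (d v : ℕ) : Instr
  /-- `R[d] := R[a] op R[b]` -/
  | op (o : Op) (d a b : ℕ) : Instr
  /-- `R[d] := M[R[a]]` -/
  | load (d a : ℕ) : Instr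
  /-- `M[R[a]] := R[b]` -/
  | store (a b : ℕ) : Instr
  /-- if `R[a] < R[b]` then go to `t` -/
  | jlt (a b t : ℕ) : Instr
  /-- if `R[a] = R[b]` then go to `t` -/
  | jeq (a b t : ℕ) : Instr
  /-- stop -/
  | halt : Instr

/-- A configuration of the machine. -/
structure Config : Type where
  pc : ℕ
  reg : ℕ → ℕ
  mem : ℕ → ℕ

/-- The machine has stopped: it is at a `halt` or outside of the program. -/
def Halted (P : List Instr) (x : Config) : Prop := P[x.pc]?.getD .halt = .halt

/-- One step of the machine with words of `w` bits; a stopped machine does not move. -/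
def step (w : ℕ) (P : List Instr) (x : Config) : Config :=
  match P[x.pc]?.getD .halt with
  | .const d v => { x with pc := x.pc + 1, reg := Function.update x.reg d (v % 2 ^ w) }
  | .op o d a b =>
    { x with pc := x.pc + 1, reg := Function.update x.reg d (o.eval w (x.reg a) (x.reg b)) }
  | .load d a => { x with pc := x.pc + 1, reg := Function.update x.reg d (x.mem (x.reg a)) }
  | .store a b => { x with pc := x.pc + 1, mem := Function.update x.mem (x.reg a) (x.reg b) }
  | .jlt a b t => { x with pc := if x.reg a < x.reg b then t else x.pc + 1 }
  | .jeq a b t => { x with pc := if x.reg a = x.reg b then t else x.pc + 1 }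
  | .halt => x

/-- Initial configuration: the data structure `D` is at the start of the memory, the two words of
the query are in registers 0 and 1, and everything else is 0. -/
def start (D : List ℕ) (q₀ q₁ : ℕ) : Config where
  pc := 0
  reg := fun r => if r = 0 then q₀ else if r = 1 then q₁ else 0
  mem := fun a => D.getD a 0

/-- On words of `w` bits, `P` answers the query `(q₀, q₁)` on the data structure `D` with the
word `v`, left in register 0, after at most `time` steps. -/
def Answers (w : ℕ) (P : List Instr) (D : List ℕ) (q₀ q₁ v time : ℕ) : Prop :=
  ∃ t ≤ time, Halted P ((step w P)^[t] (start D q₀ q₁)) ∧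
    ((step w P)^[t] (start D q₀ q₁)).reg 0 = v

end LCG

end

noncomputable section

namespace LCG

/-! ### Symbols -/

/-! A query is a prefix of a suffix of one rule. It is read from left to right, keeping the
signature so far, the matching power of `c` and the number of letters left. Stored prefix signatures
and inverse powers (`c` is invertible modulo `p`) give the signature of any stretch of a rule in
constant time, so the task is to navigate in time O(1 + log ℓ), although the symbols met may be far
longer than `ℓ`.

Two facts about the grammar make this possible. Put `k = 8 (⌊log ℓ⌋ + 1)`. From level `6 (⌊log ℓ⌋ +
1)` on, all symbols inside a window of `ℓ` letters are active, so each block compression halves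
their number up to the two ends of the window, and at level `k` at most two whole symbols remain
(`windowBound_two`). Hence four boundaries of level `k` never lie within `ℓ` letters
(`not_four_boundaries`), and a symbol has height logarithmic in the length of its own expansion
(`Occurs.height_le`). Moreover, the right-hand side of a rule created at a level up to `k` consists
of symbols of length at most `2 ^ (4 (⌊log ℓ⌋ + 1))`, polynomial in `ℓ`.

A galloping search among the symbols of the rule leaves a proper prefix of a single symbol `A` to be
read. If `A` is long, the query climbs the leftmost path of `A` from its leaf to the first symbol
`u` that is longer than the remaining length; this costs the height of the symbol below `u`, which
is O(1 + log ℓ), and the prefix is also one of `u`. A galloping search in the rule of `u` skips at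
least its first symbol unless the rule is a run. So every round adds a boundary of level `k` further
right inside the window, or ends in a symbol of length polynomial in `ℓ` or a run of such a symbol
(`Progress.step`). After three rounds only the latter is possible (`Progress.shallow`), and a
descent from the top through weight-balanced search trees, with repeated squaring at runs, is cheap
because its cost telescopes (`Stores.stops_direct`).

To climb, the machine must know which of the many rules that start with `v` continues the path
towards `A`. Each symbol stores the ranks of these choices, packed into two words. Rules with a
common first symbol are ranked by decreasing size of their subtree in the forest of first symbols,
so that the logarithms of the ranks telescope and the code has O(log n) bits
(`two_pow_codeBits_le`). -/

theorem Sym.induction_children {P : Sym → Prop} (term : ∀ a, P (.term a))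
    (run : ∀ B t, P B → P (.run B t)) (block : ∀ Bs, (∀ B ∈ Bs, P B) → P (.block Bs)) :
    ∀ A, P A
  | .term a => term a
  | .run B t => run B t (Sym.induction_children term run block B)
  | .block Bs => block Bs fun B _ => Sym.induction_children term run block B

/-- The right-hand side of the rule of a symbol. -/
def Sym.children : Sym → List Sym
  | .term _ => []
  | .run B t => List.replicate t B
  | .block Bs => Bs

/-- The height of the parse tree of a symbol. -/
def Sym.height : Sym → ℕ
  | .term _ => 0
  | .run B _ => B.height + 1
  | .block Bs => (Bs.map Sym.height).foldr max 0 + 1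

/-- The first symbol of the rule of a nonterminal. -/
def Sym.first (A : Sym) : Sym := A.children.headD A

@[simp] theorem expand_nil : expand [] = [] := rfl

@[simp] theorem expand_cons (A : Sym) (X : List Sym) : expand (A :: X) = A.exp ++ expand X := by
  simp [expand]

@[simp] theorem expand_append (X Y : List Sym) : expand (X ++ Y) = expand X ++ expand Y := by
  simp [expand]

theorem expand_replicate (t : ℕ) (B : Sym) :
    expand (List.replicate t B) = (List.replicate t B.exp).flatten := by
  simp [expand]

theorem exp_eq_expand_children {A : Sym} (h : A.children ≠ []) : A.exp = expand A.children := by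
  cases A with
  | term a => simp [Sym.children] at h
  | run B t => simp [Sym.exp, Sym.children, expand]
  | block Bs => simp [Sym.exp, Sym.children, expand]

theorem height_lt_of_mem {A B : Sym} (h : B ∈ A.children) : B.height < A.height := by
  cases A with
  | term a => simp [Sym.children] at h
  | run C t =>
    obtain rfl := List.eq_of_mem_replicate h
    simp [Sym.height]
  | block Bs =>
    have : ∀ l : List ℕ, ∀ x ∈ l, x ≤ l.foldr max 0 := by
      intro l
      induction l with
      | nil => simp
      | cons a l ih =>
        intro x hx
        rcases List.mem_cons.1 hx with rfl | hx
        · simp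
        · exact (ih x hx).trans (by simp)
    simp only [Sym.height]
    exact Nat.lt_succ_of_le (this _ _ (List.mem_map_of_mem h))

theorem exists_height_eq {A : Sym} (h : A.children ≠ []) :
    ∃ B ∈ A.children, A.height = B.height + 1 := by
  cases A with
  | term a => simp [Sym.children] at h
  | run C t =>
    refine ⟨C, ?_, by simp [Sym.height]⟩
    cases t with
    | zero => simp [Sym.children] at h
    | succ t => simp [Sym.children]
  | block Bs =>
    have : ∀ l : List Sym, l ≠ [] → ∃ B ∈ l, (l.map Sym.height).foldr max 0 = B.height := by
      intro l
      induction l with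
      | nil => simp
      | cons a l ih =>
        intro _
        rcases eq_or_ne l [] with rfl | hl
        · exact ⟨a, by simp⟩
        · obtain ⟨B, hB, e⟩ := ih hl
          rcases le_total a.height B.height with hc | hc
          · exact ⟨B, by simp [hB], by simp [e, hc]⟩
          · exact ⟨a, by simp, by simp [e, hc]⟩
    obtain ⟨B, hB, e⟩ := this Bs h
    exact ⟨B, hB, by simp [Sym.height, e]⟩

theorem first_mem {A : Sym} (h : A.children ≠ []) : A.first ∈ A.children := by
  unfold Sym.first
  cases hA : A.children with
  | nil => exact absurd hA h
  | cons B l => simp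

theorem children_eq_first_cons {A : Sym} (h : A.children ≠ []) :
    ∃ X, A.children = A.first :: X := by
  unfold Sym.first
  cases hA : A.children with
  | nil => exact absurd hA h
  | cons B l => simp

/-! ### Grouping of symbols from one level to the next -/

/-- `A` replaces the group `g` at level `k`. -/
def Groups (k : ℕ) (g : List Sym) (A : Sym) : Prop :=
  g = [A] ∨ (2 ≤ g.length ∧ A.children = g ∧ ∀ B ∈ g, Active k B)

theorem Groups.expand_eq {k : ℕ} {g : List Sym} {A : Sym} (h : Groups k g A) :
    expand g = A.exp := by
  rcases h with rfl | ⟨h2, rfl, -⟩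
  · simp
  · refine (exp_eq_expand_children ?_).symm
    rintro h; simp [h] at h2

theorem Groups.ne_nil {k : ℕ} {g : List Sym} {A : Sym} (h : Groups k g A) : g ≠ [] := by
  rcases h with rfl | ⟨h2, -, -⟩
  · simp
  · rintro rfl; simp at h2

theorem forall₂_flatMap {α β : Type} {R : List α → β → Prop} {f : List α → List β} :
    ∀ G : List (List α), (∀ g ∈ G, ∃ A, f g = [A] ∧ R g A) → List.Forall₂ R G (G.flatMap f)
  | [], _ => by simp
  | g :: G, h => by
    obtain ⟨A, e, hA⟩ := h g (by simp)
    rw [List.flatMap_cons, e]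
    exact .cons hA (forall₂_flatMap G fun g' h' => h g' (by simp [h']))

theorem rle_groups (k : ℕ) (S : List Sym) :
    ∃ G : List (List Sym), G.flatten = S ∧ List.Forall₂ (Groups k) G (rle k S) := by
  refine ⟨_, List.flatten_splitBy _ S, forall₂_flatMap _ fun g hg => ?_⟩
  have hne : g ≠ [] := List.ne_nil_of_mem_splitBy hg
  have hc := List.isChain_of_mem_splitBy hg
  match g, hne, hc with
  | [A], _, _ => exact ⟨A, rfl, .inl rfl⟩
  | A :: B :: g, _, hc =>
    have key : ∀ (l : List Sym) (A : Sym),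
        List.IsChain (fun A B => decide (A = B ∧ Active k A) = true) (A :: l) →
        ∀ B ∈ l, B = A := by
      intro l
      induction l with
      | nil => simp
      | cons C l ih =>
        intro A h B hB
        rw [List.isChain_cons_cons] at h
        have h1 := h.1
        simp only [decide_eq_true_eq] at h1
        obtain ⟨rfl, -⟩ := h1
        rcases List.mem_cons.1 hB with rfl | hB
        · rfl
        · exact ih _ h.2 B hB
    have e := key _ _ hc
    have hact : Active k A := by
      rw [List.isChain_cons_cons] at hc
      have h1 := hc.1
      simp only [decide_eq_true_eq] at h1
      exact h1.2
    have e2 : A :: B :: g = List.replicate ((B :: g).length + 1) A := by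
      rw [List.eq_replicate_iff]
      exact ⟨by simp, by simpa using e⟩
    refine ⟨.run A ((B :: g).length + 1), rfl, .inr ⟨by simp, e2.symm, ?_⟩⟩
    intro C hC
    rw [e2] at hC
    rw [List.eq_of_mem_replicate hC]
    exact hact

theorem flatten_blocks (π : Sym → ℕ) (k : ℕ) :
    ∀ (S : List Sym) (prev : Option Sym), (blocks π k prev S).flatten = S
  | [], prev => by simp [blocks]
  | [A], prev => by simp [blocks]
  | A :: B :: S, prev => by
    have ih := flatten_blocks π k (B :: S) (some A)
    rw [blocks]
    split_ifs
    · simp [ih]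
    · cases h : blocks π k (some A) (B :: S) with
      | nil => simp [h] at ih
      | cons g G => simpa [h] using ih

theorem ne_nil_of_mem_blocks (π : Sym → ℕ) (k : ℕ) :
    ∀ (S : List Sym) (prev : Option Sym), ∀ g ∈ blocks π k prev S, g ≠ []
  | [], prev => by simp [blocks]
  | [A], prev => by simp [blocks]
  | A :: B :: S, prev => by
    have ih := ne_nil_of_mem_blocks π k (B :: S) (some A)
    rw [blocks]
    split_ifs
    · simpa using ih
    · cases h : blocks π k (some A) (B :: S) with
      | nil => simp
      | cons g G =>
        rw [h] at ih
        simp only [List.modifyHead_cons, List.mem_cons, forall_eq_or_imp]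
        exact ⟨by simp, fun a ha => ih a (by simp [ha])⟩

/-- The left neighbour of the last symbol of a prefix is the second-last symbol, and this does not
depend on what stands further left. It lets `blockEnd_of_blocks` replace the symbol `prev` of the
recursion by the whole string read so far. -/
theorem getLast?_dropLast_append {α : Type} (a : α) (X : List α) {Y : List α} (hY : Y ≠ []) :
    (X ++ a :: Y).dropLast.getLast? = (a :: Y).dropLast.getLast? := by
  rw [List.dropLast_append_of_ne_nil (by simp), List.dropLast_cons_of_ne_nil hY,
    List.getLast?_append, List.getLast?_cons, Option.some_or]

/-- The boundary between two consecutive blocks is a block end. -/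
theorem blockEnd_of_blocks (π : Sym → ℕ) (k : ℕ) :
    ∀ (S : List Sym) (prev : Option Sym) (G₁ G₂ : List (List Sym)) (g₁ g₂ : List Sym),
      blocks π k prev S = G₁ ++ g₁ :: g₂ :: G₂ →
      ∃ a b, g₁.getLast? = some a ∧ g₂.head? = some b ∧
        BlockEnd π k (prev.toList ++ G₁.flatten ++ g₁).dropLast.getLast? a b
  | [], prev, G₁, G₂, g₁, g₂ => by simp [blocks]
  | [A], prev, G₁, G₂, g₁, g₂ => by
    intro h
    have := congrArg List.length h
    simp [blocks] at this
    omega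
  | A :: B :: S, prev, G₁, G₂, g₁, g₂ => by
    have ih := blockEnd_of_blocks π k (B :: S) (some A)
    have hne := ne_nil_of_mem_blocks π k (B :: S) (some A)
    have hfl := flatten_blocks π k (B :: S) (some A)
    rw [blocks]
    split_ifs with hb
    · intro h
      rcases G₁ with _ | ⟨g₀, G₁⟩
      · simp only [List.nil_append, List.cons.injEq] at h
        obtain ⟨rfl, h⟩ := h
        have hg : g₂ ≠ [] := hne g₂ (by simp [h])
        obtain ⟨b, g₂, rfl⟩ := List.exists_cons_of_ne_nil hg
        rw [h] at hfl
        simp only [List.flatten_cons, List.cons_append, List.cons.injEq] at hfl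
        obtain ⟨rfl, -⟩ := hfl
        refine ⟨A, b, rfl, rfl, ?_⟩
        cases prev <;> simpa using hb
      · simp only [List.cons_append, List.cons.injEq] at h
        obtain ⟨rfl, h⟩ := h
        obtain ⟨a, b, ha, hb, hE⟩ := ih _ _ _ _ h
        refine ⟨a, b, ha, hb, ?_⟩
        have hg : g₁ ≠ [] := hne g₁ (by simp [h])
        convert hE using 1
        simpa using getLast?_dropLast_append A prev.toList (Y := G₁.flatten ++ g₁) (by simp [hg])
    · intro h
      cases hbl : blocks π k (some A) (B :: S) with
      | nil => simp [hbl] at hfl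
      | cons g G =>
        rw [hbl, List.modifyHead_cons] at h
        rcases G₁ with _ | ⟨g₀, G₁⟩
        · simp only [List.nil_append, List.cons.injEq] at h
          obtain ⟨rfl, rfl⟩ := h
          obtain ⟨a, b, ha, hb, hE⟩ := ih [] _ _ _ hbl
          have hg : g ≠ [] := hne g (by simp [hbl])
          refine ⟨a, b, by simp [List.getLast?_cons, ha], hb, ?_⟩
          convert hE using 1
          simpa using getLast?_dropLast_append A prev.toList hg
        · simp only [List.cons_append, List.cons.injEq] at h
          obtain ⟨rfl, rfl⟩ := h
          obtain ⟨a, b, ha, hb, hE⟩ := ih (g :: G₁) _ _ _ hbl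
          have hg : g ≠ [] := hne g (by simp [hbl])
          refine ⟨a, b, ha, hb, ?_⟩
          convert hE using 1
          simpa using getLast?_dropLast_append A prev.toList
            (Y := g ++ (G₁.flatten ++ g₁)) (by simp [hg])

/-- A block between two others consists of at least two symbols, if the symbols are active. -/
theorem two_le_length_of_blocks {π : Sym → ℕ} {k : ℕ} {S : List Sym}
    {G₁ G₂ : List (List Sym)} {g₁ g₂ g₃ : List Sym}
    (h : blocks π k none S = G₁ ++ g₁ :: g₂ :: g₃ :: G₂)
    (h₁ : ∀ B ∈ g₁, Active k B) (h₂ : ∀ B ∈ g₂, Active k B) (h₃ : ∀ B ∈ g₃, Active k B) :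
    2 ≤ g₂.length := by
  have hg₁ : g₁ ≠ [] := ne_nil_of_mem_blocks π k S none g₁ (by simp [h])
  obtain ⟨a, b, ha, hb, hE⟩ := blockEnd_of_blocks π k S none G₁ _ _ _ h
  obtain ⟨a', b', ha', hb', hE'⟩ :=
    blockEnd_of_blocks π k S none (G₁ ++ [g₁]) G₂ g₂ g₃ (by simp [h])
  by_contra hlt
  match g₂ with
  | [] => simp at hb
  | c :: d :: g => simp at hlt
  | [c] =>
    simp only [List.head?_cons, Option.some.injEq] at hb
    simp only [List.getLast?_singleton, Option.some.injEq] at ha'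
    subst hb ha'
    -- Since all symbols are active, the block end before `c` makes `a` a local minimum, so `π a < π
    -- c`; the block end after `c` makes `c` a local minimum, so `π a > π c`.
    rcases hE with hE | hE | ⟨C, -, -, hE⟩
    · exact hE (h₁ _ (List.mem_of_getLast? ha))
    · exact hE (h₂ _ (by simp))
    · rcases hE' with hE' | hE' | ⟨D, hD, hE', -⟩
      · exact hE' (h₂ _ (by simp))
      · exact hE' (h₃ _ (List.mem_of_mem_head? hb'))
      · simp only [List.dropLast_concat, Option.toList_none, List.nil_append,
          List.flatten_append, List.flatten_cons, List.flatten_nil, List.append_nil] at hD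
        rw [List.getLast?_append, ha] at hD
        simp only [Option.some_or, Option.mem_def, Option.some.injEq] at hD
        subst hD
        omega

theorem bc_groups (π : Sym → ℕ) (k : ℕ) (S : List Sym) :
    List.Forall₂ (fun g A => g = [A] ∨ (2 ≤ g.length ∧ A.children = g)) (blocks π k none S)
      (bc π k S) := by
  refine forall₂_flatMap _ fun g hg => ?_
  match g, ne_nil_of_mem_blocks π k S none g hg with
  | [A], _ => exact ⟨A, rfl, .inl rfl⟩
  | A :: B :: g, _ => exact ⟨_, rfl, .inr ⟨by simp, rfl⟩⟩

/-- Two neighbours share a block only where `BlockEnd` fails, and this failure makes both of them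
active. -/
theorem active_of_mem_blocks (π : Sym → ℕ) (k : ℕ) :
    ∀ (S : List Sym) (prev : Option Sym), ∀ g ∈ blocks π k prev S, 2 ≤ g.length →
      ∀ B ∈ g, Active k B
  | [], prev => by simp [blocks]
  | [A], prev => by simp [blocks]
  | A :: B :: S, prev => by
    have ih := active_of_mem_blocks π k (B :: S) (some A)
    have hfl := flatten_blocks π k (B :: S) (some A)
    have hne := ne_nil_of_mem_blocks π k (B :: S) (some A)
    rw [blocks]
    split_ifs with hb
    · intro g hg h2
      rcases List.mem_cons.1 hg with rfl | hg
      · simp at h2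
      · exact ih g hg h2
    · have hA : Active k A := by
        by_contra h; exact hb (.inl h)
      have hB : Active k B := by
        by_contra h; exact hb (.inr (.inl h))
      cases h : blocks π k (some A) (B :: S) with
      | nil => simp
      | cons g G =>
        rw [h] at ih hfl hne
        intro g' hg' h2
        rw [List.modifyHead_cons] at hg'
        rcases List.mem_cons.1 hg' with rfl | hg'
        · have hg := hne g (by simp)
          match g, hg with
          | [C], _ =>
            simp only [List.flatten_cons, List.cons_append, List.cons.injEq] at hfl
            obtain ⟨rfl, -⟩ := hfl
            simp [hA, hB]
          | C :: D :: g, _ =>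
            intro E hE
            rcases List.mem_cons.1 hE with rfl | hE
            · exact hA
            · exact ih _ (by simp) (by simp) E hE
        · exact ih _ (by simp [hg']) h2

theorem bc_groups_active (π : Sym → ℕ) (k : ℕ) (S : List Sym) :
    List.Forall₂ (Groups k) (blocks π k none S) (bc π k S) := by
  have h := bc_groups π k S
  rw [List.forall₂_iff_get] at h ⊢
  refine ⟨h.1, fun i h₁ h₂ => ?_⟩
  rcases h.2 i h₁ h₂ with h | ⟨h2, h⟩
  · exact .inl h
  · exact .inr ⟨h2, h, active_of_mem_blocks π k S none _ (List.get_mem _ _) h2⟩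

theorem level_succ_groups (π : ℕ → Sym → ℕ) (T : List ℕ) (k : ℕ) :
    ∃ G : List (List Sym), G.flatten = level π T k ∧
      List.Forall₂ (Groups (k + 1)) G (level π T (k + 1)) := by
  rw [level]
  split_ifs
  · exact rle_groups _ _
  · exact ⟨_, flatten_blocks _ _ _ none, bc_groups_active _ _ _⟩

section

theorem split_forall₂ {α β : Type} {R : α → β → Prop} {G : List α} {X Y : List β}
    (h : List.Forall₂ R G (X ++ Y)) :
    ∃ G₁ G₂, G = G₁ ++ G₂ ∧ List.Forall₂ R G₁ X ∧ List.Forall₂ R G₂ Y :=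
  ⟨G.take X.length, G.drop X.length, (List.take_append_drop _ _).symm,
    List.forall₂_take_append _ _ _ h, List.forall₂_drop_append _ _ _ h⟩

theorem expand_flatten_of_groups {k : ℕ} {G : List (List Sym)} {Z : List Sym}
    (h : List.Forall₂ (Groups k) G Z) : expand G.flatten = expand Z := by
  induction h with
  | nil => simp
  | cons h _ ih => simp [ih, h.expand_eq]

theorem length_le_of_groups {k : ℕ} {G : List (List Sym)} {Z : List Sym}
    (h : List.Forall₂ (Groups k) G Z) : Z.length ≤ G.flatten.length := by
  induction h with
  | nil => simp
  | cons h _ ih =>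
    have := List.length_pos_iff.2 h.ne_nil
    simp only [List.length_cons, List.flatten_cons, List.length_append]
    omega

theorem exp_length_le_of_mem {A : Sym} {X : List Sym} (h : A ∈ X) :
    A.exp.length ≤ (expand X).length := by
  obtain ⟨L, R, rfl⟩ := List.append_of_mem h
  simp only [expand_append, expand_cons, List.length_append]
  omega

theorem length_exp_pos_of_mem_level {π : ℕ → Sym → ℕ} {T : List ℕ} {k : ℕ} :
    ∀ A ∈ level π T k, 1 ≤ A.exp.length := by
  induction k with
  | zero =>
    intro A hA
    simp only [level, List.mem_map] at hA
    obtain ⟨a, -, rfl⟩ := hA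
    simp [Sym.exp]
  | succ k ih =>
    intro A hA
    obtain ⟨L, R, e⟩ := List.append_of_mem hA
    obtain ⟨G, hG, hf⟩ := level_succ_groups π T k
    rw [e] at hf
    obtain ⟨G₁, G₂, rfl, -, h⟩ := split_forall₂ hf
    cases h with
    | cons hg _ =>
      rename_i g G₂ _
      rw [← hg.expand_eq]
      obtain ⟨B, g, rfl⟩ := List.exists_cons_of_ne_nil hg.ne_nil
      have := ih B (by rw [← hG]; simp)
      simp only [expand_cons, List.length_append]
      omega

theorem expand_level (π : ℕ → Sym → ℕ) (T : List ℕ) (k : ℕ) : expand (level π T k) = T := by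
  induction k with
  | zero =>
    rw [level]
    induction T with
    | nil => simp
    | cons a T ih => simp [ih, Sym.exp]
  | succ k ih =>
    obtain ⟨G, hG, hf⟩ := level_succ_groups π T k
    rw [← expand_flatten_of_groups hf, hG, ih]

theorem length_le_length_expand {X : List Sym} (h : ∀ A ∈ X, 1 ≤ A.exp.length) :
    X.length ≤ (expand X).length := by
  induction X with
  | nil => simp
  | cons A X ih =>
    have h1 := h A (by simp)
    have h2 := ih fun B hB => h B (by simp [hB])
    simp only [List.length_cons, expand_cons, List.length_append]
    omega

/-! ### Windows -/

/-- At level `k`, a factor that expands to at most `ℓ` letters has at most `m` symbols. -/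
def WindowBound (π : ℕ → Sym → ℕ) (T : List ℕ) (k ℓ m : ℕ) : Prop :=
  ∀ L Z R, level π T k = L ++ Z ++ R → (expand Z).length ≤ ℓ → Z.length ≤ m

theorem WindowBound.trivial (π : ℕ → Sym → ℕ) (T : List ℕ) (k ℓ : ℕ) :
    WindowBound π T k ℓ ℓ := by
  intro L Z R h hZ
  refine (length_le_length_expand fun A hA => ?_).trans hZ
  exact length_exp_pos_of_mem_level (π := π) (T := T) (k := k) A (by rw [h]; simp [hA])

theorem WindowBound.succ {π : ℕ → Sym → ℕ} {T : List ℕ} {k ℓ m : ℕ}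
    (hw : WindowBound π T k ℓ m) : WindowBound π T (k + 1) ℓ m := by
  intro L Z R h hZ
  obtain ⟨G, hG, hf⟩ := level_succ_groups π T k
  rw [h] at hf
  obtain ⟨G₁, G₃, rfl, hf, -⟩ := split_forall₂ hf
  obtain ⟨G₁, G₂, rfl, -, hf⟩ := split_forall₂ hf
  exact (length_le_of_groups hf).trans
    (hw G₁.flatten _ G₃.flatten (by simp [← hG]) (by rwa [expand_flatten_of_groups hf]))

theorem two_mul_length_le_aux {α : Type} (G : List (List α)) (hne : ∀ g ∈ G, g ≠ [])
    (h : ∀ G₁ g₁ g₂ G₂, G = G₁ ++ g₁ :: g₂ :: G₂ → 2 ≤ g₁.length) :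
    2 * G.length ≤ G.flatten.length + 1 := by
  induction G with
  | nil => simp
  | cons g G ih =>
    have ih := ih (fun g hg => hne g (by simp [hg]))
      fun G₁ g₁ g₂ G₂ e => h (g :: G₁) g₁ g₂ G₂ (by simp [e])
    rcases G with _ | ⟨g', G⟩
    · have := List.length_pos_iff.2 (hne g (by simp))
      simp only [List.length_cons, List.length_nil, List.flatten_cons, List.flatten_nil,
        List.length_append]
      omega
    · have := h [] g g' G rfl
      simp only [List.length_cons, List.flatten_cons, List.length_append] at ih ⊢
      omega

/-- All groups but the first and the last have at least two elements, and these two are nonempty,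
which costs 2 in the count. -/
theorem two_mul_length_le {α : Type} (G : List (List α)) (hne : ∀ g ∈ G, g ≠ [])
    (h : ∀ G₁ g₁ g₂ g₃ G₂, G = G₁ ++ g₁ :: g₂ :: g₃ :: G₂ → 2 ≤ g₂.length) :
    2 * G.length ≤ G.flatten.length + 2 := by
  rcases G with _ | ⟨g, G⟩
  · simp
  have h1 := two_mul_length_le_aux G (fun g hg => hne g (by simp [hg]))
    fun G₁ g₁ g₂ G₂ e => by
      rcases List.eq_nil_or_concat G₁ with rfl | ⟨G₁, g₀, rfl⟩
      · exact h [] g g₁ g₂ G₂ (by simp [e])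
      · exact h (g :: G₁) g₀ g₁ g₂ G₂ (by simp [e])
  have := List.length_pos_iff.2 (hne g (by simp))
  simp only [List.length_cons, List.flatten_cons, List.length_append]
  omega

/-- Every symbol inside the window is at most as long as the window, hence active, so
`two_le_length_of_blocks` applies to all blocks except the two at the ends. -/
theorem WindowBound.succ_even {π : ℕ → Sym → ℕ} {T : List ℕ} {k ℓ m : ℕ}
    (hw : WindowBound π T k ℓ m) (hk : ¬ Odd (k + 1)) (hℓ : (ℓ : ℚ) ≤ ell (k + 1)) :
    WindowBound π T (k + 1) ℓ (m / 2 + 1) := by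
  intro L Z R h hZ
  rw [level, if_neg hk] at h
  have hf := bc_groups_active (π (k + 1)) (k + 1) (level π T k)
  have hG := flatten_blocks (π (k + 1)) (k + 1) (level π T k) none
  rw [h] at hf
  obtain ⟨G', G₃, e, hf, -⟩ := split_forall₂ hf
  obtain ⟨G₁, G₂, rfl, -, hf⟩ := split_forall₂ hf
  have hlen := expand_flatten_of_groups hf
  have hm := hw G₁.flatten G₂.flatten G₃.flatten (by rw [← hG, e]; simp) (by rwa [hlen])
  have hact : ∀ g ∈ G₂, ∀ B ∈ g, Active (k + 1) B := fun g hg B hB => by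
    have : B.exp.length ≤ ℓ :=
      (exp_length_le_of_mem (List.mem_flatten.2 ⟨g, hg, hB⟩)).trans (by rwa [hlen])
    refine le_trans ?_ hℓ
    exact_mod_cast this
  have := two_mul_length_le G₂
    (fun g hg => ne_nil_of_mem_blocks _ _ _ none g (by rw [e]; simp [hg]))
    fun H₁ g₁ g₂ g₃ H₂ e' => by
      refine two_le_length_of_blocks (G₁ := G₁ ++ H₁) (G₂ := H₂ ++ G₃) (g₁ := g₁) (g₃ := g₃)
        (by rw [e, e']; simp) (hact _ ?_) (hact _ ?_) (hact _ ?_) <;> simp [e']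
  have h2 := hf.length_eq
  omega

/-- Six levels raise `ell` by the factor `(4/3)^3 > 2`. -/
theorem le_ell {ℓ k : ℕ} (h : 6 * (Nat.log 2 ℓ + 1) + 1 ≤ k) : (ℓ : ℚ) ≤ ell k := by
  have h1 : ℓ < 2 ^ (Nat.log 2 ℓ + 1) := Nat.lt_pow_succ_log_self (by norm_num) ℓ
  have h2 : (ℓ : ℚ) ≤ 2 ^ (Nat.log 2 ℓ + 1) := by exact_mod_cast h1.le
  refine h2.trans ?_
  calc (2 : ℚ) ^ (Nat.log 2 ℓ + 1) ≤ ((4 / 3) ^ 3) ^ (Nat.log 2 ℓ + 1) :=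
        pow_le_pow_left₀ (by norm_num) (by norm_num) _
    _ = (4 / 3) ^ (3 * (Nat.log 2 ℓ + 1)) := by rw [pow_mul]
    _ ≤ _ := pow_le_pow_right₀ (by norm_num) (by omega)

theorem ell_le {k m : ℕ} (h : k ≤ 2 * m) : ell k ≤ 2 ^ m := by
  calc ell k ≤ (4 / 3 : ℚ) ^ m := pow_le_pow_right₀ (by norm_num) (by omega)
    _ ≤ _ := pow_le_pow_left₀ (by norm_num) (by norm_num) _

/-- Start at level `6 (⌊log ℓ⌋ + 1)` with the trivial bound `ℓ`. Every two levels map the bound `m`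
to `m / 2 + 1`, which keeps the form `ℓ / 2 ^ i + 2`; after `⌊log ℓ⌋ + 1` such pairs the quotient is
0. -/
theorem windowBound_two (π : ℕ → Sym → ℕ) (T : List ℕ) (ℓ : ℕ) :
    WindowBound π T (8 * (Nat.log 2 ℓ + 1)) ℓ 2 := by
  have key : ∀ i, WindowBound π T (6 * (Nat.log 2 ℓ + 1) + 2 * i) ℓ (ℓ / 2 ^ i + 2) := by
    intro i
    induction i with
    | zero =>
      intro L Z R h hZ
      have := WindowBound.trivial π T _ ℓ L Z R h hZ
      simp only [pow_zero, Nat.div_one]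
      omega
    | succ i ih =>
      have := ih.succ.succ_even (by
        rw [Nat.not_odd_iff_even]
        exact ⟨3 * (Nat.log 2 ℓ + 1) + i + 1, by ring⟩)
        (le_ell (by omega))
      convert this using 1
      · ring
      · rw [pow_succ, ← Nat.div_div_eq_div_mul]
        omega
  have := key (Nat.log 2 ℓ + 1)
  rw [Nat.div_eq_of_lt (Nat.lt_pow_succ_log_self (by norm_num) ℓ)] at this
  convert this using 1
  ring

/-! ### Boundaries and occurrences -/

/-- The string `S_k` has a boundary between symbols after the first `x` letters of the text. -/
def Boundary (π : ℕ → Sym → ℕ) (T : List ℕ) (k x : ℕ) : Prop :=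
  ∃ L R, level π T k = L ++ R ∧ (expand L).length = x

/-- The string `X` of symbols occurs in `S_k`, after the first `x` letters of the text. -/
def Occurs (π : ℕ → Sym → ℕ) (T : List ℕ) (k x : ℕ) (X : List Sym) : Prop :=
  ∃ L R, level π T k = L ++ X ++ R ∧ (expand L).length = x

variable {π : ℕ → Sym → ℕ} {T : List ℕ}

/-- Going up a level only merges neighbouring symbols, so boundaries disappear but never arise. -/
theorem Boundary.of_le {k x j : ℕ} (h : Boundary π T k x) (hj : j ≤ k) : Boundary π T j x := by
  induction hj using Nat.decreasingInduction with
  | self => exact h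
  | of_succ j _ ih =>
    obtain ⟨L, R, e, hx⟩ := ih
    obtain ⟨G, hG, hf⟩ := level_succ_groups π T j
    rw [e] at hf
    obtain ⟨G₁, G₂, rfl, hf, -⟩ := split_forall₂ hf
    exact ⟨G₁.flatten, G₂.flatten, by simp [← hG], by rw [expand_flatten_of_groups hf, hx]⟩

theorem Occurs.boundary {k x : ℕ} {X : List Sym} (h : Occurs π T k x X) : Boundary π T k x := by
  obtain ⟨L, R, e, hx⟩ := h
  exact ⟨L, X ++ R, by simp [e], hx⟩

theorem Occurs.right {k x : ℕ} {X Y : List Sym} (h : Occurs π T k x (X ++ Y)) :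
    Occurs π T k (x + (expand X).length) Y := by
  obtain ⟨L, R, e, hx⟩ := h
  exact ⟨L ++ X, R, by simp [e], by simp [hx]⟩

theorem Occurs.left {k x : ℕ} {X Y : List Sym} (h : Occurs π T k x (X ++ Y)) :
    Occurs π T k x X := by
  obtain ⟨L, R, e, hx⟩ := h
  exact ⟨L, Y ++ R, by simp [e], hx⟩

theorem Occurs.length_pos {k x : ℕ} {X : List Sym} (h : Occurs π T k x X) :
    ∀ A ∈ X, 1 ≤ A.exp.length := by
  obtain ⟨L, R, e, hx⟩ := h
  exact fun A hA => length_exp_pos_of_mem_level (π := π) (T := T) (k := k) A (by rw [e]; simp [hA])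

theorem Occurs.length_le {k x : ℕ} {X : List Sym} (h : Occurs π T k x X) :
    x + (expand X).length ≤ T.length := by
  obtain ⟨L, R, e, hx⟩ := h
  rw [← expand_level π T k, e]
  simp [hx]

theorem Occurs.boundary_right {k x : ℕ} {X : List Sym} (h : Occurs π T k x X) :
    Boundary π T k (x + (expand X).length) := by
  rw [← List.append_nil X] at h
  simpa using h.right.boundary

/-- An occurrence of a nonterminal is created from an occurrence of the right-hand side of its
rule at a lower level. -/
theorem Occurs.children {k x : ℕ} {A : Sym} (h : Occurs π T k x [A]) (hA : A.children ≠ []) :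
    ∃ j < k, Occurs π T j x A.children ∧ 2 ≤ A.children.length ∧
      ∀ B ∈ A.children, Active (j + 1) B := by
  induction k with
  | zero =>
    obtain ⟨L, R, e, -⟩ := h
    have : A ∈ level π T 0 := by rw [e]; simp
    simp only [level, List.mem_map] at this
    obtain ⟨a, -, rfl⟩ := this
    simp [Sym.children] at hA
  | succ k ih =>
    obtain ⟨L, R, e, hx⟩ := h
    obtain ⟨G, hG, hf⟩ := level_succ_groups π T k
    rw [e] at hf
    obtain ⟨G₁, G₃, rfl, hf, -⟩ := split_forall₂ hf
    obtain ⟨G₁, G₂, rfl, hL, hf⟩ := split_forall₂ hf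
    rw [List.forall₂_cons_right_iff] at hf
    obtain ⟨g, _, hg, hn, rfl⟩ := hf
    obtain rfl := List.forall₂_nil_right_iff.1 hn
    have ho : Occurs π T k x g :=
      ⟨G₁.flatten, G₃.flatten, by simp [← hG], by rw [expand_flatten_of_groups hL, hx]⟩
    rcases hg with rfl | ⟨h2, rfl, hact⟩
    · obtain ⟨j, hj, h⟩ := ih ho
      exact ⟨j, by omega, h⟩
    · exact ⟨k, by omega, ho, h2, hact⟩

theorem Occurs.first {k x : ℕ} {A : Sym} (h : Occurs π T k x [A]) (hA : A.children ≠ []) :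
    ∃ j < k, Occurs π T j x [A.first] := by
  obtain ⟨j, hj, ho, -, -⟩ := h.children hA
  obtain ⟨X, e⟩ := children_eq_first_cons hA
  rw [e] at ho
  exact ⟨j, hj, Occurs.left (X := [A.first]) (Y := X) ho⟩

/-- The interval of a child is strictly smaller than that of its parent because a rule has at least
two symbols, none of them empty. The right end of the parent is recorded as a boundary of the lower
level, where the parent itself need not occur. -/
theorem Occurs.mem_children {k x : ℕ} {A B : Sym} (h : Occurs π T k x [A])
    (hB : B ∈ A.children) :
    ∃ j < k, ∃ y, Occurs π T j y [B] ∧ x ≤ y ∧ y + B.exp.length ≤ x + A.exp.length ∧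
      (x < y ∨ y + B.exp.length < x + A.exp.length) ∧ Boundary π T j (x + A.exp.length) := by
  have hA : A.children ≠ [] := List.ne_nil_of_mem hB
  obtain ⟨j, hj, ho, h2, -⟩ := h.children hA
  obtain ⟨X, Y, e⟩ := List.append_of_mem hB
  have hbd := ho.boundary_right
  have hpos : ∀ C ∈ A.children, 1 ≤ C.exp.length := ho.length_pos
  rw [← exp_eq_expand_children hA] at hbd
  have hlen := congrArg List.length (exp_eq_expand_children hA)
  rw [e] at ho h2 hlen hpos
  have ho' : Occurs π T j (x + (expand X).length) [B] :=
    Occurs.left (X := [B]) (Y := Y) ho.right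
  have hX := length_le_length_expand (X := X) fun C hC => hpos C (by simp [hC])
  have hY := length_le_length_expand (X := Y) fun C hC => hpos C (by simp [hC])
  simp only [expand_append, expand_cons, List.length_append] at hlen
  simp only [List.length_append, List.length_cons] at h2
  exact ⟨j, hj, _, ho', by omega, by omega, by omega, hbd⟩

theorem height_eq_zero {A : Sym} (h : 1 ≤ A.exp.length) (hc : A.children = []) :
    A.height = 0 := by
  cases A with
  | term a => simp [Sym.height]
  | run B t =>
    simp only [Sym.children, List.replicate_eq_nil_iff] at hc
    simp [hc, Sym.exp] at h
  | block Bs =>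
    simp only [Sym.children] at hc
    simp [hc, Sym.exp] at h

theorem height_le_of_mem_level {k : ℕ} : ∀ A ∈ level π T k, A.height ≤ k := by
  intro A hA
  induction k using Nat.strong_induction_on generalizing A with
  | _ k ih =>
    by_cases hc : A.children = []
    · simp [height_eq_zero (length_exp_pos_of_mem_level A hA) hc]
    · obtain ⟨B, hB, e⟩ := exists_height_eq hc
      obtain ⟨L, R, e'⟩ := List.append_of_mem hA
      have ho : Occurs π T k (expand L).length [A] := ⟨L, R, by simp [e'], rfl⟩
      obtain ⟨j, hj, y, ⟨L', R', e'', -⟩, -⟩ := ho.mem_children hB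
      have := ih j hj B (by rw [e'']; simp)
      omega

/-- Four boundaries are not contained in a short window. -/
theorem not_four_boundaries {k ℓ : ℕ} (hw : WindowBound π T k ℓ 2) {x₀ x₁ x₂ x₃ : ℕ}
    (h₀ : Boundary π T k x₀) (h₁ : Boundary π T k x₁) (h₂ : Boundary π T k x₂)
    (h₃ : Boundary π T k x₃) (h₀₁ : x₀ < x₁) (h₁₂ : x₁ < x₂) (h₂₃ : x₂ < x₃)
    (hℓ : x₃ ≤ x₀ + ℓ) : False := by
  have key : ∀ {L R L' R' : List Sym}, level π T k = L ++ R → level π T k = L' ++ R' →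
      (expand L).length < (expand L').length → ∃ X, X ≠ [] ∧ L' = L ++ X := by
    intro L R L' R' e e' hlt
    rcases List.prefix_or_prefix_of_prefix (l₃ := level π T k) ⟨R, e.symm⟩ ⟨R', e'.symm⟩ with
      ⟨X, rfl⟩ | ⟨X, rfl⟩
    · refine ⟨X, ?_, rfl⟩
      rintro rfl
      simp at hlt
    · simp only [expand_append, List.length_append] at hlt
      omega
  obtain ⟨L₀, R₀, e₀, rfl⟩ := h₀
  obtain ⟨L₁, R₁, e₁, rfl⟩ := h₁
  obtain ⟨L₂, R₂, e₂, rfl⟩ := h₂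
  obtain ⟨L₃, R₃, e₃, rfl⟩ := h₃
  obtain ⟨X₀, hX₀, rfl⟩ := key e₀ e₁ h₀₁
  obtain ⟨X₁, hX₁, rfl⟩ := key e₁ e₂ h₁₂
  obtain ⟨X₂, hX₂, rfl⟩ := key e₂ e₃ h₂₃
  have := hw L₀ (X₀ ++ X₁ ++ X₂) R₃ (by simp [e₃]) (by
    simp only [expand_append, List.length_append] at hℓ ⊢
    omega)
  have h0 := List.length_pos_iff.2 hX₀
  have h1 := List.length_pos_iff.2 hX₁
  have h2 := List.length_pos_iff.2 hX₂
  simp only [List.length_append] at this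
  omega

/-- If the height exceeded `k₁ + 1`, two steps to a highest child would give three strictly nested
intervals whose ends are all boundaries of level `k₁`, since a symbol of height at least `k₁` occurs
only from level `k₁` on. That is at least four boundaries inside the expansion of `A`. -/
theorem Occurs.height_le {k x : ℕ} {A : Sym} (h : Occurs π T k x [A]) :
    A.height ≤ 8 * (Nat.log 2 A.exp.length + 1) + 1 := by
  have hw := windowBound_two π T A.exp.length
  set k₁ := 8 * (Nat.log 2 A.exp.length + 1)
  have lev : ∀ {k x : ℕ} {A : Sym}, Occurs π T k x [A] → A.height ≤ k := by
    rintro k x A ⟨L, R, e, -⟩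
    exact height_le_of_mem_level A (by rw [e]; simp)
  have step : ∀ {k x : ℕ} {A : Sym}, Occurs π T k x [A] → k₁ < A.height →
      ∃ j ≥ k₁, j < k ∧ ∃ B y, B.height + 1 = A.height ∧
      Occurs π T j y [B] ∧ x ≤ y ∧ y + B.exp.length ≤ x + A.exp.length ∧
      (x < y ∨ y + B.exp.length < x + A.exp.length) ∧ Boundary π T j (x + A.exp.length) := by
    intro k x A h hk
    have hc : A.children ≠ [] := by
      intro hc
      have := height_eq_zero (h.length_pos A (by simp)) hc
      omega
    obtain ⟨B, hB, e⟩ := exists_height_eq hc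
    obtain ⟨j, hj, y, ho, h⟩ := h.mem_children hB
    have := lev ho
    exact ⟨j, by omega, hj, B, y, e.symm, ho, h⟩
  by_contra hlt
  have hk := lev h
  obtain ⟨j, hj, hjk, B, y, hB, ho, h1, h2, h3, h4⟩ := step h (by omega)
  obtain ⟨j', hj', hjk', C, z, hC, ho', h1', h2', h3', h4'⟩ := step ho (by omega)
  have b0 := h.boundary.of_le (j := k₁) (by omega)
  have b1 := ho.boundary.of_le hj
  have b2 := ho'.boundary.of_le hj'
  have bA := h4.of_le hj
  have bB := h4'.of_le hj'
  have bC : Boundary π T k₁ (z + C.exp.length) := by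
    have := ho'.boundary_right.of_le hj'
    simpa using this
  have pC := ho'.length_pos C (by simp)
  have nf := @not_four_boundaries π T k₁ _ hw
  -- The cases say at which end each inner interval is strictly smaller; each case selects four
  -- distinct endpoints of the three intervals.
  rcases h3 with h3 | h3 <;> rcases h3' with h3' | h3'
  · exact nf b0 b1 b2 bA (by omega) (by omega) (by omega) (by omega)
  · exact nf b0 b1 bC bB (by omega) (by omega) (by omega) (by omega)
  · rcases h1.lt_or_eq with h | h
    · exact nf b0 b1 b2 bA (by omega) (by omega) (by omega) (by omega)
    · exact nf b1 b2 bB bA (by omega) (by omega) (by omega) (by omega)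
  · exact nf b2 bC bB bA (by omega) (by omega) (by omega) (by omega)

/-- Symbols grouped below the critical level are short because `ell` grows by less than the factor 2
per two levels. -/
theorem length_le_of_active {j ℓ : ℕ} {B : Sym} (h : Active (j + 1) B)
    (hj : j < 8 * (Nat.log 2 ℓ + 1)) : B.exp.length ≤ 2 ^ (4 * (Nat.log 2 ℓ + 1)) := by
  have : (B.exp.length : ℚ) ≤ 2 ^ (4 * (Nat.log 2 ℓ + 1)) := h.trans (ell_le (by omega))
  exact_mod_cast this

end

/-! ### Symbols that occur in the parse, and the slots of their rules -/

section

/-- The strings that are searched at a symbol: the right-hand side of a rule `A → B₁ ⋯ Bₜ`, and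
the symbol itself otherwise. -/
def Sym.slots : Sym → List Sym
  | .block Bs => Bs
  | A => [A]

theorem expand_slots (A : Sym) : expand A.slots = A.exp := by
  cases A <;> simp [Sym.slots, Sym.exp, expand]

/-- This is induction from the top: a property that passes from a symbol to the symbols of its rule
reaches every nonterminal of the grammar. -/
theorem nonterminals_induction {P : Sym → Prop}
    (run : ∀ B t, P (.run B t) → P B) (block : ∀ Bs, P (.block Bs) → ∀ B ∈ Bs, P B) :
    ∀ S, P S → ∀ A ∈ S.nonterminals, P A := by
  apply Sym.induction_children
  · simp [Sym.nonterminals]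
  · intro B t ih h A hA
    simp only [Sym.nonterminals, Finset.mem_insert] at hA
    rcases hA with rfl | hA
    · exact h
    · exact ih (run B t h) A hA
  · intro Bs ih h A hA
    simp only [Sym.nonterminals, Finset.mem_insert] at hA
    rcases hA with rfl | hA
    · exact h
    · have : ∀ l : List Sym, A ∈ (l.map Sym.nonterminals).foldr (· ∪ ·) ∅ →
          ∃ B ∈ l, A ∈ B.nonterminals := by
        intro l
        induction l with
        | nil => simp
        | cons a l ih =>
          simp only [List.map_cons, List.foldr_cons, Finset.mem_union, List.mem_cons]
          rintro (h | h)
          · exact ⟨a, .inl rfl, h⟩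
          · obtain ⟨B, hB, h⟩ := ih h
            exact ⟨B, .inr hB, h⟩
      obtain ⟨B, hB, hA⟩ := this Bs hA
      exact ih B hB (block Bs h B hB) A hA

theorem mem_nonterminals_self {A : Sym} (h : A.children ≠ []) : A ∈ A.nonterminals := by
  cases A <;> simp_all [Sym.nonterminals, Sym.children]

theorem nonterminals_subset_of_mem_children {A B : Sym} (h : B ∈ A.children) :
    B.nonterminals ⊆ A.nonterminals := by
  cases A with
  | term a => simp [Sym.children] at h
  | run C t =>
    obtain rfl := List.eq_of_mem_replicate h
    simp [Sym.nonterminals]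
  | block Bs =>
    have : ∀ l : List Sym, B ∈ l → B.nonterminals ⊆ (l.map Sym.nonterminals).foldr (· ∪ ·) ∅ := by
      intro l
      induction l with
      | nil => simp
      | cons a l ih =>
        intro hB
        rcases List.mem_cons.1 hB with rfl | hB
        · simp
        · exact (ih hB).trans (by simp)
    exact (this Bs h).trans (by simp [Sym.nonterminals])

theorem nonterminals_subset_of_mem {S A : Sym} (h : A ∈ S.nonterminals) :
    A.nonterminals ⊆ S.nonterminals := by
  refine nonterminals_induction (P := fun A => A.nonterminals ⊆ S.nonterminals) ?_ ?_ S
    subset_rfl A h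
  · intro B t h
    exact subset_trans (by simp [Sym.nonterminals]) h
  · intro Bs h B hB
    exact (nonterminals_subset_of_mem_children (A := .block Bs) hB).trans h

/-- The symbols of a grammar that has at least one rule. -/
def Sym.symbols (S : Sym) : Finset Sym :=
  S.nonterminals.biUnion fun A => insert A A.children.toFinset

/-- The symbols of the grammar occur in the parse of the text. -/
def Sym.Parsed (π : ℕ → Sym → ℕ) (T : List ℕ) (A : Sym) : Prop :=
  ∃ k x, Occurs π T k x [A]

variable {π : ℕ → Sym → ℕ} {T : List ℕ}

theorem Sym.Parsed.length_pos {A : Sym} (h : A.Parsed π T) : 1 ≤ A.exp.length := by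
  obtain ⟨k, x, h⟩ := h
  exact h.length_pos A (by simp)

theorem Sym.Parsed.length_le {A : Sym} (h : A.Parsed π T) : A.exp.length ≤ T.length := by
  obtain ⟨k, x, h⟩ := h
  have := h.length_le
  simp at this
  omega

theorem Sym.Parsed.height_le {A : Sym} (h : A.Parsed π T) :
    A.height ≤ 8 * (Nat.log 2 A.exp.length + 1) + 1 := by
  obtain ⟨k, x, h⟩ := h
  exact h.height_le

theorem Sym.Parsed.of_mem_children {A B : Sym} (h : A.Parsed π T) (hB : B ∈ A.children) :
    B.Parsed π T := by
  obtain ⟨k, x, h⟩ := h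
  obtain ⟨j, -, y, ho, -⟩ := h.mem_children hB
  exact ⟨j, y, ho⟩

theorem Sym.Parsed.two_le {A : Sym} (h : A.Parsed π T) (hA : A.children ≠ []) :
    2 ≤ A.children.length := by
  obtain ⟨k, x, h⟩ := h
  obtain ⟨j, -, -, h2, -⟩ := h.children hA
  exact h2

theorem Sym.Parsed.children_ne_nil {A : Sym} (h : A.Parsed π T) (hA : ∀ a, A ≠ .term a) :
    A.children ≠ [] := by
  intro hc
  have h0 := height_eq_zero h.length_pos hc
  cases A with
  | term a => exact hA a rfl
  | run B t => simp [Sym.height] at h0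
  | block Bs => simp [Sym.height] at h0

theorem Sym.Parsed.nonterminals {S : Sym} (hS : S.Parsed π T) :
    ∀ A ∈ S.nonterminals, A.Parsed π T := by
  refine nonterminals_induction ?_ ?_ S hS
  · intro B t h
    refine h.of_mem_children ?_
    have := h.children_ne_nil (by simp)
    simp only [Sym.children, ne_eq, List.replicate_eq_nil_iff] at this
    simp [Sym.children, this]
  · intro Bs h B hB
    exact h.of_mem_children hB

theorem not_term_of_mem_nonterminals {S A : Sym} (h : A ∈ S.nonterminals) (a : ℕ) :
    A ≠ .term a := by
  rintro rfl
  have : ∀ S : Sym, Sym.term a ∉ S.nonterminals := by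
    apply Sym.induction_children
    · simp [Sym.nonterminals]
    · simp [Sym.nonterminals]
    · intro Bs ih h
      simp only [Sym.nonterminals, Finset.mem_insert, reduceCtorEq, false_or] at h
      induction Bs with
      | nil => simp at h
      | cons B Bs ih' =>
        simp only [List.map_cons, List.foldr_cons, Finset.mem_union] at h
        rcases h with h | h
        · exact ih B (by simp) h
        · exact ih' (fun B hB => ih B (by simp [hB])) h
  exact this S h

theorem Sym.Parsed.ne_nil_of_mem {S A : Sym} (hS : S.Parsed π T) (h : A ∈ S.nonterminals) :
    A.children ≠ [] :=
  (hS.nonterminals A h).children_ne_nil (not_term_of_mem_nonterminals h)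

theorem mem_symbols_of_mem_nonterminals {S A : Sym} (h : A ∈ S.nonterminals) : A ∈ S.symbols :=
  Finset.mem_biUnion.2 ⟨A, h, by simp⟩

theorem mem_symbols_of_mem_children {S A B : Sym} (h : A ∈ S.nonterminals)
    (hB : B ∈ A.children) : B ∈ S.symbols :=
  Finset.mem_biUnion.2 ⟨A, h, by simp [hB]⟩

theorem mem_nonterminals_of_mem_symbols {S A : Sym} (h : A ∈ S.symbols) (hA : A.children ≠ []) :
    A ∈ S.nonterminals := by
  obtain ⟨C, hC, h⟩ := Finset.mem_biUnion.1 h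
  simp only [Finset.mem_insert, List.mem_toFinset] at h
  rcases h with rfl | h
  · exact hC
  · exact nonterminals_subset_of_mem hC
      (nonterminals_subset_of_mem_children h (mem_nonterminals_self hA))

theorem Sym.Parsed.symbols {S : Sym} (hS : S.Parsed π T) : ∀ A ∈ S.symbols, A.Parsed π T := by
  intro A h
  obtain ⟨C, hC, h⟩ := Finset.mem_biUnion.1 h
  simp only [Finset.mem_insert, List.mem_toFinset] at h
  rcases h with rfl | h
  · exact hS.nonterminals A hC
  · exact (hS.nonterminals C hC).of_mem_children h

theorem mem_symbols_of_mem_slots {S A B : Sym} (h : A ∈ S.nonterminals) (hB : B ∈ A.slots) :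
    B ∈ S.symbols := by
  cases A with
  | term a => exact absurd rfl (not_term_of_mem_nonterminals h a)
  | run C t =>
    simp only [Sym.slots, List.mem_singleton] at hB
    exact hB ▸ mem_symbols_of_mem_nonterminals h
  | block Bs => exact mem_symbols_of_mem_children h hB

/-! ### Sizes -/

theorem Sym.Parsed.two_le_ruleSize {A : Sym} (h : A.Parsed π T) (hA : A.children ≠ []) :
    2 ≤ A.ruleSize := by
  have := h.two_le hA
  cases A with
  | term a => simp [Sym.children] at hA
  | run C t => simp [Sym.ruleSize]
  | block Bs => simpa [Sym.ruleSize, Sym.children] using this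

theorem card_symbols_le {S : Sym} (hS : S.Parsed π T) :
    S.symbols.card ≤ 2 * grammarSize S := by
  rw [grammarSize, Finset.mul_sum]
  refine Finset.card_biUnion_le.trans (Finset.sum_le_sum fun A hA => ?_)
  have hc := hS.ne_nil_of_mem hA
  have h2 := (hS.nonterminals A hA).two_le_ruleSize hc
  refine (Finset.card_insert_le _ _).trans ?_
  cases A with
  | term a => simp [Sym.children] at hc
  | run C t =>
    have : (Sym.run C t).children.toFinset ⊆ {C} := by
      intro B hB
      simp only [Sym.children, List.mem_toFinset] at hB
      simp [List.eq_of_mem_replicate hB]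
    have := Finset.card_le_card this
    simp only [Finset.card_singleton] at this
    omega
  | block Bs =>
    have := List.toFinset_card_le Bs
    simp only [Sym.children, Sym.ruleSize] at *
    omega

theorem sum_slots_le {S : Sym} (hS : S.Parsed π T) :
    ∑ A ∈ S.nonterminals, (A.slots.length + 1) ≤ 2 * grammarSize S := by
  rw [grammarSize, Finset.mul_sum]
  refine Finset.sum_le_sum fun A hA => ?_
  have hc := hS.ne_nil_of_mem hA
  have h2 := (hS.nonterminals A hA).two_le_ruleSize hc
  cases A with
  | term a => simp [Sym.children] at hc
  | run C t => simp [Sym.slots, Sym.ruleSize]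
  | block Bs =>
    simp only [Sym.slots, Sym.ruleSize] at *
    omega

theorem card_multisetY_le (S : Sym) : Multiset.card (multisetY S) ≤ grammarSize S := by
  rw [multisetY, Multiset.card_bind, grammarSize, Finset.sum]
  refine Multiset.sum_map_le_sum_map _ _ fun A _ => ?_
  cases A with
  | term a => simp [Sym.ruleY]
  | run C t => simp [Sym.ruleY, Sym.ruleSize]
  | block Bs =>
    have := Nat.card_Ico 1 Bs.length
    rw [Finset.card, Finset.Ico] at this
    simp only [Function.comp_apply, Sym.ruleY, Multiset.card_map, Sym.ruleSize, Multiset.Ico]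
    exact this.le.trans (Nat.sub_le _ _)

/-- This gives all queries one format, a symbol and a first slot. A run has itself as its only slot,
and `exp(B) ^ (t - 1)` is a prefix of its expansion. -/
theorem exists_slot_of_mem_multisetY {S : Sym} {y : List ℕ} (hy : y ∈ multisetY S) :
    ∃ A ∈ S.nonterminals, ∃ s < A.slots.length, y <+: expand (A.slots.drop s) := by
  rw [multisetY, Multiset.mem_bind] at hy
  obtain ⟨A, hA, hy⟩ := hy
  refine ⟨A, hA, ?_⟩
  cases A with
  | term a => simp [Sym.ruleY] at hy
  | run C t =>
    simp only [Sym.ruleY, Multiset.mem_singleton] at hy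
    refine ⟨0, by simp [Sym.slots], ?_⟩
    subst hy
    simp only [Sym.slots, List.drop_zero, expand_cons, expand_nil, List.append_nil]
    rw [Sym.exp, ← expand_replicate]
    cases t with
    | zero => simp
    | succ t => exact ⟨C.exp, by simp [List.replicate_succ']⟩
  | block Bs =>
    simp only [Sym.ruleY, Multiset.mem_map, Multiset.mem_Ico] at hy
    obtain ⟨s, hs, rfl⟩ := hy
    exact ⟨s, hs.2, List.prefix_rfl⟩

theorem sum_insert_ruleSize_le (A : Sym) (s : Finset Sym) :
    ∑ B ∈ insert A s, B.ruleSize ≤ A.ruleSize + ∑ B ∈ s, B.ruleSize := by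
  by_cases h : A ∈ s
  · simp [h]
  · rw [Finset.sum_insert h]

/-- A parse tree without unary nodes has size linear in its number of leaves, and sharing equal
rules only helps; the summand 2 pays for the rule at the root in the induction. It is needed for
pointers to fit into a word. -/
theorem grammarSize_le : ∀ S : Sym, S.Parsed π T → grammarSize S + 2 ≤ 2 * S.exp.length := by
  apply Sym.induction_children
  · intro a _
    simp [grammarSize, Sym.nonterminals, Sym.exp]
  · intro B t ih h
    have hc := h.children_ne_nil (by simp)
    have h2 := h.two_le hc
    have hB : B.Parsed π T := by
      refine h.of_mem_children ?_
      simp only [Sym.children, ne_eq, List.replicate_eq_nil_iff] at hc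
      simp [Sym.children, hc]
    have hs := ih hB
    have hpos := hB.length_pos
    have hg : grammarSize (.run B t) ≤ 2 + grammarSize B := by
      rw [grammarSize, Sym.nonterminals]
      exact sum_insert_ruleSize_le _ _
    have hl : (Sym.run B t).exp.length = t * B.exp.length := by simp [Sym.exp]
    simp only [Sym.children, List.length_replicate] at h2
    rw [hl]
    have := Nat.mul_le_mul_right B.exp.length h2
    omega
  · intro Bs ih h
    have hc := h.children_ne_nil (by simp)
    have h2 := h.two_le hc
    have hg : grammarSize (.block Bs) ≤ Bs.length +
        ∑ A ∈ (Bs.map Sym.nonterminals).foldr (· ∪ ·) ∅, A.ruleSize := by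
      rw [grammarSize, Sym.nonterminals]
      exact sum_insert_ruleSize_le _ _
    have key : ∀ l : List Sym, (∀ B ∈ l, grammarSize B + 2 ≤ 2 * B.exp.length) →
        ∑ A ∈ (l.map Sym.nonterminals).foldr (· ∪ ·) ∅, A.ruleSize + 2 * l.length
          ≤ 2 * (expand l).length := by
      intro l
      induction l with
      | nil => simp
      | cons B l ih =>
        intro hl
        have h1 := hl B (by simp)
        have h2 := ih fun C hC => hl C (by simp [hC])
        simp only [List.map_cons, List.foldr_cons, List.length_cons, expand_cons,
          List.length_append]
        have := Finset.sum_union_inter (s₁ := B.nonterminals)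
          (s₂ := (l.map Sym.nonterminals).foldr (· ∪ ·) ∅) (f := Sym.ruleSize)
        rw [grammarSize] at h1
        omega
    have := key Bs fun B hB => ih B hB (h.of_mem_children hB)
    rw [exp_eq_expand_children hc]
    simp only [Sym.children] at h2 ⊢
    omega

/-! ### Signatures in `ZMod p` -/

/-- The Karp–Rabin signature before reduction to a number. -/
def sig (p c : ℕ) : List ℕ → ZMod p
  | [] => 0
  | a :: s => a + c * sig p c s

theorem sig_append (p c : ℕ) (s t : List ℕ) :
    sig p c (s ++ t) = sig p c s + (c : ZMod p) ^ s.length * sig p c t := by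
  induction s with
  | nil => simp [sig]
  | cons a s ih => simp only [List.cons_append, sig, ih, List.length_cons]; ring

theorem karpRabin_eq (p c : ℕ) (s : List ℕ) : karpRabin p c s = (sig p c s).val := by
  have : ((∑ i : Fin s.length, s[i] * c ^ (i : ℕ) : ℕ) : ZMod p) = sig p c s := by
    induction s with
    | nil => simp [sig]
    | cons a s ih =>
      rw [sig, ← ih]
      change ((∑ i : Fin (s.length + 1), (a :: s)[i] * c ^ (i : ℕ) : ℕ) : ZMod p) = _
      rw [Fin.sum_univ_succ]
      simp [pow_succ', Finset.mul_sum, mul_comm, mul_assoc]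
  rw [karpRabin, ← ZMod.val_natCast, this]

end

section

/-! ### Rankings, arrays and search trees -/

/-- A finite set can be ranked by decreasing weight. -/
theorem exists_rank {α : Type} [DecidableEq α] (s : Finset α) (f : α → ℕ) :
    ∃ r : α → ℕ, Set.InjOn r s ∧
      ∀ u ∈ s, (r u + 1) * f u ≤ ∑ v ∈ s, f v ∧ r u < s.card := by
  induction s using Finset.induction_on_min_value f with
  | empty => exact ⟨fun _ => 0, by simp, by simp⟩
  | insert a s ha hmin ih =>
    obtain ⟨r, hr, h⟩ := ih
    have hne : ∀ u ∈ s, u ≠ a := fun u hu e => ha (e ▸ hu)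
    refine ⟨Function.update r a s.card, ?_, ?_⟩
    · intro u hu v hv e
      simp only [Finset.coe_insert, Set.mem_insert_iff, Finset.mem_coe] at hu hv
      rcases hu with rfl | hu <;> rcases hv with rfl | hv
      · rfl
      · have := (h v hv).2
        simp [Function.update_of_ne (hne v hv)] at e
        omega
      · have := (h u hu).2
        simp [Function.update_of_ne (hne u hu)] at e
        omega
      · simp only [Function.update_of_ne (hne v hv), Function.update_of_ne (hne u hu)] at e
        exact hr hu hv e
    · intro u hu
      rw [Finset.sum_insert ha, Finset.card_insert_of_notMem ha]
      rcases Finset.mem_insert.1 hu with rfl | hu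
      -- The new element has the least weight and gets the last rank, so each of the elements ranked
      -- before it weighs at least as much.
      · have := Finset.card_nsmul_le_sum s f _ hmin
        simp only [Function.update_self, smul_eq_mul] at this ⊢
        refine ⟨?_, by omega⟩
        rw [add_mul, one_mul]
        have e : ∑ x ∈ s, f x = s.sum f := rfl
        omega
      · rw [Function.update_of_ne (hne u hu)]
        have := h u hu
        exact ⟨by omega, by omega⟩

/-- Arrays of given lengths can be stored one after another. -/
theorem exists_arrays {α β : Type} [DecidableEq α] [Inhabited β] (s : Finset α) (d : α → ℕ)
    (entry : α → ℕ → β) :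
    ∃ (base : α → ℕ) (arr : ℕ → β), ∀ a ∈ s, base a + d a ≤ ∑ b ∈ s, d b ∧
      ∀ j < d a, arr (base a + j) = entry a j := by
  induction s using Finset.induction_on with
  | empty => exact ⟨fun _ => 0, fun _ => default, by simp⟩
  | insert a s ha ih =>
    obtain ⟨base, arr, h⟩ := ih
    refine ⟨Function.update base a (∑ b ∈ s, d b),
      fun i => if i < ∑ b ∈ s, d b then arr i else entry a (i - ∑ b ∈ s, d b), ?_⟩
    intro b hb
    rw [Finset.sum_insert ha]
    rcases Finset.mem_insert.1 hb with rfl | hb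
    · simp only [Function.update_self]
      refine ⟨by omega, fun j _ => ?_⟩
      rw [if_neg (by omega), Nat.add_sub_cancel_left]
    · rw [Function.update_of_ne (fun e : b = a => ha (e ▸ hb))]
      obtain ⟨h1, h2⟩ := h b hb
      refine ⟨by omega, fun j hj => ?_⟩
      rw [← h2 j hj]
      exact if_pos (by omega)

/-- In the search tree on `[a, b)` with children `L` and `R`, the node `i` is found from the node
`x` in `d` steps. -/
inductive SearchPath (a b : ℕ) (L R : ℕ → ℕ) (i : ℕ) : ℕ → ℕ → Prop
  | here : SearchPath a b L R i 0 i
  | left {d x : ℕ} (ha : a ≤ x) (hb : x < b) (h : i < x) (hp : SearchPath a b L R i d (L x)) :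
    SearchPath a b L R i (d + 1) x
  | right {d x : ℕ} (ha : a ≤ x) (hb : x < b) (h : x < i) (hp : SearchPath a b L R i d (R x)) :
    SearchPath a b L R i (d + 1) x

theorem SearchPath.congr {a b a' b' i d x : ℕ} {L R L' R' : ℕ → ℕ}
    (h : SearchPath a b L R i d x) (ha : a' ≤ a) (hb : b ≤ b')
    (hL : ∀ y, a ≤ y → y < b → L y = L' y ∧ R y = R' y) : SearchPath a' b' L' R' i d x := by
  induction h with
  | here => exact .here
  | left h1 h2 h3 _ ih => exact .left (by omega) (by omega) h3 ((hL _ h1 h2).1 ▸ ih)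
  | right h1 h2 h3 _ ih => exact .right (by omega) (by omega) h3 ((hL _ h1 h2).2 ▸ ih)

/-- Weight-balanced search trees. -/
theorem exists_searchTree {cum : ℕ → ℕ} (hc : Monotone cum) (n : ℕ) :
    ∀ a b : ℕ, b - a ≤ n → a < b → ∃ (L R : ℕ → ℕ) (r : ℕ), a ≤ r ∧ r < b ∧
      (∀ x, a ≤ x → x < b → L x < b ∧ R x < b) ∧
      ∀ i, a ≤ i → i < b → ∃ d, 2 ^ d * (cum (i + 1) - cum i) ≤ cum b - cum a ∧
        SearchPath a b L R i d r := by
  induction n with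
  | zero => intro a b h1 h2; omega
  | succ n ih =>
    intro a b hn hab
    -- The root is the first element whose right end passes the middle of the total weight, or else
    -- the last element. Both sides then carry at most half of the weight, so every step down halves
    -- the weight that remains.
    have hcab := hc hab.le
    obtain ⟨m, hm⟩ : ∃ m, (a ≤ m ∧ (m + 1 = b ∨ cum a + cum b < 2 * cum (m + 1))) ∧
        ∀ m' < m, ¬ (a ≤ m' ∧ (m' + 1 = b ∨ cum a + cum b < 2 * cum (m' + 1))) := by
      have hex : ∃ m, a ≤ m ∧ (m + 1 = b ∨ cum a + cum b < 2 * cum (m + 1)) :=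
        ⟨b - 1, by omega, by omega⟩
      classical
      exact ⟨Nat.find hex, Nat.find_spec hex, fun m' => Nat.find_min hex⟩
    obtain ⟨⟨ham, hm1⟩, hmin⟩ := hm
    have hmb : m < b := by
      by_contra h
      exact hmin (b - 1) (by omega) ⟨by omega, by omega⟩
    have hml : 2 * cum m ≤ cum a + cum b := by
      rcases ham.eq_or_lt with rfl | h
      · omega
      · have := hmin (m - 1) (by omega)
        rw [show m - 1 + 1 = m by omega] at this
        by_contra h'
        exact this ⟨by omega, by omega⟩
    have hc1 := hc ham
    have hc2 := hc (show m + 1 ≤ b by omega)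
    have hc3 := hc (show m ≤ m + 1 by omega)
    have hleft : ∃ (L R : ℕ → ℕ) (r : ℕ), (r < b) ∧
        (∀ x, a ≤ x → x < m → L x < b ∧ R x < b) ∧
        ∀ i, a ≤ i → i < m → ∃ d, 2 ^ d * (cum (i + 1) - cum i) ≤ cum m - cum a ∧
          SearchPath a m L R i d r := by
      rcases ham.eq_or_lt with rfl | h
      · exact ⟨id, id, a, hab, fun x _ _ => by omega, fun i _ _ => by omega⟩
      · obtain ⟨L, R, r, h1, h2, h3, h4⟩ := ih a m (by omega) h
        exact ⟨L, R, r, by omega, fun x hx hx' => ⟨(h3 x hx hx').1.trans hmb,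
          (h3 x hx hx').2.trans hmb⟩, h4⟩
    have hright : ∃ (L R : ℕ → ℕ) (r : ℕ), (r < b) ∧
        (∀ x, m + 1 ≤ x → x < b → L x < b ∧ R x < b) ∧
        ∀ i, m + 1 ≤ i → i < b → ∃ d, 2 ^ d * (cum (i + 1) - cum i) ≤ cum b - cum (m + 1) ∧
          SearchPath (m + 1) b L R i d r := by
      rcases (show m + 1 ≤ b by omega).eq_or_lt with rfl | h
      · exact ⟨id, id, a, hab, fun x _ _ => by omega, fun i _ _ => by omega⟩
      · obtain ⟨L, R, r, h1, h2, h3, h4⟩ := ih (m + 1) b (by omega) h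
        exact ⟨L, R, r, h2, h3, h4⟩
    obtain ⟨L₁, R₁, r₁, hr₁, hb₁, h₁⟩ := hleft
    obtain ⟨L₂, R₂, r₂, hr₂, hb₂, h₂⟩ := hright
    refine ⟨fun x => if x < m then L₁ x else if x = m then r₁ else L₂ x,
      fun x => if x < m then R₁ x else if x = m then r₂ else R₂ x, m, ham, hmb, ?_, ?_⟩
    · intro x hxa hxb
      rcases lt_trichotomy x m with h | rfl | h
      · simpa [h] using hb₁ x hxa h
      · simp [hr₁, hr₂]
      · simpa [h.not_gt, h.ne'] using hb₂ x h hxb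
    · intro i hia hib
      rcases lt_trichotomy i m with h | rfl | h
      · obtain ⟨d, hd, hp⟩ := h₁ i hia h
        refine ⟨d + 1, ?_, .left ham hmb h ?_⟩
        · rw [pow_succ, mul_right_comm]
          omega
        · simp only [lt_self_iff_false, if_false, if_true]
          exact hp.congr le_rfl hmb.le fun y _ hy => by simp [hy]
      · refine ⟨0, ?_, .here⟩
        omega
      · obtain ⟨d, hd, hp⟩ := h₂ i h hib
        refine ⟨d + 1, ?_, .right ham hmb h ?_⟩
        · rw [pow_succ, mul_right_comm]
          rcases hm1 with rfl | hm1
          · omega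
          · omega
        · simp only [lt_self_iff_false, if_false, if_true]
          refine hp.congr (by omega) le_rfl fun y hy _ => ?_
          have : ¬ y < m := by omega
          have : y ≠ m := by omega
          simp [*]

/-! ### Codes for lists of numbers -/

/-- Number of bits of the code of a list. -/
def codeBits : List ℕ → ℕ
  | [] => 0
  | j :: l => Nat.log 2 (j + 1) + 1 + codeBits l

/-- The numbers of a list, one after another in a word, from the lowest bits on. -/
def codeFields : List ℕ → ℕ
  | [] => 0
  | j :: l => j + 2 ^ (Nat.log 2 (j + 1) + 1) * codeFields l

/-- The word that marks the last bits of the fields of `codeFields`. -/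
def codeMarks : List ℕ → ℕ
  | [] => 0
  | j :: l => 2 ^ Nat.log 2 (j + 1) + 2 ^ (Nat.log 2 (j + 1) + 1) * codeMarks l

theorem codeBits_append (l l' : List ℕ) : codeBits (l ++ l') = codeBits l + codeBits l' := by
  induction l with
  | nil => simp [codeBits]
  | cons j l ih => simp only [List.cons_append, codeBits, ih]; ring

theorem field_lt (j : ℕ) : j < 2 ^ (Nat.log 2 (j + 1) + 1) :=
  (Nat.lt_succ_self j).trans (Nat.lt_pow_succ_log_self (by norm_num) _)

theorem add_mul_lt_two_pow {a b x y : ℕ} (hx : x < 2 ^ a) (hy : y < 2 ^ b) :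
    x + 2 ^ a * y < 2 ^ (a + b) := by
  rw [pow_add]
  calc x + 2 ^ a * y < 2 ^ a + 2 ^ a * y := by omega
    _ = 2 ^ a * (y + 1) := by ring
    _ ≤ _ := Nat.mul_le_mul_left _ hy

theorem codeFields_lt (l : List ℕ) : codeFields l < 2 ^ codeBits l := by
  induction l with
  | nil => simp [codeFields, codeBits]
  | cons j l ih => exact add_mul_lt_two_pow (field_lt j) ih

theorem codeMarks_lt (l : List ℕ) : codeMarks l < 2 ^ codeBits l := by
  induction l with
  | nil => simp [codeMarks, codeBits]
  | cons j l ih => exact add_mul_lt_two_pow (Nat.pow_lt_pow_right (by norm_num) (by omega)) ih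

theorem codeFields_mod (j : ℕ) (l : List ℕ) :
    codeFields (j :: l) % 2 ^ (Nat.log 2 (j + 1) + 1) = j := by
  rw [codeFields, Nat.add_mul_mod_self_left, Nat.mod_eq_of_lt (field_lt j)]

theorem codeFields_div (j : ℕ) (l : List ℕ) :
    codeFields (j :: l) / 2 ^ (Nat.log 2 (j + 1) + 1) = codeFields l := by
  rw [codeFields, Nat.add_mul_div_left _ _ (by positivity), Nat.div_eq_of_lt (field_lt j),
    zero_add]

theorem codeMarks_div (j : ℕ) (l : List ℕ) :
    codeMarks (j :: l) / 2 ^ (Nat.log 2 (j + 1) + 1) = codeMarks l := by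
  rw [codeMarks, Nat.add_mul_div_left _ _ (by positivity),
    Nat.div_eq_of_lt (Nat.pow_lt_pow_right (by norm_num) (by omega)), zero_add]

/-- Subtracting 1 flips exactly the bits up to the lowest one that is set. Thus a few word
operations isolate the width of the lowest field, without a table or a loop. -/
theorem xor_pred (a m : ℕ) :
    (2 ^ a + 2 ^ (a + 1) * m) ^^^ (2 ^ a + 2 ^ (a + 1) * m - 1) = 2 ^ (a + 1) - 1 := by
  induction a with
  | zero =>
    have e : 2 ^ 0 + 2 ^ (0 + 1) * m - 1 = 2 * m := by omega
    rw [e]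
    have h1 := Nat.xor_div_two (a := 2 ^ 0 + 2 ^ (0 + 1) * m) (b := 2 * m)
    have h2 := Nat.xor_mod_two_eq (m := 2 ^ 0 + 2 ^ (0 + 1) * m) (n := 2 * m)
    rw [show (2 ^ 0 + 2 ^ (0 + 1) * m) / 2 = m by omega, show 2 * m / 2 = m by omega,
      Nat.xor_self] at h1
    omega
  | succ a ih =>
    set y := 2 ^ a + 2 ^ (a + 1) * m with hy
    have e : 2 ^ (a + 1) + 2 ^ (a + 1 + 1) * m = 2 * y := by rw [hy]; ring
    have hpos : 0 < 2 ^ a := by positivity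
    rw [e]
    have h1 := Nat.xor_div_two (a := 2 * y) (b := 2 * y - 1)
    have h2 := Nat.xor_mod_two_eq (m := 2 * y) (n := 2 * y - 1)
    rw [show 2 * y / 2 = y by omega, show (2 * y - 1) / 2 = y - 1 by omega, ih] at h1
    have h3 : 2 ^ (a + 1 + 1) = 2 * 2 ^ (a + 1) := by ring
    have h4 : 0 < 2 ^ (a + 1) := by positivity
    omega

theorem codeMarks_pos (j : ℕ) (l : List ℕ) : 0 < codeMarks (j :: l) := by
  rw [codeMarks]; positivity

theorem codeMarks_xor (j : ℕ) (l : List ℕ) :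
    (codeMarks (j :: l) ^^^ (codeMarks (j :: l) - 1)) + 1 = 2 ^ (Nat.log 2 (j + 1) + 1) := by
  rw [codeMarks, xor_pred]
  have : 0 < 2 ^ (Nat.log 2 (j + 1) + 1) := by positivity
  omega

/-! ### Leftmost paths -/

/-- The symbols on the leftmost path of the parse tree of a symbol, from the bottom up and without
the terminal. -/
def Sym.spine : Sym → List Sym
  | .term _ => []
  | .run B t => B.spine ++ [.run B t]
  | .block [] => []
  | .block (B :: Bs) => B.spine ++ [.block (B :: Bs)]

/-- The terminal on the leftmost path. -/
def Sym.leaf : Sym → Sym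
  | .term a => .term a
  | .run B _ => B.leaf
  | .block [] => .block []
  | .block (B :: _) => B.leaf

theorem spine_eq {A : Sym} (h : A.children ≠ []) : A.spine = A.first.spine ++ [A] := by
  match A with
  | .term a => simp [Sym.children] at h
  | .run B 0 => simp [Sym.children] at h
  | .run B (t + 1) => simp [Sym.spine, Sym.first, Sym.children, List.replicate_succ]
  | .block [] => simp [Sym.children] at h
  | .block (B :: Bs) => simp [Sym.spine, Sym.first, Sym.children]

theorem leaf_eq {A : Sym} (h : A.children ≠ []) : A.leaf = A.first.leaf := by
  match A with
  | .term a => simp [Sym.children] at h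
  | .run B 0 => simp [Sym.children] at h
  | .run B (t + 1) => simp [Sym.leaf, Sym.first, Sym.children, List.replicate_succ]
  | .block [] => simp [Sym.children] at h
  | .block (B :: Bs) => simp [Sym.leaf, Sym.first, Sym.children]

/-- `us` are the symbols above `v` on the leftmost path of `w`. -/
inductive Climb : Sym → List Sym → Sym → Prop
  | nil (v : Sym) : Climb v [] v
  | cons {u w : Sym} {us : List Sym} (hu : u.children ≠ []) (h : Climb u us w) :
    Climb u.first (u :: us) w

theorem Climb.snoc {v w : Sym} {us : List Sym} (hw : w.children ≠ []) (h : Climb v us w.first) :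
    Climb v (us ++ [w]) w := by
  generalize hx : w.first = x at h
  induction h with
  | nil v => subst hx; exact .cons hw (.nil w)
  | cons hu _ ih => exact .cons hu (ih hx)

variable {π : ℕ → Sym → ℕ} {T : List ℕ}

theorem Sym.Parsed.first {A : Sym} (h : A.Parsed π T) (hA : A.children ≠ []) :
    A.first.Parsed π T :=
  h.of_mem_children (first_mem hA)

/-- Induction along the leftmost path. -/
theorem Sym.Parsed.induction_first {P : Sym → Prop} (term : ∀ a, P (.term a))
    (step : ∀ A : Sym, A.Parsed π T → A.children ≠ [] → P A.first → P A) :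
    ∀ A : Sym, A.Parsed π T → P A := by
  intro A
  induction hn : A.height using Nat.strong_induction_on generalizing A with
  | _ n ih =>
    intro h
    by_cases hA : A.children = []
    · have h0 := height_eq_zero h.length_pos hA
      cases A with
      | term a => exact term a
      | run B t => simp [Sym.height] at h0
      | block Bs => simp [Sym.height] at h0
    · exact step A h hA (ih _ (hn ▸ height_lt_of_mem (first_mem hA)) _ rfl (h.first hA))

theorem Sym.Parsed.climb {A : Sym} (h : A.Parsed π T) : Climb A.leaf A.spine A := by
  revert A
  apply Sym.Parsed.induction_first
  · intro a
    simp only [Sym.leaf, Sym.spine]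
    exact .nil _
  · intro A _ hA ih
    rw [leaf_eq hA, spine_eq hA]
    exact ih.snoc hA

theorem Sym.Parsed.length_leaf {A : Sym} (h : A.Parsed π T) : A.leaf.exp.length = 1 := by
  revert A
  apply Sym.Parsed.induction_first
  · intro a; simp [Sym.leaf, Sym.exp]
  · intro A _ hA ih; rw [leaf_eq hA, ih]

theorem first_mem_symbols {S A : Sym} (h : A ∈ S.nonterminals) (hA : A.children ≠ []) :
    A.first ∈ S.symbols :=
  mem_symbols_of_mem_children h (first_mem hA)

theorem leaf_mem_symbols {S : Sym} (hS : S.Parsed π T) {A : Sym} (h : A ∈ S.symbols) :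
    A.leaf ∈ S.symbols := by
  have : ∀ A : Sym, A.Parsed π T → A ∈ S.symbols → A.leaf ∈ S.symbols := by
    apply Sym.Parsed.induction_first
    · intro a h; simpa [Sym.leaf] using h
    · intro A _ hA ih h
      rw [leaf_eq hA]
      exact ih (first_mem_symbols (mem_nonterminals_of_mem_symbols h hA) hA)
  exact this A (hS.symbols A h) h

open scoped Classical in
/-- The number of symbols that have `v` on their leftmost path. -/
def subtreeSize (S v : Sym) : ℕ := {u ∈ S.symbols | ∃ k, Sym.first^[k] u = v}.card

theorem subtreeSize_pos {S v : Sym} (h : v ∈ S.symbols) : 0 < subtreeSize S v :=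
  Finset.card_pos.2 ⟨v, by simp only [Finset.mem_filter]; exact ⟨h, 0, rfl⟩⟩

theorem subtreeSize_le_card (S v : Sym) : subtreeSize S v ≤ S.symbols.card := by
  rw [subtreeSize]
  classical exact Finset.card_le_card fun x hx => (Finset.mem_filter.1 hx).1

theorem height_first_le (A : Sym) : A.first.height ≤ A.height := by
  by_cases h : A.children = []
  · simp [Sym.first, h]
  · exact (height_lt_of_mem (first_mem h)).le

theorem height_iterate_first_le (A : Sym) (k : ℕ) : (Sym.first^[k] A).height ≤ A.height := by
  induction k with
  | zero => simp
  | succ k ih => rw [Function.iterate_succ_apply']; exact (height_first_le _).trans ih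

/-- `Sym.first` is the parent function of a forest, and the subtrees of siblings are disjoint: a
symbol below two siblings would reach them after equally many steps, as otherwise one sibling would
lie strictly below the other's rule, against their heights. -/
theorem sum_subtreeSize_le {S : Sym} (hS : S.Parsed π T) (v : Sym) :
    ∑ u ∈ S.nonterminals with u.first = v, subtreeSize S u ≤ subtreeSize S v := by
  simp only [subtreeSize]
  rw [← Finset.card_biUnion]
  · refine Finset.card_le_card fun x hx => ?_
    simp only [Finset.mem_biUnion, Finset.mem_filter] at hx ⊢
    obtain ⟨u, ⟨-, hu⟩, hx, k, hk⟩ := hx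
    exact ⟨hx, k + 1, by rw [Function.iterate_succ_apply', hk, hu]⟩
  · intro u hu u' hu' hne
    simp only [Finset.coe_filter, Set.mem_ofPred_eq] at hu hu'
    rw [Function.onFun, Finset.disjoint_left]
    intro x hx hx'
    simp only [Finset.mem_filter] at hx hx'
    obtain ⟨-, k, hk⟩ := hx
    obtain ⟨-, k', hk'⟩ := hx'
    have key : ∀ {u u' : Sym} {k k' : ℕ}, u' ∈ S.nonterminals → u.first = u'.first →
        Sym.first^[k] x = u → Sym.first^[k'] x = u' → ¬ k < k' := by
      intro u u' k k' hu' he hk hk' hlt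
      obtain ⟨e, rfl⟩ := Nat.exists_eq_add_of_lt hlt
      rw [show k + e + 1 = e + (k + 1) by ring, Function.iterate_add_apply,
        Function.iterate_succ_apply', hk, he] at hk'
      have h1 := height_iterate_first_le u'.first e
      rw [hk'] at h1
      have h2 := height_lt_of_mem (first_mem (hS.ne_nil_of_mem hu'))
      omega
    have h1 := key hu'.1 (hu.2.trans hu'.2.symm) hk hk'
    have h2 := key hu.1 (hu'.2.trans hu.2.symm) hk' hk
    obtain rfl : k = k' := by omega
    exact hne (hk.symm.trans hk')

/-- Ranks that number, for each symbol, the nonterminals whose rule starts with that symbol. -/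
theorem exists_spine_rank {S : Sym} (hS : S.Parsed π T) :
    ∃ r : Sym → ℕ,
      (∀ u ∈ S.nonterminals, ∀ v ∈ S.nonterminals, u.first = v.first → r u = r v → u = v) ∧
      ∀ u ∈ S.nonterminals, (r u + 1) * subtreeSize S u ≤ subtreeSize S u.first ∧
        r u < {v ∈ S.nonterminals | v.first = u.first}.card := by
  choose r hr h using fun v : Sym =>
    exists_rank {u ∈ S.nonterminals | u.first = v} (subtreeSize S)
  refine ⟨fun u => r u.first u, ?_, ?_⟩
  · intro u hu v hv e e'
    simp only [e] at e'
    exact hr v.first (by simp [hu, e]) (by simp [hv]) e'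
  · intro u hu
    have := h u.first u (by simp [hu])
    exact ⟨this.1.trans (sum_subtreeSize_le hS _), this.2⟩

/-- The field of `u` has at most `1 + log (r u + 1)` bits, and `r u + 1` is at most the ratio of the
subtree sizes of `u.first` and `u`. Along the path the ratios telescope to at most the number of
symbols, and the rounding costs one bit per symbol, hence the factor `2 ^ A.height`. The induction
keeps the factor `subtreeSize S A`. -/
theorem two_pow_codeBits_le {S : Sym} (hS : S.Parsed π T) {r : Sym → ℕ}
    (hr : ∀ u ∈ S.nonterminals, (r u + 1) * subtreeSize S u ≤ subtreeSize S u.first)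
    {A : Sym} (h : A ∈ S.symbols) :
    2 ^ codeBits (A.spine.map r) ≤ 2 ^ A.height * S.symbols.card := by
  have : ∀ A : Sym, A.Parsed π T → A ∈ S.symbols →
      2 ^ codeBits (A.spine.map r) * subtreeSize S A ≤ 2 ^ A.height * S.symbols.card := by
    apply Sym.Parsed.induction_first
    · intro a _
      simp only [Sym.spine, List.map_nil, codeBits, pow_zero, one_mul, Sym.height]
      exact subtreeSize_le_card S _
    · intro A hp hA ih h
      have hN := mem_nonterminals_of_mem_symbols h hA
      have ih := ih (first_mem_symbols hN hA)
      have hlog : 2 ^ Nat.log 2 (r A + 1) ≤ r A + 1 := Nat.pow_log_le_self 2 (by omega)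
      have hh := height_lt_of_mem (first_mem hA)
      rw [spine_eq hA, List.map_append, codeBits_append, List.map_singleton]
      simp only [codeBits, add_zero]
      calc 2 ^ (codeBits (A.first.spine.map r) + (Nat.log 2 (r A + 1) + 1)) * subtreeSize S A
          = 2 * (2 ^ codeBits (A.first.spine.map r) *
              (2 ^ Nat.log 2 (r A + 1) * subtreeSize S A)) := by ring
        _ ≤ 2 * (2 ^ codeBits (A.first.spine.map r) * subtreeSize S A.first) := by
            gcongr
            exact (Nat.mul_le_mul_right _ hlog).trans (hr A hN)
        _ ≤ 2 * (2 ^ A.first.height * S.symbols.card) := by gcongr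
        _ = 2 ^ (A.first.height + 1) * S.symbols.card := by ring
        _ ≤ _ := by gcongr <;> omega
  refine le_trans ?_ (this A (hS.symbols A h) h)
  exact Nat.le_mul_of_pos_right _ (subtreeSize_pos h)

end

section

/-! ### Programs without overflow -/

/-- The effect of an instruction that is not a jump on the list of registers, over the natural
numbers. -/
def Instr.effect (m : ℕ → ℕ) (l : List ℕ) : Instr → List ℕ
  | .const d v => l.set d v
  | .op .add d a b => l.set d (l.getD a 0 + l.getD b 0)
  | .op .sub d a b => l.set d (l.getD a 0 - l.getD b 0)
  | .op .mul d a b => l.set d (l.getD a 0 * l.getD b 0)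
  | .op .div d a b => l.set d (l.getD a 0 / l.getD b 0)
  | .op .mod d a b => l.set d (l.getD a 0 % l.getD b 0)
  | .op .xor d a b => l.set d (l.getD a 0 ^^^ l.getD b 0)
  | .load d a => l.set d (m (l.getD a 0))
  | _ => l

/-- The instruction has that effect also on words of `w` bits. -/
def Instr.Fits (w : ℕ) (l : List ℕ) : Instr → Prop
  | .const _ v => v < 2 ^ w
  | .op .add _ a b => l.getD a 0 + l.getD b 0 < 2 ^ w
  | .op .sub _ a b => l.getD b 0 ≤ l.getD a 0 ∧ l.getD a 0 < 2 ^ w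
  | .op .mul _ a b => l.getD a 0 * l.getD b 0 < 2 ^ w
  | .op .div _ _ _ | .op .mod _ _ _ | .op .xor _ _ _ | .load _ _ => True
  | _ => False

/-- The instruction is followed by the next one and writes one of the first `n` registers. -/
def Instr.straight (n : ℕ) : Instr → Bool
  | .const d _ | .op _ d _ _ | .load d _ => decide (d < n)
  | _ => false

/-- All instructions of a list fit, when executed one after another. -/
def FitsAll (w : ℕ) (m : ℕ → ℕ) : List Instr → List ℕ → Prop
  | [], _ => True
  | i :: cs, l => i.Fits w l ∧ FitsAll w m cs (i.effect m l)

/-- The registers given by a list. -/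
def rg (l : List ℕ) : ℕ → ℕ := fun r => l.getD r 0

theorem update_rg {l : List ℕ} {d : ℕ} (h : d < l.length) (v : ℕ) :
    Function.update (rg l) d v = rg (l.set d v) := by
  funext r
  rcases eq_or_ne r d with rfl | hr
  · simp [rg, h]
  · simp [rg, Function.update_of_ne hr, hr.symm]

theorem length_effect (m : ℕ → ℕ) (l : List ℕ) (i : Instr) :
    (i.effect m l).length = l.length := by
  rcases i with _ | ⟨o, _, _, _⟩ | _ | _ | _ | _ | _
  case op => cases o <;> simp [Instr.effect]
  all_goals simp [Instr.effect]

theorem step_of_fits {w : ℕ} {P : List Instr} {pc : ℕ} {l : List ℕ} {m : ℕ → ℕ} {i : Instr}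
    (hi : P[pc]? = some i) (hs : i.straight l.length = true) (hf : i.Fits w l) :
    step w P ⟨pc, rg l, m⟩ = ⟨pc + 1, rg (i.effect m l), m⟩ := by
  rcases i with ⟨d, v⟩ | ⟨o, d, a, b⟩ | ⟨d, a⟩ | _ | _ | _ | _
  · simp only [Instr.straight, decide_eq_true_eq] at hs
    simp only [Instr.Fits] at hf
    simp [step, hi, update_rg hs, Instr.effect, Nat.mod_eq_of_lt hf]
  · simp only [Instr.straight, decide_eq_true_eq] at hs
    have hr : ∀ a, rg l a = l.getD a 0 := fun _ => rfl
    cases o <;> simp only [Instr.Fits] at hf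
    case sub =>
      have : l.getD a 0 + 2 ^ w - l.getD b 0 = (l.getD a 0 - l.getD b 0) + 2 ^ w := by omega
      have h2 : (l.getD a 0 + 2 ^ w - l.getD b 0) % 2 ^ w = l.getD a 0 - l.getD b 0 := by
        rw [this, Nat.add_mod_right, Nat.mod_eq_of_lt (by omega)]
      simp only [step, hi, Option.getD_some, Op.eval, hr, h2, update_rg hs, Instr.effect]
    case add | mul =>
      simp only [step, hi, Option.getD_some, Op.eval, hr, Nat.mod_eq_of_lt hf, update_rg hs,
        Instr.effect]
    case div | mod | xor =>
      simp only [step, hi, Option.getD_some, Op.eval, hr, update_rg hs, Instr.effect]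
  · simp only [Instr.straight, decide_eq_true_eq] at hs
    simp [step, hi, update_rg hs, Instr.effect, rg]
  all_goals simp [Instr.straight] at hs

/-- The program leads from one position and list of registers to another one in at most `n`
steps. -/
def Run (w : ℕ) (P : List Instr) (m : ℕ → ℕ) (n : ℕ) (pc : ℕ) (l : List ℕ) (pc' : ℕ)
    (l' : List ℕ) : Prop :=
  ∃ t ≤ n, (step w P)^[t] ⟨pc, rg l, m⟩ = ⟨pc', rg l', m⟩

variable {w : ℕ} {P : List Instr} {m : ℕ → ℕ}

theorem Run.refl (pc : ℕ) (l : List ℕ) : Run w P m 0 pc l pc l := ⟨0, le_rfl, rfl⟩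

theorem Run.mono {n n' pc pc' : ℕ} {l l' : List ℕ} (h : Run w P m n pc l pc' l') (hn : n ≤ n') :
    Run w P m n' pc l pc' l' := by
  obtain ⟨t, ht, e⟩ := h
  exact ⟨t, ht.trans hn, e⟩

theorem Run.trans {n n' pc pc' pc'' : ℕ} {l l' l'' : List ℕ} (h : Run w P m n pc l pc' l')
    (h' : Run w P m n' pc' l' pc'' l'') : Run w P m (n + n') pc l pc'' l'' := by
  obtain ⟨t, ht, e⟩ := h
  obtain ⟨t', ht', e'⟩ := h'
  exact ⟨t' + t, by omega, by rw [Function.iterate_add_apply, e, e']⟩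

/-- Executing straight-line code is reduced to folding `Instr.effect` over the natural numbers, with
the absence of overflow as a separate arithmetic obligation. For a concrete program the first two
hypotheses hold by `rfl`. -/
theorem Run.code (cs : List Instr) {pc : ℕ} {l : List ℕ}
    (hP : (P.drop pc).take cs.length = cs) (hs : cs.all (Instr.straight l.length) = true)
    (hf : FitsAll w m cs l) :
    Run w P m cs.length pc l (pc + cs.length) (cs.foldl (Instr.effect m) l) := by
  induction cs generalizing pc l with
  | nil => exact Run.refl _ _
  | cons i cs ih =>
    have hi : P[pc]? = some i := by
      have := congrArg (fun l => l[0]?) hP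
      simpa using this
    have hP' : (P.drop (pc + 1)).take cs.length = cs := by
      cases h : P.drop pc with
      | nil => simp [h] at hP
      | cons a R =>
        rw [← List.drop_drop, h]
        rw [h, List.length_cons, List.take_succ_cons] at hP
        exact (List.cons.inj hP).2
    simp only [List.all_cons, Bool.and_eq_true] at hs
    have h1 : Run w P m 1 pc l (pc + 1) (i.effect m l) := ⟨1, le_rfl, step_of_fits hi hs.1 hf.1⟩
    have h2 := h1.trans (ih hP' (by rw [length_effect]; exact hs.2) hf.2)
    simp only [List.length_cons, List.foldl_cons]
    rw [show pc + (cs.length + 1) = pc + 1 + cs.length by ring]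
    exact h2.mono (by omega)

theorem Run.code_eq (cs : List Instr) {n pc pc' : ℕ} {l l' : List ℕ}
    (hP : (P.drop pc).take cs.length = cs) (hs : cs.all (Instr.straight l.length) = true)
    (hf : FitsAll w m cs l) (hl : cs.foldl (Instr.effect m) l = l') (hn : cs.length = n)
    (hpc : pc + n = pc') :
    Run w P m n pc l pc' l' := by
  subst hl hpc hn
  exact Run.code cs hP hs hf

theorem Run.jlt {pc a b t : ℕ} {l : List ℕ} (hP : P[pc]? = some (.jlt a b t))
    (h : l.getD a 0 < l.getD b 0) : Run w P m 1 pc l t l :=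
  ⟨1, le_rfl, by simp only [Function.iterate_one, step, hP, Option.getD_some, rg, h, if_true]⟩

theorem Run.not_jlt {pc a b t : ℕ} {l : List ℕ} (hP : P[pc]? = some (.jlt a b t))
    (h : ¬ l.getD a 0 < l.getD b 0) : Run w P m 1 pc l (pc + 1) l :=
  ⟨1, le_rfl, by simp only [Function.iterate_one, step, hP, Option.getD_some, rg, h, if_false]⟩

theorem Run.jeq {pc a b t : ℕ} {l : List ℕ} (hP : P[pc]? = some (.jeq a b t))
    (h : l.getD a 0 = l.getD b 0) : Run w P m 1 pc l t l :=
  ⟨1, le_rfl, by simp only [Function.iterate_one, step, hP, Option.getD_some, rg, h, if_true]⟩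

theorem Run.not_jeq {pc a b t : ℕ} {l : List ℕ} (hP : P[pc]? = some (.jeq a b t))
    (h : ¬ l.getD a 0 = l.getD b 0) : Run w P m 1 pc l (pc + 1) l :=
  ⟨1, le_rfl, by simp only [Function.iterate_one, step, hP, Option.getD_some, rg, h, if_false]⟩

/-! ### The query program

Memory consists of rows of 32 words; a pointer is the address of the first word of a row.
Columns 0 to 10 are about symbols: length, 1 for a run, base of the run, first slot, root of the
search tree of the slots, leaf of the leftmost path, fields and marks of the code of that path,
array of the nonterminals above the symbol, signature, power of the base.
Columns 11 to 18 are about slots: length, signature, power and inverse power of the prefix before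
the slot, symbol, children in the search tree, last slot.
Column 19 is for the arrays of nonterminals, column 20 for the strings of the queries and
column 21 for the modulus.

Registers: 0 signature so far, 1 remaining length, 2 power of the base, 3 modulus, 4 current
slot or symbol, 12 to 14 and 16 the constants 32, 0, 1, 2, and 15 a counter. -/

/-- `R[d] := M[R[a] + f]` -/
abbrev ldField (d a f : ℕ) : List Instr := [.const d f, .op .add d d a, .load d d]

abbrev codeInit : List Instr :=
  [.const 12 32, .const 14 1, .const 15 3, .const 16 2, .const 3 21, .load 3 3, .op .mul 4 0 12,
    .const 9 20, .op .add 9 9 4, .load 4 9, .const 0 0, .const 2 1]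

abbrev codeGallop : List Instr := List.flatten [
    ldField 5 4 11, [.op .add 5 5 1, .op .add 6 4 13, .op .add 7 12 13], ldField 8 4 18]

abbrev codeSkip : List Instr := List.flatten [
    ldField 10 6 11, [.op .sub 1 5 10], ldField 10 6 12, [.op .add 10 10 3], ldField 11 4 12,
    [.op .sub 10 10 11], ldField 11 4 14,
    [.op .mul 10 10 11, .op .mod 10 10 3, .op .mul 10 10 2, .op .add 0 0 10, .op .mod 0 0 3],
    ldField 10 6 13, [.op .mul 10 10 11, .op .mod 10 10 3, .op .mul 2 2 10, .op .mod 2 2 3]]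

abbrev codeSpine : List Instr := List.flatten [
    ldField 5 4 6, ldField 6 4 7, ldField 9 4 5]

abbrev codeClimb : List Instr := List.flatten [
    [.op .sub 7 6 14, .op .xor 7 6 7, .op .add 7 7 14, .op .mod 8 5 7, .op .div 5 5 7,
      .op .div 6 6 7, .op .mul 8 8 12],
    ldField 10 9 8, [.op .add 10 10 8], ldField 9 10 19, ldField 10 9 0]

abbrev codeFound : List Instr := List.flatten [
    ldField 7 5 12, [.op .mul 7 7 2, .op .add 0 0 7, .op .mod 0 0 3], ldField 7 5 13,
    [.op .mul 2 2 7, .op .mod 2 2 3, .op .sub 1 1 6], ldField 4 5 15]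

abbrev codeRun : List Instr := List.flatten [
    ldField 5 4 2, [.op .add 4 5 13], ldField 6 4 0, [.op .div 5 1 6, .op .mod 1 1 6],
    ldField 17 4 9, ldField 18 4 10]

abbrev codeAppend : List Instr :=
  [.op .mul 7 2 17, .op .add 0 0 7, .op .mod 0 0 3, .op .mul 2 2 18, .op .mod 2 2 3]

abbrev codeSquare : List Instr :=
  [.op .mul 7 18 17, .op .add 17 17 7, .op .mod 17 17 3, .op .mul 18 18 18, .op .mod 18 18 3]

/-- The query program.  Positions: 12 galloping search from a slot, 21 its doubling phase,
30 its halving phase, 40 jump over the slots found, 73 leftmost path of a symbol, 82 step on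
that path, 105 descent into a symbol, 112 search tree, 148 run, 163 powers, 180 end. -/
def prog : List Instr := List.flatten [
    codeInit, codeGallop, [.op .add 9 6 7, .jlt 8 9 30], ldField 10 9 11,
    [.jlt 5 10 30, .op .add 6 9 13, .op .add 7 7 7, .jeq 0 0 21],
    [.jeq 7 12 40, .op .div 7 7 16, .op .add 9 6 7, .jlt 8 9 30], ldField 10 9 11,
    [.jlt 5 10 30, .op .add 6 9 13, .jeq 0 0 30], codeSkip, [.jeq 1 13 180], ldField 4 6 15,
    [.jeq 15 13 105, .op .sub 15 15 14], codeSpine, codeClimb, [.jlt 1 10 101, .jeq 0 0 82],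
    ldField 4 9 3, [.jeq 0 0 12], ldField 10 4 1, [.jeq 10 14 148], ldField 5 4 4, ldField 6 5 11,
    [.jlt 1 6 126, .op .add 7 5 12], ldField 8 7 11, [.jlt 1 8 131], ldField 7 5 17,
    [.op .add 5 7 13, .jeq 0 0 112], ldField 7 5 16, [.op .add 5 7 13, .jeq 0 0 112], codeFound,
    [.jeq 1 13 180, .jeq 0 0 105], codeRun,
    [.jeq 5 13 178, .op .mod 6 5 16, .op .div 5 5 16, .jeq 6 13 172], codeAppend, codeSquare,
    [.jeq 0 0 163], [.jeq 1 13 180, .jeq 0 0 105, .halt]]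

end

/-! ### Galloping search -/

/-- Length of the expansion of the first `i` slots of a symbol. -/
def Sym.cum (A : Sym) (i : ℕ) : ℕ := (expand (A.slots.take i)).length

theorem Sym.cum_zero (A : Sym) : A.cum 0 = 0 := by simp [Sym.cum]

theorem Sym.cum_length (A : Sym) : A.cum A.slots.length = A.exp.length := by
  rw [Sym.cum, List.take_length, expand_slots]

theorem Sym.cum_succ {A : Sym} {i : ℕ} (h : i < A.slots.length) :
    A.cum (i + 1) = A.cum i + A.slots[i].exp.length := by
  rw [Sym.cum, Sym.cum, ← List.take_append_getElem h, expand_append, List.length_append]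
  simp

theorem Sym.cum_monotone (A : Sym) : Monotone A.cum := by
  refine monotone_nat_of_le_succ fun i => ?_
  rcases lt_or_ge i A.slots.length with h | h
  · rw [Sym.cum_succ h]; omega
  · rw [Sym.cum, Sym.cum, List.take_of_length_le h, List.take_of_length_le (by omega)]

/-- Every slot expands to at least one letter. Hence a search that passes over slots within `rem`
letters passes over at most `rem` of them. -/
theorem Sym.Parsed.cum_add_le {π : ℕ → Sym → ℕ} {T : List ℕ} {S : Sym} (hS : S.Parsed π T)
    {A : Sym} (hA : A ∈ S.nonterminals) {i j : ℕ} (h : i + j ≤ A.slots.length) :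
    A.cum i + j ≤ A.cum (i + j) := by
  induction j with
  | zero => simp
  | succ j ih =>
    have h1 := ih (by omega)
    have h2 := Sym.cum_succ (show i + j < A.slots.length by omega)
    have h3 := (hS.symbols _ (mem_symbols_of_mem_slots hA
      (List.getElem_mem (show i + j < A.slots.length by omega)))).length_pos
    change A.cum i + j + 1 ≤ A.cum (i + j + 1)
    omega

/-- The data structure for the grammar with initial symbol `S` is in memory: `sp`, `sl` and `ca`
are the addresses of symbols, slots and arrays, `rk` are the ranks in the arrays, and `L`, `R`
and `root` give the search trees on the slots. -/
structure Stores (w p c n : ℕ) (S : Sym) (rk : Sym → ℕ) (L R : Sym → ℕ → ℕ) (root : Sym → ℕ)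
    (sp : Sym → ℕ) (sl : Sym → ℕ → ℕ) (ca : Sym → ℕ) (m : ℕ → ℕ) : Prop where
  len : ∀ A ∈ S.symbols, m (sp A) = A.exp.length
  isRun : ∀ B t, .run B t ∈ S.symbols → m (1 + sp (.run B t)) = 1
  isBlock : ∀ Bs, .block Bs ∈ S.symbols → m (1 + sp (.block Bs)) = 0
  base : ∀ B t, .run B t ∈ S.symbols → m (2 + sp (.run B t)) = sp B
  slot : ∀ A ∈ S.nonterminals, m (3 + sp A) = sl A 0
  treeRoot : ∀ A ∈ S.nonterminals, m (4 + sp A) = sl A (root A)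
  leaf : ∀ A ∈ S.symbols, m (5 + sp A) = sp A.leaf
  fields : ∀ A ∈ S.symbols, m (6 + sp A) = codeFields (A.spine.map rk)
  marks : ∀ A ∈ S.symbols, m (7 + sp A) = codeMarks (A.spine.map rk)
  array : ∀ A ∈ S.symbols, m (8 + sp A) = ca A
  sig : ∀ A ∈ S.symbols, m (9 + sp A) = (sig p c A.exp).val
  pow : ∀ A ∈ S.symbols, m (10 + sp A) = ((c : ZMod p) ^ A.exp.length).val
  cum : ∀ A ∈ S.nonterminals, ∀ i ≤ A.slots.length, m (11 + sl A i) = A.cum i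
  prefixSig : ∀ A ∈ S.nonterminals, ∀ i ≤ A.slots.length,
    m (12 + sl A i) = (LCG.sig p c (expand (A.slots.take i))).val
  prefixPow : ∀ A ∈ S.nonterminals, ∀ i ≤ A.slots.length,
    m (13 + sl A i) = ((c : ZMod p) ^ A.cum i).val
  prefixInv : ∀ A ∈ S.nonterminals, ∀ i ≤ A.slots.length,
    m (14 + sl A i) = ((c : ZMod p) ^ A.cum i)⁻¹.val
  sym : ∀ A ∈ S.nonterminals, ∀ i, ∀ h : i < A.slots.length, m (15 + sl A i) = sp A.slots[i]
  left : ∀ A ∈ S.nonterminals, ∀ i < A.slots.length, m (16 + sl A i) = sl A (L A i)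
  right : ∀ A ∈ S.nonterminals, ∀ i < A.slots.length, m (17 + sl A i) = sl A (R A i)
  last : ∀ A ∈ S.nonterminals, ∀ i ≤ A.slots.length, m (18 + sl A i) = sl A A.slots.length
  entry : ∀ A ∈ S.nonterminals, m (19 + (ca A.first + rk A * 32)) = sp A
  sl_add : ∀ A i, sl A i = sl A 0 + 32 * i
  sp_lt : ∀ A ∈ S.symbols, sp A + 32 < 2 ^ w
  sl_lt : ∀ A ∈ S.nonterminals, ∀ i ≤ A.slots.length, sl A i + 64 * (n + 2) < 2 ^ w
  ca_lt : ∀ A ∈ S.nonterminals, ca A.first + rk A * 32 + 32 < 2 ^ w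
  code_lt : ∀ A ∈ S.symbols, 2 ^ codeBits (A.spine.map rk) < 2 ^ w
  mod_lt : 4 * (p * p) < 2 ^ w
  tree_lt : ∀ A ∈ S.nonterminals, root A < A.slots.length ∧
    ∀ i < A.slots.length, L A i < A.slots.length ∧ R A i < A.slots.length
  search : ∀ A ∈ S.nonterminals, ∀ i < A.slots.length, ∃ d,
    2 ^ d * (A.cum (i + 1) - A.cum i) ≤ A.exp.length ∧
      SearchPath 0 A.slots.length (L A) (R A) i d (root A)

/-- The registers of the query program. -/
abbrev regs (p ctr acc rem pw cur r₅ r₆ r₇ r₈ r₉ r₁₀ r₁₁ r₁₇ r₁₈ : ℕ) : List ℕ :=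
  [acc, rem, pw, p, cur, r₅, r₆, r₇, r₈, r₉, r₁₀, r₁₁, 32, 0, 1, ctr, 2, r₁₇, r₁₈]

section

variable {w p c n : ℕ} {S : Sym} {rk : Sym → ℕ} {L R : Sym → ℕ → ℕ} {root : Sym → ℕ}
  {sp : Sym → ℕ} {sl : Sym → ℕ → ℕ} {ca : Sym → ℕ} {m : ℕ → ℕ}

theorem Stores.run_gallop_start (h : Stores w p c n S rk L R root sp sl ca m) {A : Sym}
    (hA : A ∈ S.nonterminals) {s : ℕ} (hs : s ≤ A.slots.length)
    {ctr acc rem pw r₅ r₆ r₇ r₈ r₉ r₁₀ r₁₁ r₁₇ r₁₈ : ℕ} (hr : A.cum s + rem ≤ n) :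
    Run w prog m 9 12 (regs p ctr acc rem pw (sl A s) r₅ r₆ r₇ r₈ r₉ r₁₀ r₁₁ r₁₇ r₁₈)
      21 (regs p ctr acc rem pw (sl A s) (A.cum s + rem) (sl A s) 32 (sl A A.slots.length)
        r₉ r₁₀ r₁₁ r₁₇ r₁₈) := by
  have h1 := h.sl_lt A hA s hs
  have h2 := h.cum A hA s hs
  have h3 := h.last A hA s hs
  refine Run.code_eq codeGallop rfl rfl ?_ ?_ rfl rfl
  · simp [FitsAll, Instr.Fits, Instr.effect, h2]
    omega
  · simp [Instr.effect, h2, h3]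

variable {π : ℕ → Sym → ℕ} {T : List ℕ}

/-- With step `2 ^ k` the search stands at slot `s + 2 ^ k - 1` and tries `s + 2 ^ (k + 1) - 1`. The
slots passed lie within `rem` letters, so `2 ^ k' ≤ rem + 1` and the number of doublings is
logarithmic in `rem`. The number `f` only serves the induction: the step grows until it exceeds the
number of slots. -/
theorem Stores.run_double (h : Stores w p c n S rk L R root sp sl ca m) (hS : S.Parsed π T)
    {A : Sym} (hA : A ∈ S.nonterminals) (hn : A.slots.length ≤ n) {s rem : ℕ}
    {ctr acc pw r₁₁ r₁₇ r₁₈ : ℕ} (f : ℕ) :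
    ∀ k r₉ r₁₀, A.slots.length < f + 2 ^ k → s + 2 ^ k ≤ A.slots.length + 1 →
      A.cum (s + 2 ^ k - 1) ≤ A.cum s + rem →
    ∃ k' ≥ k, 2 ^ k' ≤ rem + 1 ∧ s + 2 ^ k' ≤ A.slots.length + 1 ∧
      A.cum (s + 2 ^ k' - 1) ≤ A.cum s + rem ∧
      (A.slots.length < s + 2 ^ k' - 1 + 2 ^ k' ∨
        A.cum s + rem < A.cum (s + 2 ^ k' - 1 + 2 ^ k')) ∧
      ∃ r₉' r₁₀', Run w prog m (9 * (k' - k) + 6)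
        21 (regs p ctr acc rem pw (sl A s) (A.cum s + rem) (sl A (s + 2 ^ k - 1)) (32 * 2 ^ k)
          (sl A A.slots.length) r₉ r₁₀ r₁₁ r₁₇ r₁₈)
        30 (regs p ctr acc rem pw (sl A s) (A.cum s + rem) (sl A (s + 2 ^ k' - 1)) (32 * 2 ^ k')
          (sl A A.slots.length) r₉' r₁₀' r₁₁ r₁₇ r₁₈) := by
  induction f with
  | zero =>
    intro k r₉ r₁₀ hf hs hc
    have hk : 0 < 2 ^ k := by positivity
    have hlen := hS.cum_add_le hA (i := s) (j := 2 ^ k - 1) (by omega)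
    rw [show s + (2 ^ k - 1) = s + 2 ^ k - 1 by omega] at hlen
    have a1 := h.sl_add A (s + 2 ^ k - 1)
    have a2 := h.sl_add A A.slots.length
    have hlt := h.sl_lt A hA (s + 2 ^ k - 1) (by omega)
    refine ⟨k, le_rfl, by omega, hs, hc, .inl (by omega), sl A (s + 2 ^ k - 1) + 32 * 2 ^ k,
      r₁₀, ?_⟩
    refine Run.mono (Run.trans
      (Run.code_eq (n := 1) (pc' := 22) [.op .add 9 6 7] rfl rfl ?_ rfl rfl rfl)
      (Run.jlt rfl ?_)) (by omega)
    · simp [FitsAll, Instr.Fits]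
      omega
    · simp [Instr.effect]
      omega
  | succ f ih =>
    intro k r₉ r₁₀ hf hs hc
    have hk : 0 < 2 ^ k := by positivity
    have hk' : 2 ^ (k + 1) = 2 ^ k + 2 ^ k := by ring
    have hlen := hS.cum_add_le hA (i := s) (j := 2 ^ k - 1) (by omega)
    rw [show s + (2 ^ k - 1) = s + 2 ^ k - 1 by omega] at hlen
    have a1 := h.sl_add A (s + 2 ^ k - 1)
    have a2 := h.sl_add A A.slots.length
    have a3 := h.sl_add A (s + 2 ^ k - 1 + 2 ^ k)
    have hlt := h.sl_lt A hA (s + 2 ^ k - 1) (by omega)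
    have r1 : Run w prog m 1
        21 (regs p ctr acc rem pw (sl A s) (A.cum s + rem) (sl A (s + 2 ^ k - 1)) (32 * 2 ^ k)
          (sl A A.slots.length) r₉ r₁₀ r₁₁ r₁₇ r₁₈)
        22 (regs p ctr acc rem pw (sl A s) (A.cum s + rem) (sl A (s + 2 ^ k - 1)) (32 * 2 ^ k)
          (sl A A.slots.length) (sl A (s + 2 ^ k - 1 + 2 ^ k)) r₁₀ r₁₁ r₁₇ r₁₈) := by
      refine Run.code_eq [.op .add 9 6 7] rfl rfl ?_ ?_ rfl rfl
      · simp [FitsAll, Instr.Fits]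
        omega
      · simp [Instr.effect]
        omega
    by_cases h1 : A.slots.length < s + 2 ^ k - 1 + 2 ^ k
    · refine ⟨k, le_rfl, by omega, hs, hc, .inl h1, _, _,
        (r1.trans (Run.jlt rfl ?_)).mono (by omega)⟩
      simp
      omega
    have b1 := h.cum A hA (s + 2 ^ k - 1 + 2 ^ k) (by omega)
    have hlt' := h.sl_lt A hA (s + 2 ^ k - 1 + 2 ^ k) (by omega)
    have r2 : Run w prog m 4
        22 (regs p ctr acc rem pw (sl A s) (A.cum s + rem) (sl A (s + 2 ^ k - 1)) (32 * 2 ^ k)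
          (sl A A.slots.length) (sl A (s + 2 ^ k - 1 + 2 ^ k)) r₁₀ r₁₁ r₁₇ r₁₈)
        26 (regs p ctr acc rem pw (sl A s) (A.cum s + rem) (sl A (s + 2 ^ k - 1)) (32 * 2 ^ k)
          (sl A A.slots.length) (sl A (s + 2 ^ k - 1 + 2 ^ k))
          (A.cum (s + 2 ^ k - 1 + 2 ^ k)) r₁₁ r₁₇ r₁₈) := by
      refine (Run.not_jlt rfl (by simp; omega)).trans
        (Run.code_eq (ldField 10 9 11) rfl rfl ?_ ?_ rfl rfl)
      · simp [FitsAll, Instr.Fits, Instr.effect]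
        omega
      · simp [Instr.effect, b1]
    by_cases h2 : A.cum s + rem < A.cum (s + 2 ^ k - 1 + 2 ^ k)
    · exact ⟨k, le_rfl, by omega, hs, hc, .inr h2, _, _,
        ((r1.trans r2).trans (Run.jlt rfl (by simpa using h2))).mono (by omega)⟩
    have e : s + 2 ^ k - 1 + 2 ^ k = s + 2 ^ (k + 1) - 1 := by omega
    have r3 : Run w prog m 4
        26 (regs p ctr acc rem pw (sl A s) (A.cum s + rem) (sl A (s + 2 ^ k - 1)) (32 * 2 ^ k)
          (sl A A.slots.length) (sl A (s + 2 ^ k - 1 + 2 ^ k))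
          (A.cum (s + 2 ^ k - 1 + 2 ^ k)) r₁₁ r₁₇ r₁₈)
        21 (regs p ctr acc rem pw (sl A s) (A.cum s + rem) (sl A (s + 2 ^ (k + 1) - 1))
          (32 * 2 ^ (k + 1)) (sl A A.slots.length) (sl A (s + 2 ^ k - 1 + 2 ^ k))
          (A.cum (s + 2 ^ k - 1 + 2 ^ k)) r₁₁ r₁₇ r₁₈) := by
      refine Run.mono (Run.trans (n' := 1) (Run.trans (Run.not_jlt rfl h2)
        (Run.code_eq (n := 2) (pc' := 29) [.op .add 6 9 13, .op .add 7 7 7] rfl rfl ?_ ?_ rfl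
          rfl)) (Run.jeq rfl rfl)) (le_refl 4)
      · simp [FitsAll, Instr.Fits, Instr.effect]
        omega
      · simp [Instr.effect, e, hk', mul_add]
    obtain ⟨k', hk1, hk2, hk3, hk4, hk5, r₉', r₁₀', r4⟩ := ih (k + 1)
      (sl A (s + 2 ^ k - 1 + 2 ^ k)) (A.cum (s + 2 ^ k - 1 + 2 ^ k)) (by omega) (by omega)
      (by rw [← e]; omega)
    exact ⟨k', by omega, hk2, hk3, hk4, hk5, r₉', r₁₀',
      (((r1.trans r2).trans r3).trans r4).mono (by omega)⟩

/-- The invariant is that slot `i` is not beyond the target while slot `i + 2 ^ k` is, or does not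
exist. Slot number `A.slots.length` is allowed: it stands for the end of the rule. -/
theorem Stores.run_halve (h : Stores w p c n S rk L R root sp sl ca m)
    {A : Sym} (hA : A ∈ S.nonterminals) (hn : A.slots.length ≤ n) {s tgt : ℕ}
    {ctr acc rem pw r₁₁ r₁₇ r₁₈ : ℕ} (k : ℕ) :
    ∀ i r₉ r₁₀, i ≤ A.slots.length → s ≤ i → A.cum i ≤ tgt → 2 ^ k ≤ n + 1 →
      (A.slots.length < i + 2 ^ k ∨ tgt < A.cum (i + 2 ^ k)) →
    ∃ i', i' ≤ A.slots.length ∧ s ≤ i' ∧ A.cum i' ≤ tgt ∧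
      (A.slots.length < i' + 1 ∨ tgt < A.cum (i' + 1)) ∧
      ∃ r₉' r₁₀', Run w prog m (10 * k + 1)
        30 (regs p ctr acc rem pw (sl A s) tgt (sl A i) (32 * 2 ^ k)
          (sl A A.slots.length) r₉ r₁₀ r₁₁ r₁₇ r₁₈)
        40 (regs p ctr acc rem pw (sl A s) tgt (sl A i') 32
          (sl A A.slots.length) r₉' r₁₀' r₁₁ r₁₇ r₁₈) := by
  induction k with
  | zero =>
    intro i r₉ r₁₀ hi hsi hc _ hk
    exact ⟨i, hi, hsi, hc, hk, r₉, r₁₀, Run.jeq rfl rfl⟩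
  | succ k ih =>
    intro i r₉ r₁₀ hi hsi hc hkn hk
    have hk0 : 0 < 2 ^ k := by positivity
    have hk' : 2 ^ (k + 1) = 2 ^ k + 2 ^ k := by ring
    have a1 := h.sl_add A i
    have a2 := h.sl_add A A.slots.length
    have a3 := h.sl_add A (i + 2 ^ k)
    have hlt := h.sl_lt A hA i hi
    have r1 : Run w prog m 3
        30 (regs p ctr acc rem pw (sl A s) tgt (sl A i) (32 * 2 ^ (k + 1))
          (sl A A.slots.length) r₉ r₁₀ r₁₁ r₁₇ r₁₈)
        33 (regs p ctr acc rem pw (sl A s) tgt (sl A i) (32 * 2 ^ k)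
          (sl A A.slots.length) (sl A (i + 2 ^ k)) r₁₀ r₁₁ r₁₇ r₁₈) := by
      have hd : 32 * 2 ^ (k + 1) / 2 = 32 * 2 ^ k := by omega
      refine (Run.not_jeq rfl (by simp)).trans
        (Run.code_eq [.op .div 7 7 16, .op .add 9 6 7] rfl rfl ?_ ?_ rfl rfl)
      · simp [FitsAll, Instr.Fits, Instr.effect, hd]
        omega
      · simp [Instr.effect, hd]
        omega
    by_cases h1 : A.slots.length < i + 2 ^ k
    · obtain ⟨i', h1', h2', h3', h4', r₉', r₁₀', r⟩ := ih i (sl A (i + 2 ^ k)) r₁₀ hi hsi hc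
        (by omega) (.inl h1)
      exact ⟨i', h1', h2', h3', h4', r₉', r₁₀',
        ((r1.trans (Run.jlt rfl (by simp; omega))).trans r).mono (by omega)⟩
    have b1 := h.cum A hA (i + 2 ^ k) (by omega)
    have hlt' := h.sl_lt A hA (i + 2 ^ k) (by omega)
    have r2 : Run w prog m 4
        33 (regs p ctr acc rem pw (sl A s) tgt (sl A i) (32 * 2 ^ k)
          (sl A A.slots.length) (sl A (i + 2 ^ k)) r₁₀ r₁₁ r₁₇ r₁₈)
        37 (regs p ctr acc rem pw (sl A s) tgt (sl A i) (32 * 2 ^ k)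
          (sl A A.slots.length) (sl A (i + 2 ^ k)) (A.cum (i + 2 ^ k)) r₁₁ r₁₇ r₁₈) := by
      refine (Run.not_jlt rfl (by simp; omega)).trans
        (Run.code_eq (ldField 10 9 11) rfl rfl ?_ ?_ rfl rfl)
      · simp [FitsAll, Instr.Fits, Instr.effect]
        omega
      · simp [Instr.effect, b1]
    by_cases h2 : tgt < A.cum (i + 2 ^ k)
    · obtain ⟨i', h1', h2', h3', h4', r₉', r₁₀', r⟩ := ih i (sl A (i + 2 ^ k))
        (A.cum (i + 2 ^ k)) hi hsi hc (by omega) (.inr h2)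
      exact ⟨i', h1', h2', h3', h4', r₉', r₁₀',
        (((r1.trans r2).trans (Run.jlt rfl (by simpa using h2))).trans r).mono (by omega)⟩
    have r3 : Run w prog m 3
        37 (regs p ctr acc rem pw (sl A s) tgt (sl A i) (32 * 2 ^ k)
          (sl A A.slots.length) (sl A (i + 2 ^ k)) (A.cum (i + 2 ^ k)) r₁₁ r₁₇ r₁₈)
        30 (regs p ctr acc rem pw (sl A s) tgt (sl A (i + 2 ^ k)) (32 * 2 ^ k)
          (sl A A.slots.length) (sl A (i + 2 ^ k)) (A.cum (i + 2 ^ k)) r₁₁ r₁₇ r₁₈) := by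
      refine Run.mono (Run.trans (n' := 1) (Run.trans (Run.not_jlt rfl h2)
        (Run.code_eq (n := 1) (pc' := 39) [.op .add 6 9 13] rfl rfl ?_ rfl rfl rfl)) ?_) (le_refl 3)
      · simp [FitsAll, Instr.Fits]
        omega
      · exact Run.jeq rfl rfl
    obtain ⟨i', h1', h2', h3', h4', r₉', r₁₀', r⟩ := ih (i + 2 ^ k) (sl A (i + 2 ^ k))
      (A.cum (i + 2 ^ k)) (by omega) (by omega) (by omega) (by omega)
      (by rw [hk', ← add_assoc] at hk; exact hk)
    exact ⟨i', h1', h2', h3', h4', r₉', r₁₀',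
      (((r1.trans r2).trans r3).trans r).mono (by omega)⟩

end

/-- The registers are those of the query program, with arbitrary scratch registers. -/
def Ready (p ctr acc rem pw cur : ℕ) (l : List ℕ) : Prop :=
  ∃ r₅ r₆ r₇ r₈ r₉ r₁₀ r₁₁ r₁₇ r₁₈, l = regs p ctr acc rem pw cur r₅ r₆ r₇ r₈ r₉ r₁₀ r₁₁ r₁₇ r₁₈

/-- The query program stops within `N` steps with the answer `v`. -/
def Stops (w : ℕ) (m : ℕ → ℕ) (N pc : ℕ) (l : List ℕ) (v : ℕ) : Prop :=
  ∃ l', l'.getD 0 0 = v ∧ Run w prog m N pc l 180 l'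

theorem Stops.of_run {w : ℕ} {m : ℕ → ℕ} {n N N' pc pc' v : ℕ} {l l' : List ℕ}
    (h : Run w prog m n pc l pc' l') (hs : Stops w m N pc' l' v) (hN : n + N ≤ N') :
    Stops w m N' pc l v := by
  obtain ⟨l'', hl, hr⟩ := hs
  exact ⟨l'', hl, (h.trans hr).mono hN⟩

theorem mod_eq_val {p N : ℕ} {z : ZMod p} (h : (N : ZMod p) = z) : N % p = z.val := by
  rw [← h, ZMod.val_natCast]

theorem mul_lt_of_mod_lt {w p a b : ℕ} (h : 4 * (p * p) < 2 ^ w) (ha : a ≤ 2 * p)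
    (hb : b ≤ p) : a * b < 2 ^ w := by
  have := Nat.mul_le_mul ha hb
  rw [mul_assoc] at this
  omega

section

variable {w p c n : ℕ} {S : Sym} {rk : Sym → ℕ} {L R : Sym → ℕ → ℕ} {root : Sym → ℕ}
  {sp : Sym → ℕ} {sl : Sym → ℕ → ℕ} {ca : Sym → ℕ} {m : ℕ → ℕ}
  {π : ℕ → Sym → ℕ} {T : List ℕ}

theorem expand_slots_split (A : Sym) {s i : ℕ} (h : s ≤ i) :
    expand (A.slots.take i) =
      expand (A.slots.take s) ++ expand ((A.slots.take i).drop s) := by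
  rw [← expand_append]
  congr 1
  have := List.take_append_drop s (A.slots.take i)
  rwa [List.take_take, min_eq_left h, eq_comm] at this

theorem length_expand_drop_take (A : Sym) {s i : ℕ} (h : s ≤ i) :
    (expand ((A.slots.take i).drop s)).length = A.cum i - A.cum s := by
  have := congrArg List.length (expand_slots_split A h)
  rw [List.length_append] at this
  rw [Sym.cum, Sym.cum]
  omega

/-- The signature of slots `s` to `i` is the difference of two prefix signatures, divided by `c ^
A.cum s`; the inverse of that power is stored. -/
theorem Stores.run_skip [Fact p.Prime] (hc : (c : ZMod p) ≠ 0)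
    (h : Stores w p c n S rk L R root sp sl ca m) {A : Sym} (hA : A ∈ S.nonterminals)
    (hn : A.exp.length ≤ n) (hnw : n < 2 ^ w) {s i rem : ℕ} (hs : s ≤ A.slots.length)
    (hi : i ≤ A.slots.length) (hsi : s ≤ i) (hr : A.cum s + rem ≤ A.exp.length)
    (hir : A.cum i ≤ A.cum s + rem)
    {ctr r₇ r₈ r₉ r₁₀ r₁₁ r₁₇ r₁₈ : ℕ} (x y : ZMod p) :
    ∃ r₁₀' r₁₁', Run w prog m 27
      40 (regs p ctr x.val rem y.val (sl A s) (A.cum s + rem) (sl A i) r₇ r₈ r₉ r₁₀ r₁₁ r₁₇ r₁₈)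
      67 (regs p ctr (x + y * LCG.sig p c (expand ((A.slots.take i).drop s))).val
        (A.cum s + rem - A.cum i)
        (y * (c : ZMod p) ^ (A.cum i - A.cum s)).val (sl A s) (A.cum s + rem) (sl A i)
        r₇ r₈ r₉ r₁₀' r₁₁' r₁₇ r₁₈) := by
  have hp : 0 < p := (Fact.out : p.Prime).pos
  have l1 := h.sl_lt A hA s hs
  have l2 := h.sl_lt A hA i hi
  have c1 := h.cum A hA i hi
  have c2 := h.prefixSig A hA i hi
  have c3 := h.prefixSig A hA s hs
  have c4 := h.prefixInv A hA s hs
  have c5 := h.prefixPow A hA i hi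
  have hmono := A.cum_monotone hsi
  have hsplit : LCG.sig p c (expand (A.slots.take i)) = LCG.sig p c (expand (A.slots.take s)) +
      (c : ZMod p) ^ A.cum s * LCG.sig p c (expand ((A.slots.take i).drop s)) := by
    rw [expand_slots_split A hsi, sig_append]; rfl
  have hpow : (c : ZMod p) ^ A.cum i = (c : ZMod p) ^ A.cum s *
      (c : ZMod p) ^ (A.cum i - A.cum s) := by
    rw [← pow_add]; congr 1; omega
  have hinv : (c : ZMod p) ^ A.cum s ≠ 0 := pow_ne_zero _ hc
  set Fi := LCG.sig p c (expand (A.slots.take i)) with hFi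
  set Fs := LCG.sig p c (expand (A.slots.take s)) with hFs
  set I := ((c : ZMod p) ^ A.cum s)⁻¹ with hI
  have v1 := ZMod.val_lt Fi
  have v2 := ZMod.val_lt Fs
  have v3 := ZMod.val_lt I
  have v4 := ZMod.val_lt x
  have v5 := ZMod.val_lt y
  have v6 := ZMod.val_lt ((c : ZMod p) ^ A.cum i)
  have hpp := h.mod_lt
  have hple : p ≤ p * p := Nat.le_mul_of_pos_left p hp
  -- The modulus is added before the subtraction so that the difference is not negative; the first
  -- factor is then below `2 * p`, whence the 4 in `mod_lt` leaves ample room.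
  have m1 : (Fi.val + p - Fs.val) * I.val < 2 ^ w := mul_lt_of_mod_lt hpp (by omega) v3.le
  have q1 : (Fi.val + p - Fs.val) * I.val % p * y.val ≤ p * p :=
    Nat.mul_le_mul (Nat.mod_lt _ hp).le v5.le
  have m2 : ((c : ZMod p) ^ A.cum i).val * I.val < 2 ^ w :=
    mul_lt_of_mod_lt hpp (by omega) v3.le
  have m3 : y.val * (((c : ZMod p) ^ A.cum i).val * I.val % p) < 2 ^ w :=
    mul_lt_of_mod_lt hpp (by omega) (Nat.mod_lt _ hp).le
  have e1 : (x.val + (Fi.val + p - Fs.val) * I.val % p * y.val) % p =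
      (x + y * LCG.sig p c (expand ((A.slots.take i).drop s))).val := by
    refine mod_eq_val ?_
    rw [Nat.cast_add, Nat.cast_mul, ZMod.natCast_mod, Nat.cast_mul, Nat.cast_sub (by omega),
      Nat.cast_add]
    simp only [ZMod.natCast_zmod_val, CharP.cast_eq_zero]
    rw [hsplit, hI]
    field_simp
    ring
  have e2 : y.val * (((c : ZMod p) ^ A.cum i).val * I.val % p) % p =
      (y * (c : ZMod p) ^ (A.cum i - A.cum s)).val := by
    refine mod_eq_val ?_
    rw [Nat.cast_mul, ZMod.natCast_mod, Nat.cast_mul]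
    simp only [ZMod.natCast_zmod_val]
    rw [hpow, hI]
    field_simp
  refine ⟨_, _, Run.code_eq codeSkip rfl rfl ?_ (l' := regs p ctr _ _ _ _ _ _ _ _ _
    (((c : ZMod p) ^ A.cum i).val * I.val % p) I.val _ _) ?_ rfl rfl⟩
  · simp [FitsAll, Instr.Fits, Instr.effect, c1, c2, c3, c4, c5]
    refine ⟨?_, ?_, ?_, ?_, ?_, ?_, ?_, ?_, ?_, ?_, ?_, ?_⟩
    all_goals first | assumption | omega
  · simp [Instr.effect, c1, c2, c3, c4, c5, e1, e2]

end

/-! ### Search on leftmost paths and search trees -/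

section

variable {w p c n : ℕ} {S : Sym} {rk : Sym → ℕ} {L R : Sym → ℕ → ℕ} {root : Sym → ℕ}
  {sp : Sym → ℕ} {sl : Sym → ℕ → ℕ} {ca : Sym → ℕ} {m : ℕ → ℕ}
  {π : ℕ → Sym → ℕ} {T : List ℕ}

theorem Sym.Parsed.length_slots_le {S : Sym} (hS : S.Parsed π T) {A : Sym}
    (hA : A ∈ S.nonterminals) : A.slots.length ≤ A.exp.length := by
  have := hS.cum_add_le hA (i := 0) (j := A.slots.length) (by omega)
  rw [zero_add, A.cum_length, A.cum_zero] at this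
  omega

/-- Galloping search. -/
theorem Stores.run_gallop [Fact p.Prime] (hc : (c : ZMod p) ≠ 0)
    (h : Stores w p c n S rk L R root sp sl ca m) (hS : S.Parsed π T) {A : Sym}
    (hA : A ∈ S.nonterminals) (hn : A.exp.length ≤ n) (hnw : n < 2 ^ w) {s rem : ℕ}
    (hs : s ≤ A.slots.length) (hr : A.cum s + rem ≤ A.exp.length) {ctr : ℕ} (x y : ZMod p)
    {l : List ℕ} (hl : Ready p ctr x.val rem y.val (sl A s) l) :
    ∃ i, s ≤ i ∧ i ≤ A.slots.length ∧ A.cum i ≤ A.cum s + rem ∧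
      (A.slots.length < i + 1 ∨ A.cum s + rem < A.cum (i + 1)) ∧
      ∃ r₅ r₇ r₈ r₉ r₁₀ r₁₁ r₁₇ r₁₈, Run w prog m (19 * Nat.log 2 rem + 62) 12 l
        67 (regs p ctr (x + y * LCG.sig p c (expand ((A.slots.take i).drop s))).val
          (A.cum s + rem - A.cum i)
          (y * (c : ZMod p) ^ (A.cum i - A.cum s)).val (sl A s) r₅ (sl A i)
          r₇ r₈ r₉ r₁₀ r₁₁ r₁₇ r₁₈) := by
  obtain ⟨r₅, r₆, r₇, r₈, r₉, r₁₀, r₁₁, r₁₇, r₁₈, rfl⟩ := hl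
  have hsn := (hS.length_slots_le hA).trans hn
  have run1 := h.run_gallop_start hA hs (ctr := ctr) (acc := x.val) (pw := y.val) (r₅ := r₅)
    (r₆ := r₆) (r₇ := r₇) (r₈ := r₈) (r₉ := r₉) (r₁₀ := r₁₀) (r₁₁ := r₁₁) (r₁₇ := r₁₇)
    (r₁₈ := r₁₈) (hr.trans hn)
  obtain ⟨k, -, hk, hk1, hk2, hk3, r₉', r₁₀', run2⟩ := h.run_double hS hA hsn (s := s)
    (rem := rem) (ctr := ctr) (acc := x.val) (pw := y.val) (r₁₁ := r₁₁) (r₁₇ := r₁₇)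
    (r₁₈ := r₁₈) A.slots.length 0 r₉ r₁₀ (by omega) (by omega) (by simp)
  have h2k : 0 < 2 ^ k := by positivity
  obtain ⟨i, hi, hsi, hic, hin, r₉'', r₁₀'', run3⟩ := h.run_halve hA hsn (s := s)
    (tgt := A.cum s + rem) (ctr := ctr) (acc := x.val) (rem := rem) (pw := y.val) (r₁₁ := r₁₁)
    (r₁₇ := r₁₇) (r₁₈ := r₁₈) k (s + 2 ^ k - 1) r₉' r₁₀' (by omega) (by omega) hk2 (by omega) hk3
  obtain ⟨r₁₀''', r₁₁', run4⟩ := h.run_skip hc hA hn hnw hs hi hsi hr hic (ctr := ctr)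
    (r₇ := 32) (r₈ := sl A A.slots.length) (r₉ := r₉'') (r₁₀ := r₁₀'') (r₁₁ := r₁₁)
    (r₁₇ := r₁₇) (r₁₈ := r₁₈) x y
  -- The rounding for `2 ^ k ≤ rem + 1` costs one more doubling; it also covers `rem = 0`, where
  -- `Nat.log` is 0.
  have hlog : k ≤ Nat.log 2 rem + 1 := by
    rcases k with _ | k
    · omega
    · have : 2 ^ k ≤ rem := by rw [pow_succ] at hk; omega
      have h0 : rem ≠ 0 := by
        have : 0 < 2 ^ k := by positivity
        omega
      have := Nat.le_log_of_pow_le (by norm_num) this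
      omega
  rw [pow_zero, mul_one, Nat.add_sub_cancel] at run2
  have run := ((run1.trans run2).trans run3).trans run4
  exact ⟨i, hsi, hi, hic, hin, _, _, _, _, _, _, _, _, run.mono (by omega)⟩

theorem Climb.mem_nonterminals {S : Sym} {v w : Sym} {us : List Sym}
    (h : Climb v us w) (hw : w ∈ S.symbols) :
    v ∈ S.symbols ∧ ∀ u ∈ us, u ∈ S.nonterminals := by
  induction h with
  | nil => simpa using hw
  | cons hu h ih =>
    obtain ⟨h1, h2⟩ := ih hw
    have := mem_nonterminals_of_mem_symbols h1 hu
    exact ⟨first_mem_symbols this hu, by simpa using ⟨this, h2⟩⟩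

/-- The lowest field of the code is the rank of `u` among the nonterminals whose rule starts with
`u.first`. It is the index into the array at `u.first`; afterwards both words are shifted by one
field, which leaves the code of the rest of the path. -/
theorem Stores.run_climb_step (h : Stores w p c n S rk L R root sp sl ca m) {u : Sym}
    (hu : u ∈ S.nonterminals) (hu' : u.first ∈ S.symbols) (us : List Sym)
    (hb : 2 ^ codeBits ((u :: us).map rk) < 2 ^ w)
    {ctr acc rem pw cur r₇ r₈ r₁₀ r₁₁ r₁₇ r₁₈ : ℕ} :
    ∃ r₇' r₈', Run w prog m 17
      82 (regs p ctr acc rem pw cur (codeFields ((u :: us).map rk))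
        (codeMarks ((u :: us).map rk)) r₇ r₈ (sp u.first) r₁₀ r₁₁ r₁₇ r₁₈)
      99 (regs p ctr acc rem pw cur (codeFields (us.map rk)) (codeMarks (us.map rk))
        r₇' r₈' (sp u) u.exp.length r₁₁ r₁₇ r₁₈) := by
  rw [List.map_cons] at hb ⊢
  have s1 := h.sp_lt u (mem_symbols_of_mem_nonterminals hu)
  have s2 := h.sp_lt _ hu'
  have a1 := h.array _ hu'
  have a2 := h.entry u hu
  have a3 := h.len u (mem_symbols_of_mem_nonterminals hu)
  have a4 := h.ca_lt u hu
  have c1 := codeMarks_xor (rk u) (us.map rk)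
  have c2 := codeMarks_pos (rk u) (us.map rk)
  have c3 := (codeMarks_lt (rk u :: us.map rk)).trans hb
  have c4 := codeFields_mod (rk u) (us.map rk)
  have c5 := codeFields_div (rk u) (us.map rk)
  have c6 := codeMarks_div (rk u) (us.map rk)
  have c7 : 2 ^ (Nat.log 2 (rk u + 1) + 1) < 2 ^ w :=
    (Nat.pow_le_pow_right (by norm_num) (by simp [codeBits])).trans_lt hb
  refine ⟨_, _, Run.code_eq codeClimb rfl rfl ?_ (l' := regs p ctr _ _ _ _ _ _
    (2 ^ (Nat.log 2 (rk u + 1) + 1)) (rk u * 32) _ _ _ _ _) ?_ rfl rfl⟩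
  · simp [FitsAll, Instr.Fits, Instr.effect, c1, c4, a1, a2]
    omega
  · simp [Instr.effect, c1, c4, c5, c6, a1, a2, a3]

/-- The climb stops at the first `u` longer than `rem`. Its cost is the rise in height up to
`u.first`, not to `u`: the expansion of `u.first` has at most `rem` letters, which makes this height
logarithmic in `rem`. -/
theorem Stores.run_climb (h : Stores w p c n S rk L R root sp sl ca m)
    {v A : Sym} {us : List Sym} (hcl : Climb v us A) (hA : A ∈ S.symbols)
    {ctr acc rem pw cur r₁₁ r₁₇ r₁₈ : ℕ} (hv : v.exp.length ≤ rem) (hr : rem < A.exp.length)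
    (hb : 2 ^ codeBits (us.map rk) < 2 ^ w) :
    ∃ u us', u ∈ S.nonterminals ∧ Climb u us' A ∧ u.first.exp.length ≤ rem ∧
      rem < u.exp.length ∧ v.height ≤ u.first.height ∧
      ∀ r₇ r₈ r₁₀, ∃ l', Ready p ctr acc rem pw (sl u 0) l' ∧
        Run w prog m (19 * (u.first.height - v.height) + 22)
        82 (regs p ctr acc rem pw cur (codeFields (us.map rk)) (codeMarks (us.map rk))
          r₇ r₈ (sp v) r₁₀ r₁₁ r₁₇ r₁₈) 12 l' := by
  induction hcl with
  | nil => omega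
  | @cons u A us hu hcl ih =>
    obtain ⟨h1, h2⟩ := Climb.mem_nonterminals (.cons hu hcl) hA
    have huN : u ∈ S.nonterminals := h2 u (by simp)
    have hb' : 2 ^ codeBits (us.map rk) < 2 ^ w := by
      refine lt_of_le_of_lt (Nat.pow_le_pow_right (by norm_num) ?_) hb
      simp [codeBits]
    by_cases hlt : rem < u.exp.length
    · refine ⟨u, us, huN, hcl, hv, hlt, le_rfl, fun r₇ r₈ r₁₀ => ?_⟩
      obtain ⟨r₇', r₈', run1⟩ := h.run_climb_step huN h1 us hb (ctr := ctr) (acc := acc)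
        (rem := rem) (pw := pw) (cur := cur) (r₇ := r₇) (r₈ := r₈) (r₁₀ := r₁₀) (r₁₁ := r₁₁)
        (r₁₇ := r₁₇) (r₁₈ := r₁₈)
      have s1 := h.sp_lt u (mem_symbols_of_mem_nonterminals huN)
      have s2 := h.slot u huN
      refine ⟨_, ⟨codeFields (us.map rk), codeMarks (us.map rk), r₇', r₈', sp u, u.exp.length,
        r₁₁, r₁₇, r₁₈, rfl⟩, ?_⟩
      refine (run1.trans (n' := 5) (Run.mono (Run.trans (n' := 1) (Run.trans (Run.jlt rfl hlt)
        (Run.code_eq (n := 3) (pc' := 104) (ldField 4 9 3) rfl rfl ?_ ?_ rfl rfl))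
        (Run.jeq rfl rfl)) (le_refl 5))).mono (by omega)
      · simp [FitsAll, Instr.Fits, Instr.effect]
        omega
      · simp [Instr.effect, s2]
    · obtain ⟨u', us', h1', h2', h3', h4', h5', hrun⟩ := ih hA (by omega) hr hb'
      have hh := height_lt_of_mem (first_mem hu)
      refine ⟨u', us', h1', h2', h3', h4', by omega, fun r₇ r₈ r₁₀ => ?_⟩
      obtain ⟨r₇', r₈', run1⟩ := h.run_climb_step huN h1 us hb (ctr := ctr) (acc := acc)
        (rem := rem) (pw := pw) (cur := cur) (r₇ := r₇) (r₈ := r₈) (r₁₀ := r₁₀) (r₁₁ := r₁₁)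
        (r₁₇ := r₁₇) (r₁₈ := r₁₈)
      obtain ⟨l', hl', run2⟩ := hrun r₇' r₈' u.exp.length
      refine ⟨l', hl', ?_⟩
      have run3 := run1.trans (Run.not_jlt rfl hlt)
      have run4 := (run3.trans (Run.jeq rfl rfl)).trans run2
      exact run4.mono (by omega)

/-- The search on the leftmost path of a symbol. -/
theorem Stores.run_spine (h : Stores w p c n S rk L R root sp sl ca m) (hS : S.Parsed π T)
    {A : Sym} (hA : A ∈ S.symbols) {ctr acc rem pw : ℕ} (h1 : 1 ≤ rem) (hr : rem < A.exp.length)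
    {l : List ℕ} (hl : Ready p ctr acc rem pw (sp A) l) :
    ∃ u us, u ∈ S.nonterminals ∧ Climb u us A ∧ u.first.exp.length ≤ rem ∧
      rem < u.exp.length ∧ ∃ l', Ready p ctr acc rem pw (sl u 0) l' ∧
        Run w prog m (19 * u.first.height + 31) 73 l 12 l' := by
  obtain ⟨r₅, r₆, r₇, r₈, r₉, r₁₀, r₁₁, r₁₇, r₁₈, rfl⟩ := hl
  have hp := hS.symbols A hA
  obtain ⟨u, us, h1', h2', h3', h4', h5', hrun⟩ := h.run_climb hp.climb hA (ctr := ctr)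
    (acc := acc) (pw := pw) (cur := sp A) (r₁₁ := r₁₁) (r₁₇ := r₁₇) (r₁₈ := r₁₈)
    (by rw [hp.length_leaf]; exact h1) hr (h.code_lt A hA)
  obtain ⟨l', hl', run⟩ := hrun r₇ r₈ r₁₀
  refine ⟨u, us, h1', h2', h3', h4', l', hl', ?_⟩
  have s1 := h.sp_lt A hA
  have s2 := h.fields A hA
  have s3 := h.marks A hA
  have s4 := h.leaf A hA
  refine Run.mono (Run.trans (n := 9) (Run.code_eq (pc' := 82) codeSpine rfl rfl ?_ ?_ rfl rfl) run)
    (by omega)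
  · simp [FitsAll, Instr.Fits, Instr.effect]
    omega
  · simp [Instr.effect, s2, s3, s4]

/-- The search among the slots of a symbol. -/
theorem Stores.run_search (h : Stores w p c n S rk L R root sp sl ca m) {A : Sym}
    (hA : A ∈ S.nonterminals) {i : ℕ} (hi : i < A.slots.length) {rem : ℕ}
    (hir : A.cum i ≤ rem) (hri : rem < A.cum (i + 1))
    {ctr acc pw cur r₉ r₁₀ r₁₁ r₁₇ r₁₈ : ℕ} {d x : ℕ}
    (hp : SearchPath 0 A.slots.length (L A) (R A) i d x) :
    ∀ r₆ r₇ r₈, ∃ r₇' r₈', Run w prog m (14 * d + 9)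
      112 (regs p ctr acc rem pw cur (sl A x) r₆ r₇ r₈ r₉ r₁₀ r₁₁ r₁₇ r₁₈)
      131 (regs p ctr acc rem pw cur (sl A i) (A.cum i) r₇' r₈' r₉ r₁₀ r₁₁ r₁₇ r₁₈) := by
  have r1 : ∀ x ≤ A.slots.length, ∀ r₆ r₇ r₈, Run w prog m 3
      112 (regs p ctr acc rem pw cur (sl A x) r₆ r₇ r₈ r₉ r₁₀ r₁₁ r₁₇ r₁₈)
      115 (regs p ctr acc rem pw cur (sl A x) (A.cum x) r₇ r₈ r₉ r₁₀ r₁₁ r₁₇ r₁₈) := by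
    intro x hx r₆ r₇ r₈
    have l1 := h.sl_lt A hA x hx
    have c1 := h.cum A hA x hx
    refine Run.code_eq (ldField 6 5 11) rfl rfl ?_ ?_ rfl rfl
    · simp [FitsAll, Instr.Fits, Instr.effect]
      omega
    · simp [Instr.effect, c1]
  have r2 : ∀ x < A.slots.length, A.cum x ≤ rem → ∀ r₇ r₈, Run w prog m 5
      115 (regs p ctr acc rem pw cur (sl A x) (A.cum x) r₇ r₈ r₉ r₁₀ r₁₁ r₁₇ r₁₈)
      120 (regs p ctr acc rem pw cur (sl A x) (A.cum x) (sl A (x + 1)) (A.cum (x + 1))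
        r₉ r₁₀ r₁₁ r₁₇ r₁₈) := by
    intro x hx hxr r₇ r₈
    have l1 := h.sl_lt A hA x hx.le
    have l2 := h.sl_lt A hA (x + 1) hx
    have c1 := h.cum A hA (x + 1) hx
    have a1 := h.sl_add A x
    have a2 := h.sl_add A (x + 1)
    have e : sl A x + 32 = sl A (x + 1) := by omega
    refine Run.mono (Run.trans (n' := 4) (Run.not_jlt rfl (Nat.not_lt.2 hxr))
      (Run.code_eq ([.op .add 7 5 12] ++ ldField 8 7 11) rfl rfl ?_ ?_ rfl rfl)) (le_refl 5)
    · simp [FitsAll, Instr.Fits, Instr.effect, e]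
      omega
    · simp [Instr.effect, e, c1]
  induction hp with
  | here =>
    intro r₆ r₇ r₈
    exact ⟨_, _, (((r1 i hi.le r₆ r₇ r₈).trans (r2 i hi hir _ _)).trans
      (Run.jlt rfl hri)).mono (by omega)⟩
  | @left d x _ hb hix _ ih =>
    intro r₆ r₇ r₈
    have hmono := A.cum_monotone (show i + 1 ≤ x from hix)
    obtain ⟨r₇', r₈', run⟩ := ih (A.cum x) (sl A (L A x)) r₈
    refine ⟨r₇', r₈', ?_⟩
    have l1 := h.sl_lt A hA x hb.le
    have c1 := h.left A hA x hb
    have c2 := h.sl_lt A hA _ ((h.tree_lt A hA).2 x hb).1.le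
    have run2 : Run w prog m 6
        115 (regs p ctr acc rem pw cur (sl A x) (A.cum x) r₇ r₈ r₉ r₁₀ r₁₁ r₁₇ r₁₈)
        112 (regs p ctr acc rem pw cur (sl A (L A x)) (A.cum x) (sl A (L A x)) r₈
          r₉ r₁₀ r₁₁ r₁₇ r₁₈) := by
      refine Run.mono (Run.trans (n' := 1) (Run.trans (Run.jlt rfl (show rem < A.cum x by omega))
        (Run.code_eq (n := 4) (pc' := 130) (ldField 7 5 16 ++ [.op .add 5 7 13]) rfl rfl ?_ ?_ rfl
          rfl)) (Run.jeq rfl rfl)) (le_refl 6)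
      · simp [FitsAll, Instr.Fits, Instr.effect, c1]
        omega
      · simp [Instr.effect, c1]
    exact (((r1 x hb.le r₆ r₇ r₈).trans run2).trans run).mono (by omega)
  | @right d x _ hb hix _ ih =>
    intro r₆ r₇ r₈
    have hmono := A.cum_monotone (show x + 1 ≤ i from hix)
    have hmono' := A.cum_monotone (show x ≤ i from hix.le)
    obtain ⟨r₇', r₈', run⟩ := ih (A.cum x) (sl A (R A x)) (A.cum (x + 1))
    refine ⟨r₇', r₈', ?_⟩
    have l1 := h.sl_lt A hA x hb.le
    have c1 := h.right A hA x hb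
    have c2 := h.sl_lt A hA _ ((h.tree_lt A hA).2 x hb).2.le
    have run2 : Run w prog m 6
        120 (regs p ctr acc rem pw cur (sl A x) (A.cum x) (sl A (x + 1)) (A.cum (x + 1))
          r₉ r₁₀ r₁₁ r₁₇ r₁₈)
        112 (regs p ctr acc rem pw cur (sl A (R A x)) (A.cum x) (sl A (R A x)) (A.cum (x + 1))
          r₉ r₁₀ r₁₁ r₁₇ r₁₈) := by
      refine Run.mono (Run.trans (n' := 1) (Run.trans
        (Run.not_jlt rfl (show ¬ rem < A.cum (x + 1) by omega))
        (Run.code_eq (n := 4) (pc' := 125) (ldField 7 5 17 ++ [.op .add 5 7 13]) rfl rfl ?_ ?_ rfl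
          rfl)) (Run.jeq rfl rfl)) (le_refl 6)
      · simp [FitsAll, Instr.Fits, Instr.effect, c1]
        omega
      · simp [Instr.effect, c1]
    exact ((((r1 x hb.le r₆ r₇ r₈).trans (r2 x hb (by omega) _ _)).trans run2).trans run).mono
      (by omega)

end

/-! ### Descent into a symbol -/

theorem take_expand_drop (X : List Sym) {s i r : ℕ} (hsi : s ≤ i) (hi : i ≤ X.length)
    (hr : (expand (X.take i)).length ≤ (expand (X.take s)).length + r) :
    (expand (X.drop s)).take r = expand ((X.take i).drop s) ++
      (expand (X.drop i)).take
        ((expand (X.take s)).length + r - (expand (X.take i)).length) := by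
  have h1 : X.drop s = (X.take i).drop s ++ X.drop i := by
    conv_lhs => rw [← List.take_append_drop i X]
    rw [List.drop_append_of_le_length (by simp; omega)]
  have h2 : (expand (X.take i)).length =
      (expand (X.take s)).length + (expand ((X.take i).drop s)).length := by
    conv_lhs => rw [← List.take_append_drop s (X.take i)]
    rw [List.take_take, min_eq_left hsi, expand_append, List.length_append]
  rw [h1, expand_append, List.take_append, List.take_of_length_le (by omega)]
  congr 2
  omega

theorem take_flatten_replicate {z : List ℕ} {t r : ℕ} (hr : r < t * z.length) :
    (List.replicate t z).flatten.take r =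
      (List.replicate (r / z.length) z).flatten ++ z.take (r % z.length) := by
  have hz : 0 < z.length := Nat.pos_of_ne_zero fun h => by simp [h] at hr
  have hq : r / z.length < t := (Nat.div_lt_iff_lt_mul hz).2 hr
  obtain ⟨k, rfl⟩ := Nat.exists_eq_add_of_lt hq
  have h1 : (List.replicate (r / z.length) z).flatten.length = z.length * (r / z.length) := by
    simp [mul_comm]
  have h2 := Nat.div_add_mod r z.length
  have h3 := Nat.mod_lt r hz
  rw [add_assoc, List.replicate_add, List.flatten_append, List.take_append,
    List.take_of_length_le (by omega), List.replicate_succ, List.flatten_cons]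
  congr 1
  rw [List.take_append_of_le_length (by omega)]
  congr 1
  omega

theorem flatten_replicate_two_mul (q : ℕ) (z : List ℕ) :
    (List.replicate (2 * q) z).flatten = (List.replicate q (z ++ z)).flatten := by
  induction q with
  | zero => rfl
  | succ q ih =>
    rw [show 2 * (q + 1) = 2 * q + 1 + 1 by ring]
    simp [List.replicate_succ, ih]

theorem log_add_log_le {a b c : ℕ} (ha : a ≠ 0) (hb : b ≠ 0) (h : a * b ≤ c) :
    Nat.log 2 a + Nat.log 2 b ≤ Nat.log 2 c := by
  have h1 := Nat.pow_log_le_self 2 ha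
  have h2 := Nat.pow_log_le_self 2 hb
  refine Nat.le_log_of_pow_le (by norm_num) ?_
  rw [pow_add]
  exact (Nat.mul_le_mul h1 h2).trans h

section

variable {w p c n : ℕ} {S : Sym} {rk : Sym → ℕ} {L R : Sym → ℕ → ℕ} {root : Sym → ℕ}
  {sp : Sym → ℕ} {sl : Sym → ℕ → ℕ} {ca : Sym → ℕ} {m : ℕ → ℕ}
  {π : ℕ → Sym → ℕ} {T : List ℕ}

theorem append_mod {p : ℕ} [Fact p.Prime] (x y z : ZMod p) :
    (x.val + y.val * z.val) % p = (x + y * z).val :=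
  mod_eq_val (by simp)

theorem mul_mod_val {p : ℕ} [Fact p.Prime] (x y : ZMod p) :
    x.val * y.val % p = (x * y).val :=
  mod_eq_val (by simp)

/-- Appending a power of a string. -/
theorem run_power [Fact p.Prime] (hp : 4 * (p * p) < 2 ^ w) (m : ℕ → ℕ) {ctr rem cur : ℕ}
    (q : ℕ) : ∀ (z : List ℕ) (x y : ZMod p) (r₆ r₇ r₈ r₉ r₁₀ r₁₁ : ℕ),
    ∃ l', Ready p ctr (x + y * LCG.sig p c (List.replicate q z).flatten).val rem
      (y * (c : ZMod p) ^ (List.replicate q z).flatten.length).val cur l' ∧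
    Run w prog m (15 * Nat.log 2 (2 * q) + 1)
      163 (regs p ctr x.val rem y.val cur q r₆ r₇ r₈ r₉ r₁₀ r₁₁ (LCG.sig p c z).val
        ((c : ZMod p) ^ z.length).val) 178 l' := by
  have hp2 : 2 ≤ p := (Fact.out : p.Prime).two_le
  have hple : p ≤ p * p := Nat.le_mul_of_pos_left p (by omega)
  induction q using Nat.strong_induction_on with
  | _ q ih =>
  intro z x y r₆ r₇ r₈ r₉ r₁₀ r₁₁
  rcases Nat.eq_zero_or_pos q with rfl | hq
  · refine ⟨_, ⟨0, r₆, r₇, r₈, r₉, r₁₀, r₁₁, (LCG.sig p c z).val,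
      ((c : ZMod p) ^ z.length).val, rfl⟩, ?_⟩
    simp only [List.replicate_zero, List.flatten_nil, LCG.sig, mul_zero, add_zero,
      List.length_nil, pow_zero, mul_one]
    exact Run.mono (Run.jeq rfl rfl) (by omega)
  -- The factor 2 makes the logarithm drop by one in the last round too, from `q = 1` to `q = 0`.
  have hlog : Nat.log 2 (2 * (q / 2)) + 1 ≤ Nat.log 2 (2 * q) := by
    rw [Nat.log_of_one_lt_of_le (b := 2) (n := 2 * q) (by norm_num) (by omega)]
    exact Nat.succ_le_succ (Nat.log_mono_right (by omega))
  set σ := LCG.sig p c z with hσ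
  set τ := (c : ZMod p) ^ z.length with hτ
  have vx := ZMod.val_lt x
  have vy := ZMod.val_lt y
  have vσ := ZMod.val_lt σ
  have vτ := ZMod.val_lt τ
  have b1 : y.val * σ.val ≤ p * p := Nat.mul_le_mul vy.le vσ.le
  have b2 : y.val * τ.val ≤ p * p := Nat.mul_le_mul vy.le vτ.le
  have b3 : τ.val * σ.val ≤ p * p := Nat.mul_le_mul vτ.le vσ.le
  have b4 : τ.val * τ.val ≤ p * p := Nat.mul_le_mul vτ.le vτ.le
  have start : Run w prog m 3
      163 (regs p ctr x.val rem y.val cur q r₆ r₇ r₈ r₉ r₁₀ r₁₁ σ.val τ.val)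
      166 (regs p ctr x.val rem y.val cur (q / 2) (q % 2) r₇ r₈ r₉ r₁₀ r₁₁ σ.val τ.val) := by
    refine Run.mono (Run.trans (n' := 2) (Run.not_jeq rfl (by simp; omega))
      (Run.code_eq [.op .mod 6 5 16, .op .div 5 5 16] rfl rfl ?_ ?_ rfl rfl)) (le_refl 3)
    · simp [FitsAll, Instr.Fits]
    · simp [Instr.effect]
  have square : ∀ (x y : ZMod p) (r₆ r₇ : ℕ), ∃ r₇', Run w prog m 6
      172 (regs p ctr x.val rem y.val cur (q / 2) r₆ r₇ r₈ r₉ r₁₀ r₁₁ σ.val τ.val)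
      163 (regs p ctr x.val rem y.val cur (q / 2) r₆ r₇' r₈ r₉ r₁₀ r₁₁
        (LCG.sig p c (z ++ z)).val ((c : ZMod p) ^ (z ++ z).length).val) := by
    intro x y r₆ r₇
    have e1 : (LCG.sig p c (z ++ z)).val = (σ.val + τ.val * σ.val) % p := by
      rw [append_mod, sig_append]
    have e2 : ((c : ZMod p) ^ (z ++ z).length).val = τ.val * τ.val % p := by
      rw [mul_mod_val, List.length_append, pow_add]
    rw [e1, e2]
    refine ⟨_, Run.mono (Run.trans (n := 5) (Run.code_eq (pc' := 177) codeSquare rfl rfl ?_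
      (l' := regs p ctr _ _ _ _ _ _ (τ.val * σ.val) _ _ _ _ _ _) ?_ rfl rfl)
      (Run.jeq rfl rfl)) (le_refl 6)⟩
    · simp [FitsAll, Instr.Fits, Instr.effect]
      omega
    · simp [Instr.effect]
  have append : ∀ r₆ r₇, ∃ r₇', Run w prog m 5
      167 (regs p ctr x.val rem y.val cur (q / 2) r₆ r₇ r₈ r₉ r₁₀ r₁₁ σ.val τ.val)
      172 (regs p ctr (x + y * σ).val rem (y * τ).val cur (q / 2) r₆ r₇' r₈ r₉ r₁₀ r₁₁
        σ.val τ.val) := by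
    intro r₆ r₇
    rw [← append_mod, ← mul_mod_val]
    refine ⟨_, Run.code_eq codeAppend rfl rfl ?_
      (l' := regs p ctr _ _ _ _ _ _ (y.val * σ.val) _ _ _ _ _ _) ?_ rfl rfl⟩
    · simp [FitsAll, Instr.Fits, Instr.effect]
      omega
    · simp [Instr.effect]
  -- Bits of `q` are used from the lowest on. All copies of `z` are equal, so an odd copy may be
  -- appended first, before `z` is doubled.
  rcases Nat.mod_two_eq_zero_or_one q with h2 | h2
  · obtain ⟨r₇', run2⟩ := square x y (q % 2) r₇
    obtain ⟨l', hl', run3⟩ := ih (q / 2) (by omega) (z ++ z) x y (q % 2) r₇' r₈ r₉ r₁₀ r₁₁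
    refine ⟨l', ?_, ((start.trans (Run.jeq rfl h2)).trans (run2.trans run3)).mono ?_⟩
    · rwa [← flatten_replicate_two_mul, show 2 * (q / 2) = q by omega] at hl'
    · omega
  · obtain ⟨r₇', run1⟩ := append (q % 2) r₇
    obtain ⟨r₇'', run2⟩ := square (x + y * σ) (y * τ) (q % 2) r₇'
    obtain ⟨l', hl', run3⟩ := ih (q / 2) (by omega) (z ++ z) (x + y * σ) (y * τ) (q % 2) r₇''
      r₈ r₉ r₁₀ r₁₁
    refine ⟨l', ?_, (((start.trans (Run.not_jeq rfl (by simp; omega))).trans run1).trans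
      (run2.trans run3)).mono ?_⟩
    · rw [← flatten_replicate_two_mul] at hl'
      have hq' : List.replicate q z = z :: List.replicate (2 * (q / 2)) z := by
        rw [← List.replicate_succ]
        congr 1
        omega
      rw [hq', List.flatten_cons, sig_append, List.length_append, pow_add, mul_add, ← mul_assoc,
        ← add_assoc, ← mul_assoc]
      exact hl'
    · omega

/-- The step to a slot that has been found in the search tree. -/
theorem Stores.run_found [Fact p.Prime] (h : Stores w p c n S rk L R root sp sl ca m) {A : Sym}
    (hA : A ∈ S.nonterminals) (hn : A.exp.length ≤ n) (hnw : n < 2 ^ w) {i : ℕ}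
    (hi : i < A.slots.length) {rem : ℕ} (hir : A.cum i ≤ rem) (hr : rem ≤ A.exp.length)
    {ctr cur r₇ r₈ r₉ r₁₀ r₁₁ r₁₇ r₁₈ : ℕ} (x y : ZMod p) :
    ∃ l', Ready p ctr (x + y * LCG.sig p c (expand (A.slots.take i))).val (rem - A.cum i)
      (y * (c : ZMod p) ^ A.cum i).val (sp A.slots[i]) l' ∧
    Run w prog m 15
      131 (regs p ctr x.val rem y.val cur (sl A i) (A.cum i) r₇ r₈ r₉ r₁₀ r₁₁ r₁₇ r₁₈) 146 l' := by
  have l1 := h.sl_lt A hA i hi.le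
  have c1 := h.prefixSig A hA i hi.le
  have c2 := h.prefixPow A hA i hi.le
  have c3 := h.sym A hA i hi
  have hpp := h.mod_lt
  set σ := LCG.sig p c (expand (A.slots.take i))
  set τ := (c : ZMod p) ^ A.cum i
  have v1 := ZMod.val_lt x
  have v2 := ZMod.val_lt y
  have v3 := ZMod.val_lt σ
  have v4 := ZMod.val_lt τ
  have hp2 : 2 ≤ p := (Fact.out : p.Prime).two_le
  have hple : p ≤ p * p := Nat.le_mul_of_pos_left p (by omega)
  have b1 : y.val * σ.val ≤ p * p := Nat.mul_le_mul v2.le v3.le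
  have b2 : y.val * τ.val ≤ p * p := Nat.mul_le_mul v2.le v4.le
  rw [← append_mod, ← mul_mod_val]
  refine ⟨_, ⟨sl A i, A.cum i, τ.val, r₈, r₉, r₁₀, r₁₁, r₁₇, r₁₈, rfl⟩,
    Run.code_eq codeFound rfl rfl ?_ ?_ rfl rfl⟩
  · simp [FitsAll, Instr.Fits, Instr.effect, c1, c2, mul_comm σ.val]
    refine ⟨?_, ?_, ?_, ?_, ?_, ?_⟩
    all_goals omega
  · simp [Instr.effect, c1, c2, c3, mul_comm σ.val]

/-- Division gives the number of whole copies of the base, which `run_power` appends; the remainder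
is a proper prefix of the base, handled by `hB`. Keeping `hB` as a hypothesis allows the use both
inside the induction and for a long run with a short base. -/
theorem Stores.stops_run [Fact p.Prime] (h : Stores w p c n S rk L R root sp sl ca m)
    {B : Sym} {t : ℕ} (hA : .run B t ∈ S.nonterminals) {ctr : ℕ} {N : ℕ}
    (hB : ∀ (rem : ℕ) (x y : ZMod p) (l : List ℕ), 1 ≤ rem → rem < B.exp.length →
      Ready p ctr x.val rem y.val (sp B) l →
      Stops w m N 105 l (x + y * LCG.sig p c (B.exp.take rem)).val)
    {rem : ℕ} (x y : ZMod p) {l : List ℕ} (hr : rem < (Sym.run B t).exp.length)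
    (hl : Ready p ctr x.val rem y.val (sp (.run B t)) l) :
    Stops w m (15 * Nat.log 2 (rem / B.exp.length) + 37 + N) 105 l
      (x + y * LCG.sig p c ((Sym.run B t).exp.take rem)).val := by
  obtain ⟨r₅, r₆, r₇, r₈, r₉, r₁₀, r₁₁, r₁₇, r₁₈, rfl⟩ := hl
  have hAs := mem_symbols_of_mem_nonterminals hA
  rw [Sym.exp] at hr ⊢
  have hr' : rem < t * B.exp.length := by simpa using hr
  have hz : 0 < B.exp.length := Nat.pos_of_ne_zero fun h => by simp [h] at hr'
  have ht : t ≠ 0 := by rintro rfl; simp at hr'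
  have hBs : B ∈ S.symbols := mem_symbols_of_mem_children hA (by
    simp [Sym.children, ht])
  have s1 := h.sp_lt _ hAs
  have s2 := h.sp_lt _ hBs
  have c1 := h.isRun B t hAs
  have c2 := h.base B t hAs
  have c3 := h.len B hBs
  have c4 := h.sig B hBs
  have c5 := h.pow B hBs
  obtain ⟨l', hl', run2⟩ := run_power (c := c) h.mod_lt m (ctr := ctr) (rem := rem % B.exp.length)
    (cur := sp B) (rem / B.exp.length) B.exp x y B.exp.length r₇ r₈ r₉ 1 r₁₁
  have run1 : Run w prog m 19
      105 (regs p ctr x.val rem y.val (sp (.run B t)) r₅ r₆ r₇ r₈ r₉ r₁₀ r₁₁ r₁₇ r₁₈)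
      163 (regs p ctr x.val (rem % B.exp.length) y.val (sp B) (rem / B.exp.length) B.exp.length
        r₇ r₈ r₉ 1 r₁₁ (LCG.sig p c B.exp).val ((c : ZMod p) ^ B.exp.length).val) := by
    refine Run.mono (Run.trans (n' := 15) (Run.trans (n' := 1)
      (Run.code_eq (n := 3) (pc' := 108) (ldField 10 4 1) rfl rfl ?_
        (l' := regs p ctr x.val rem y.val (sp (.run B t)) r₅ r₆ r₇ r₈ r₉ 1 r₁₁ r₁₇ r₁₈) ?_ rfl rfl)
      (Run.jeq rfl rfl))
      (Run.code_eq (n := 15) codeRun rfl rfl ?_ ?_ rfl rfl)) (le_refl 19)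
    · simp [FitsAll, Instr.Fits, Instr.effect]
      exact ⟨by rintro rfl; rw [pow_zero] at s1; omega, by omega⟩
    · simp [Instr.effect, c1]
    · simp [FitsAll, Instr.Fits, Instr.effect, c2]
      omega
    · simp [Instr.effect, c2, c3, c4, c5]
  have hlog : Nat.log 2 (2 * (rem / B.exp.length)) ≤ Nat.log 2 (rem / B.exp.length) + 1 := by
    rcases Nat.eq_zero_or_pos (rem / B.exp.length) with h0 | h0
    · simp [h0]
    · rw [mul_comm, Nat.log_mul_base (by norm_num) h0.ne']
  have hsplit := take_flatten_replicate hr'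
  have hval : ∀ r : ZMod p, r = LCG.sig p c (B.exp.take (rem % B.exp.length)) →
      x + y * LCG.sig p c (List.replicate (rem / B.exp.length) B.exp).flatten +
        y * (c : ZMod p) ^ (List.replicate (rem / B.exp.length) B.exp).flatten.length * r =
      x + y * LCG.sig p c ((List.replicate t B.exp).flatten.take rem) := by
    rintro _ rfl
    rw [hsplit, sig_append]
    ring
  rcases Nat.eq_zero_or_pos (rem % B.exp.length) with h0 | h0
  · have hv := hval 0 (by rw [h0]; rfl)
    rw [mul_zero, add_zero] at hv
    rw [h0] at run1 run2 hl'
    obtain ⟨r₅, r₆, r₇, r₈, r₉, r₁₀, r₁₁, r₁₇, r₁₈, rfl⟩ := hl'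
    refine ⟨_, ?_, ((run1.trans run2).trans (Run.jeq rfl rfl)).mono (by omega)⟩
    exact congrArg ZMod.val hv
  · have hv := hval _ rfl
    have hst := hB (rem % B.exp.length) _ _ _ h0 (Nat.mod_lt _ hz) hl'
    rw [hv] at hst
    obtain ⟨r₅, r₆, r₇, r₈, r₉, r₁₀, r₁₁, r₁₇, r₁₈, rfl⟩ := hl'
    exact hst.of_run (((run1.trans run2).trans (Run.not_jeq rfl h0.ne')).trans (Run.jeq rfl rfl))
      (by omega)

/-- The descent into a symbol. -/
theorem Stores.stops_direct [Fact p.Prime] (h : Stores w p c n S rk L R root sp sl ca m)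
    (hS : S.Parsed π T) (hn : T.length ≤ n) (hnw : n < 2 ^ w) {ctr : ℕ} (A : Sym) :
    A ∈ S.symbols → ∀ (rem : ℕ) (x y : ZMod p) (l : List ℕ), 1 ≤ rem → rem < A.exp.length →
      Ready p ctr x.val rem y.val (sp A) l →
      Stops w m (60 * A.height + 15 * Nat.log 2 A.exp.length) 105 l
        (x + y * LCG.sig p c (A.exp.take rem)).val := by
  induction A using Sym.induction_children with
  | term a =>
    intro _ rem x y l h1 h2
    simp [Sym.exp] at h2
    omega
  | run B t ih =>
    intro hA rem x y l h1 hr hl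
    have hN := mem_nonterminals_of_mem_symbols hA ((hS.symbols _ hA).children_ne_nil (by simp))
    have hr' : rem < t * B.exp.length := by simpa [Sym.exp] using hr
    have ht : t ≠ 0 := by rintro rfl; simp at hr'
    have hz : 0 < B.exp.length := Nat.pos_of_ne_zero fun h => by simp [h] at hr'
    have hBs : B ∈ S.symbols := mem_symbols_of_mem_children hN (by simp [Sym.children, ht])
    obtain ⟨r, hr1, hr2⟩ := h.stops_run hN (fun rem x y l => ih hBs rem x y l) x y hr hl
    refine ⟨r, hr1, hr2.mono ?_⟩
    -- The logarithm of the number of copies is paid for by the decrease from the length of the run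
    -- to that of its base.
    have hlog : Nat.log 2 (rem / B.exp.length) + Nat.log 2 B.exp.length ≤
        Nat.log 2 (Sym.run B t).exp.length := by
      rcases Nat.eq_zero_or_pos (rem / B.exp.length) with h0 | h0
      · rw [h0, Nat.log_zero_right, zero_add]
        refine Nat.log_mono_right ?_
        have : B.exp.length ≤ t * B.exp.length := Nat.le_mul_of_pos_left _ (by omega)
        simpa [Sym.exp] using this
      · exact log_add_log_le h0.ne' hz.ne' ((Nat.div_mul_le_self _ _).trans hr.le)
    simp only [Sym.height]
    omega
  | block Bs ih =>
    intro hA rem x y l h1 hr hl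
    have hpar := hS.symbols _ hA
    have hch := hpar.children_ne_nil (by simp)
    have hN := mem_nonterminals_of_mem_symbols hA hch
    have hlen := hpar.length_le.trans hn
    set A := Sym.block Bs with hAdef
    obtain ⟨i, hi, hir, hri⟩ : ∃ i < A.slots.length, A.cum i ≤ rem ∧ rem < A.cum (i + 1) := by
      have hex : ∃ i, rem < A.cum i := ⟨A.slots.length, by rw [A.cum_length]; exact hr⟩
      have h0 : Nat.find hex ≠ 0 := fun h0 => by
        have := Nat.find_spec hex
        rw [h0, A.cum_zero] at this
        omega
      obtain ⟨i, hi⟩ := Nat.exists_eq_succ_of_ne_zero h0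
      have h2 := Nat.find_min hex (m := i) (by omega)
      have h3 := Nat.find_spec hex
      rw [hi] at h3
      refine ⟨i, ?_, by omega, h3⟩
      by_contra hc
      have : A.cum i = A.exp.length := by
        rw [Sym.cum, List.take_of_length_le (by omega), expand_slots]
      omega
    obtain ⟨d, hd, hpath⟩ := h.search A hN i hi
    have hsucc := Sym.cum_succ hi
    have hmem : A.slots[i] ∈ Bs := List.getElem_mem hi
    have hBs : A.slots[i] ∈ S.symbols := mem_symbols_of_mem_children hN hmem
    obtain ⟨r₅, r₆, r₇, r₈, r₉, r₁₀, r₁₁, r₁₇, r₁₈, rfl⟩ := hl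
    obtain ⟨r₇', r₈', run2⟩ := h.run_search hN hi hir hri (ctr := ctr) (acc := x.val)
      (pw := y.val) (cur := sp A) (r₉ := r₉) (r₁₀ := 0) (r₁₁ := r₁₁) (r₁₇ := r₁₇) (r₁₈ := r₁₈)
      hpath r₆ r₇ r₈
    obtain ⟨l', hl', run3⟩ := h.run_found hN hlen hnw hi hir hr.le (ctr := ctr) (cur := sp A)
      (r₇ := r₇') (r₈ := r₈') (r₉ := r₉) (r₁₀ := 0) (r₁₁ := r₁₁) (r₁₇ := r₁₇) (r₁₈ := r₁₈) x y
    have s1 := h.sp_lt A hA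
    have c1 := h.isBlock Bs hA
    have c2 := h.treeRoot A hN
    rw [← hAdef] at c1
    have run1 : Run w prog m 7
        105 (regs p ctr x.val rem y.val (sp A) r₅ r₆ r₇ r₈ r₉ r₁₀ r₁₁ r₁₇ r₁₈)
        112 (regs p ctr x.val rem y.val (sp A) (sl A (root A)) r₆ r₇ r₈ r₉ 0 r₁₁ r₁₇ r₁₈) := by
      refine Run.mono (Run.trans (n' := 3) (Run.trans (n' := 1)
        (Run.code_eq (n := 3) (pc' := 108) (ldField 10 4 1) rfl rfl ?_
          (l' := regs p ctr x.val rem y.val (sp A) r₅ r₆ r₇ r₈ r₉ 0 r₁₁ r₁₇ r₁₈) ?_ rfl rfl)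
        (Run.not_jeq rfl (by simp)))
        (Run.code_eq (n := 3) (ldField 5 4 4) rfl rfl ?_ ?_ rfl rfl)) (le_refl 7)
      · simp [FitsAll, Instr.Fits, Instr.effect]
        exact ⟨by rintro rfl; rw [pow_zero] at s1; omega, by omega⟩
      · simp [Instr.effect, c1]
      · simp [FitsAll, Instr.Fits, Instr.effect]
        omega
      · simp [Instr.effect, c2]
    -- The depth in the search tree is paid for by the decrease of the logarithm of the length, so
    -- only constant work per unit of height remains.
    have hlog : d + Nat.log 2 A.slots[i].exp.length ≤ Nat.log 2 A.exp.length := by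
      have := log_add_log_le (a := 2 ^ d) (by positivity) (b := A.slots[i].exp.length)
        (by omega) (by convert hd using 2; omega)
      rwa [Nat.log_pow (by norm_num)] at this
    have hheight := height_lt_of_mem (A := A) hmem
    have hsplit := take_expand_drop A.slots (s := 0) (i := i) (r := rem) (Nat.zero_le i) hi.le
      (by rw [← Sym.cum]; omega)
    rw [List.drop_zero, List.drop_zero, expand_slots, List.take_zero, ← Sym.cum,
      show (expand []).length = 0 from rfl, zero_add, ← List.getElem_cons_drop hi, expand_cons,
      List.take_append_of_le_length (by omega)] at hsplit
    have hval : ∀ r : ZMod p, r = LCG.sig p c (A.slots[i].exp.take (rem - A.cum i)) →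
        x + y * LCG.sig p c (expand (A.slots.take i)) + y * (c : ZMod p) ^ A.cum i * r =
        x + y * LCG.sig p c (A.exp.take rem) := by
      rintro _ rfl
      rw [hsplit, sig_append, Sym.cum]
      ring
    rcases Nat.eq_zero_or_pos (rem - A.cum i) with h0 | h0
    · have hv := hval 0 (by rw [h0]; rfl)
      rw [mul_zero, add_zero] at hv
      rw [h0] at hl'
      obtain ⟨r₅, r₆, r₇, r₈, r₉, r₁₀, r₁₁, r₁₇, r₁₈, rfl⟩ := hl'
      refine ⟨_, ?_, (((run1.trans run2).trans run3).trans (Run.jeq rfl rfl)).mono ?_⟩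
      · exact congrArg ZMod.val hv
      · omega
    · have hv := hval _ rfl
      have hst := ih _ hmem hBs (rem - A.cum i) _ _ _ h0 (by omega) hl'
      rw [hv] at hst
      obtain ⟨r₅, r₆, r₇, r₈, r₉, r₁₀, r₁₁, r₁₇, r₁₈, rfl⟩ := hl'
      exact hst.of_run ((((run1.trans run2).trans run3).trans (Run.not_jeq rfl h0.ne')).trans
        (Run.jeq rfl rfl)) (by omega)

end

/-! ### Progress of the searches -/

theorem Climb.exp_prefix {v w : Sym} {us : List Sym} (h : Climb v us w) : v.exp <+: w.exp := by
  induction h with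
  | nil => exact List.prefix_refl _
  | cons hu h ih =>
    refine List.IsPrefix.trans ?_ ih
    obtain ⟨X, hX⟩ := children_eq_first_cons hu
    rw [exp_eq_expand_children hu, hX, expand_cons]
    exact List.prefix_append _ _

/-- For a run `w` this says that any other symbol on its leftmost path lies on that of its base, so
it is short when the base is short. -/
theorem Climb.eq_or_climb_first {v w : Sym} {us : List Sym} (h : Climb v us w) :
    v = w ∨ w.children ≠ [] ∧ ∃ us', Climb v us' w.first := by
  induction h with
  | nil => exact .inl rfl
  | cons hu h ih =>
    rcases ih with rfl | ⟨hw, us', h'⟩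
    · exact .inr ⟨hu, _, .nil _⟩
    · exact .inr ⟨hw, _, .cons hu h'⟩

section

variable {π : ℕ → Sym → ℕ} {T : List ℕ}

theorem Climb.occurs {v w : Sym} {us : List Sym} (h : Climb v us w) {k x : ℕ}
    (hw : Occurs π T k x [w]) : ∃ j ≤ k, Occurs π T j x [v] := by
  induction h with
  | nil => exact ⟨k, le_rfl, hw⟩
  | cons hu h ih =>
    obtain ⟨j, hj, hu'⟩ := ih hw
    obtain ⟨i, hi, h'⟩ := hu'.first hu
    exact ⟨i, hi.le.trans hj, h'⟩

/-- There are boundaries of level `k` at `x`, at `x₀`, and at `r - 1` positions between them. -/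
def BoundaryChain (π : ℕ → Sym → ℕ) (T : List ℕ) (k x₀ : ℕ) : ℕ → ℕ → Prop
  | 0, x => Boundary π T k x ∧ x = x₀
  | r + 1, x => Boundary π T k x ∧ ∃ y < x, BoundaryChain π T k x₀ r y

/-- The symbol, or the base of its rule if it is a run, has an expansion of length at most
`2 ^ (4 (⌊log ℓ⌋ + 1))`. -/
def Shallow (ℓ : ℕ) (A : Sym) : Prop :=
  A.exp.length ≤ 2 ^ (4 * (Nat.log 2 ℓ + 1)) ∨
    ∃ B t, A = .run B t ∧ B.exp.length ≤ 2 ^ (4 * (Nat.log 2 ℓ + 1))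

/-- Either the symbol is shallow or it follows `r + 1` boundaries of high level. -/
def Progress (π : ℕ → Sym → ℕ) (T : List ℕ) (ℓ r : ℕ) (A : Sym) (rem : ℕ) : Prop :=
  Shallow ℓ A ∨ ∃ k x x₀, Occurs π T k x [A] ∧
    BoundaryChain π T (8 * (Nat.log 2 ℓ + 1)) x₀ r x ∧ x + rem ≤ x₀ + ℓ

theorem Progress.shallow {ℓ rem : ℕ} {A : Sym} (h : Progress π T ℓ 3 A rem) : Shallow ℓ A := by
  rcases h with h | ⟨k, x, x₀, -, ⟨h₃, x₂, h₂₃, h₂, x₁, h₁₂, h₁, x₀', h₀₁, h₀, rfl⟩, hx⟩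
  · exact h
  · exact (not_four_boundaries (windowBound_two π T ℓ) h₀ h₁ h₂ h₃ h₀₁ h₁₂ h₂₃ (by omega)).elim

theorem le_two_pow_shallow (ℓ : ℕ) : ℓ ≤ 2 ^ (4 * (Nat.log 2 ℓ + 1)) :=
  (Nat.lt_pow_succ_log_self (b := 2) (by norm_num) ℓ).le.trans
    (Nat.pow_le_pow_right (by norm_num) (by omega))

theorem exp_length_le_of_mem_slots {A B : Sym} (h : B ∈ A.slots) :
    B.exp.length ≤ A.exp.length := by
  rw [← expand_slots A]
  exact exp_length_le_of_mem h

theorem Occurs.getElem {k x : ℕ} {X : List Sym} (h : Occurs π T k x X) {i : ℕ}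
    (hi : i < X.length) : Occurs π T k (x + (expand (X.take i)).length) [X[i]] := by
  have h1 : X = X.take i ++ ([X[i]] ++ X.drop (i + 1)) := by simp
  rw [h1] at h
  exact h.right.left

/-- If the right-hand side occurs below the critical level, its symbols are active there and hence
short; otherwise the left end of the slot is the first boundary of the chain. -/
theorem Occurs.progress_zero {k x : ℕ} {A : Sym} (h : Occurs π T k x [A]) (hA : A.children ≠ [])
    {i ℓ rem : ℕ} (hi : i < A.slots.length) (hr : rem ≤ ℓ) : Progress π T ℓ 0 A.slots[i] rem := by
  obtain ⟨j, hj, hc, h2, hact⟩ := h.children hA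
  have hne : 0 < A.children.length := by omega
  rcases lt_or_ge j (8 * (Nat.log 2 ℓ + 1)) with hjk | hjk
  · have hsmall : ∀ B ∈ A.children, B.exp.length ≤ 2 ^ (4 * (Nat.log 2 ℓ + 1)) :=
      fun B hB => length_le_of_active (hact B hB) hjk
    cases A with
    | term a => simp [Sym.children] at hA
    | run B t =>
      have ht : t ≠ 0 := by rintro rfl; simp [Sym.children] at hA
      refine .inl (.inr ⟨B, t, ?_, hsmall B (by simp [Sym.children, ht])⟩)
      simp [Sym.slots]
    | block Bs => exact .inl (.inl (hsmall _ (List.getElem_mem hi)))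
  · cases A with
    | term a => simp [Sym.children] at hA
    | run B t =>
      have e : (Sym.run B t).slots[i] = .run B t := by simp [Sym.slots]
      rw [e]
      exact .inr ⟨k, x, x, h, ⟨h.boundary.of_le (by omega), rfl⟩, by omega⟩
    | block Bs =>
      have h' : Occurs π T j (x + (expand (Bs.take i)).length) [(Sym.block Bs).slots[i]] :=
        hc.getElem hi
      exact .inr ⟨j, _, _, h', ⟨h'.boundary.of_le hjk, rfl⟩, by omega⟩

/-- If `u` is a run, its base is `u.first`, of length at most `rem ≤ ℓ`. If `u` is a block of short
symbols, or lies on the leftmost path of a shallow symbol, the new slot is short. In the remaining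
case `u` starts where `A` does, its right-hand side occurs at a high level, and the new slot starts
strictly further right. -/
theorem Progress.step {ℓ r rem : ℕ} {A u : Sym} {us : List Sym} (h : Progress π T ℓ r A rem)
    (hrℓ : rem ≤ ℓ) (hcl : Climb u us A) (hup : u.Parsed π T) (hu : u.children ≠ [])
    (huf : u.first.exp.length ≤ rem) (hur : rem < u.exp.length) {i : ℕ} (hi : i < u.slots.length)
    (hir : u.cum i ≤ rem) (hri : rem < u.cum (i + 1)) :
    Progress π T ℓ (r + 1) u.slots[i] (rem - u.cum i) := by
  have hlen := exp_length_le_of_mem_slots (List.getElem_mem hi)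
  cases u with
  | term a => simp [Sym.children] at hu
  | run B t =>
    have ht : t ≠ 0 := by rintro rfl; simp [Sym.children] at hu
    have hf : (Sym.run B t).first = B := by
      obtain ⟨t, rfl⟩ := Nat.exists_eq_succ_of_ne_zero ht
      rfl
    rw [hf] at huf
    exact .inl (.inr ⟨B, t, by simp [Sym.slots], (huf.trans hrℓ).trans (le_two_pow_shallow ℓ)⟩)
  | block Bs =>
    rcases h with (h | ⟨B, t, rfl, h⟩) | ⟨k, x, x₀, hx, hch, hxr⟩
    · exact .inl (.inl (hlen.trans (hcl.exp_prefix.length_le.trans h)))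
    · rcases hcl.eq_or_climb_first with hcl | ⟨hne, us', hcl⟩
      · simp at hcl
      · have hf : (Sym.run B t).first = B := by
          cases t with
          | zero => simp [Sym.children] at hne
          | succ t => rfl
        rw [hf] at hcl
        exact .inl (.inl (hlen.trans (hcl.exp_prefix.length_le.trans h)))
    · obtain ⟨j, -, hj⟩ := hcl.occurs hx
      obtain ⟨j', -, hc, -, hact⟩ := hj.children hu
      rcases lt_or_ge j' (8 * (Nat.log 2 ℓ + 1)) with hjk | hjk
      · exact .inl (.inl (length_le_of_active (hact _ (List.getElem_mem hi)) hjk))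
      · have h' : Occurs π T j' (x + (Sym.block Bs).cum i) [(Sym.block Bs).slots[i]] :=
          hc.getElem hi
        refine .inr ⟨j', _, x₀, h', ⟨h'.boundary.of_le hjk, x, ?_, hch⟩, by omega⟩
        -- The first slot of `u` is `u.first`, which has at most `rem` letters, so the search passes
        -- over it entirely.
        have h0 : 0 < i := by
          refine Nat.pos_of_ne_zero ?_
          rintro rfl
          rw [Sym.cum_succ hi, Sym.cum_zero] at hri
          cases Bs with
          | nil => simp [Sym.children] at hu
          | cons B Bs =>
            have : (Sym.block (B :: Bs)).slots[0] = (Sym.block (B :: Bs)).first := rfl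
            rw [this] at hri
            omega
        have h1 := (Sym.block Bs).cum_monotone (show 1 ≤ i from h0)
        have h2 := Sym.cum_succ (A := .block Bs) (i := 0) (by omega)
        have h3 := hc.length_pos ((Sym.block Bs).slots[0]'(by omega)) (List.getElem_mem _)
        rw [Sym.cum_zero, zero_add] at h2
        omega

/-! ### Correctness and running time of a query -/

variable {w p c n : ℕ} {S : Sym} {rk : Sym → ℕ} {L R : Sym → ℕ → ℕ} {root : Sym → ℕ}
  {sp : Sym → ℕ} {sl : Sym → ℕ → ℕ} {ca : Sym → ℕ} {m : ℕ → ℕ}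

/-- The descent into a shallow symbol. -/
theorem Stores.stops_shallow [Fact p.Prime] (h : Stores w p c n S rk L R root sp sl ca m)
    (hS : S.Parsed π T) (hn : T.length ≤ n) (hnw : n < 2 ^ w) {ctr : ℕ} {A : Sym}
    (hA : A ∈ S.symbols) {ℓ rem : ℕ} (hsh : Shallow ℓ A) (h1 : 1 ≤ rem) (hr : rem < A.exp.length)
    (hrℓ : rem ≤ ℓ) (x y : ZMod p) {l : List ℕ} (hl : Ready p ctr x.val rem y.val (sp A) l) :
    Stops w m (2600 * (Nat.log 2 ℓ + 1)) 105 l (x + y * LCG.sig p c (A.exp.take rem)).val := by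
  have key : ∀ B ∈ S.symbols, B.exp.length ≤ 2 ^ (4 * (Nat.log 2 ℓ + 1)) →
      60 * B.height + 15 * Nat.log 2 B.exp.length ≤ 2520 * (Nat.log 2 ℓ + 1) := by
    intro B hB hle
    have h1 := (hS.symbols B hB).height_le
    have h2 := Nat.log_mono_right (b := 2) hle
    rw [Nat.log_pow (by norm_num)] at h2
    omega
  rcases hsh with hsh | ⟨B, t, rfl, hsh⟩
  · obtain ⟨l', hl', run⟩ := h.stops_direct hS hn hnw A hA rem x y l h1 hr hl
    exact ⟨l', hl', run.mono ((key A hA hsh).trans (by omega))⟩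
  · have hne := (hS.symbols _ hA).children_ne_nil (by simp)
    have hN := mem_nonterminals_of_mem_symbols hA hne
    have ht : t ≠ 0 := by rintro rfl; simp [Sym.children] at hne
    have hB : B ∈ S.symbols := mem_symbols_of_mem_children hN (by simp [Sym.children, ht])
    obtain ⟨l', hl', run⟩ := h.stops_run hN
      (fun rem x y l => h.stops_direct hS hn hnw B hB rem x y l) x y hr hl
    have hk := key B hB hsh
    have hlog : Nat.log 2 (rem / B.exp.length) ≤ Nat.log 2 ℓ :=
      Nat.log_mono_right ((Nat.div_le_self _ _).trans hrℓ)
    exact ⟨l', hl', run.mono (by omega)⟩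

theorem Stores.stops_gallop [Fact p.Prime] (hc : (c : ZMod p) ≠ 0)
    (h : Stores w p c n S rk L R root sp sl ca m) (hS : S.Parsed π T) {A : Sym}
    (hA : A ∈ S.nonterminals) (hn : T.length ≤ n) (hnw : n < 2 ^ w) {s rem : ℕ}
    (hs : s ≤ A.slots.length) (hr : A.cum s + rem ≤ A.exp.length) {ctr N : ℕ} (x y : ZMod p)
    {l : List ℕ} (hl : Ready p ctr x.val rem y.val (sl A s) l)
    (hN : ∀ i, s ≤ i → i ≤ A.slots.length → A.cum i ≤ A.cum s + rem →
      (A.slots.length < i + 1 ∨ A.cum s + rem < A.cum (i + 1)) →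
      ∀ (x y : ZMod p) (r₅ r₇ r₈ r₉ r₁₀ r₁₁ r₁₇ r₁₈ : ℕ), Stops w m N 67
        (regs p ctr x.val (A.cum s + rem - A.cum i) y.val (sl A s) r₅ (sl A i)
          r₇ r₈ r₉ r₁₀ r₁₁ r₁₇ r₁₈)
        (x + y * LCG.sig p c
          ((expand (A.slots.drop i)).take (A.cum s + rem - A.cum i))).val) :
    Stops w m (19 * Nat.log 2 rem + 62 + N) 12 l
      (x + y * LCG.sig p c ((expand (A.slots.drop s)).take rem)).val := by
  obtain ⟨i, hsi, hi, hic, hin, r₅, r₇, r₈, r₉, r₁₀, r₁₁, r₁₇, r₁₈, run⟩ := h.run_gallop hc hS hA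
    ((hS.nonterminals A hA).length_le.trans hn) hnw hs hr x y hl
  have hst := hN i hsi hi hic hin (x + y * LCG.sig p c (expand ((A.slots.take i).drop s)))
    (y * (c : ZMod p) ^ (A.cum i - A.cum s)) r₅ r₇ r₈ r₉ r₁₀ r₁₁ r₁₇ r₁₈
  have hv : x + y * LCG.sig p c (expand ((A.slots.take i).drop s)) +
      y * (c : ZMod p) ^ (A.cum i - A.cum s) * LCG.sig p c
        ((expand (A.slots.drop i)).take (A.cum s + rem - A.cum i)) =
      x + y * LCG.sig p c ((expand (A.slots.drop s)).take rem) := by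
    rw [take_expand_drop A.slots hsi hi hic, sig_append, length_expand_drop_take A hsi]
    simp only [Sym.cum]
    ring
  exact hv ▸ hst.of_run run le_rfl

/-- The descent after a galloping search, with `ctr` more searches on leftmost paths. -/
theorem Stores.stops_rounds [Fact p.Prime] (hc : (c : ZMod p) ≠ 0)
    (h : Stores w p c n S rk L R root sp sl ca m) (hS : S.Parsed π T) (hn : T.length ≤ n)
    (hnw : n < 2 ^ w) {ℓ : ℕ} (ctr : ℕ) : ∀ (r : ℕ), r + ctr = 3 →
    ∀ A ∈ S.nonterminals, ∀ i ≤ A.slots.length, ∀ rem ≤ ℓ, A.cum i + rem ≤ A.exp.length →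
      (A.slots.length < i + 1 ∨ A.cum i + rem < A.cum (i + 1)) →
      (∀ h : i < A.slots.length, Progress π T ℓ r A.slots[i] rem) →
    ∀ (x y : ZMod p) (cur r₅ r₇ r₈ r₉ r₁₀ r₁₁ r₁₇ r₁₈ : ℕ),
    Stops w m ((2605 + 300 * ctr) * (Nat.log 2 ℓ + 1)) 67
      (regs p ctr x.val rem y.val cur r₅ (sl A i) r₇ r₈ r₉ r₁₀ r₁₁ r₁₇ r₁₈)
      (x + y * LCG.sig p c ((expand (A.slots.drop i)).take rem)).val := by
  induction ctr with
  | zero =>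
    intro r hr3 A hA i hi rem hrℓ hle hlt hpr x y cur r₅ r₇ r₈ r₉ r₁₀ r₁₁ r₁₇ r₁₈
    rcases Nat.eq_zero_or_pos rem with rfl | hpos
    · refine ⟨_, ?_, Run.mono (Run.jeq rfl rfl) (by omega)⟩
      simp [LCG.sig]
    have hi' : i < A.slots.length := by
      refine lt_of_le_of_ne hi ?_
      rintro rfl
      rw [Sym.cum_length] at hle
      omega
    have hsucc := Sym.cum_succ hi'
    have hAi := mem_symbols_of_mem_slots hA (List.getElem_mem hi')
    have s1 := h.sl_lt A hA i hi
    have c1 := h.sym A hA i hi'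
    obtain rfl : r = 3 := by omega
    have hst := h.stops_shallow hS hn hnw (ctr := 0) hAi (hpr hi').shallow hpos (by omega) hrℓ x y
      ⟨r₅, sl A i, r₇, r₈, r₉, r₁₀, r₁₁, r₁₇, r₁₈, rfl⟩
    have hv : (expand (A.slots.drop i)).take rem = A.slots[i].exp.take rem := by
      rw [← List.getElem_cons_drop hi', expand_cons, List.take_append_of_le_length (by omega)]
    rw [hv]
    have run : Run w prog m 5
        67 (regs p 0 x.val rem y.val cur r₅ (sl A i) r₇ r₈ r₉ r₁₀ r₁₁ r₁₇ r₁₈)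
        105 (regs p 0 x.val rem y.val (sp A.slots[i]) r₅ (sl A i) r₇ r₈ r₉ r₁₀ r₁₁ r₁₇ r₁₈) := by
      refine Run.mono (Run.trans (n' := 1) (Run.trans (Run.not_jeq rfl hpos.ne')
        (Run.code_eq (n := 3) (pc' := 71) (ldField 4 6 15) rfl rfl ?_ ?_ rfl rfl))
        (Run.jeq rfl rfl)) (le_refl 5)
      · simp [FitsAll, Instr.Fits, Instr.effect]
        omega
      · simp [Instr.effect, c1]
    exact hst.of_run run (by omega)
  | succ ctr ih =>
    intro r hr3 A hA i hi rem hrℓ hle hlt hpr x y cur r₅ r₇ r₈ r₉ r₁₀ r₁₁ r₁₇ r₁₈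
    rcases Nat.eq_zero_or_pos rem with rfl | hpos
    · refine ⟨_, ?_, Run.mono (Run.jeq rfl rfl) (n' := _) (by nlinarith)⟩
      simp [LCG.sig]
    have hi' : i < A.slots.length := by
      refine lt_of_le_of_ne hi ?_
      rintro rfl
      rw [Sym.cum_length] at hle
      omega
    have hsucc := Sym.cum_succ hi'
    have hAi := mem_symbols_of_mem_slots hA (List.getElem_mem hi')
    have s1 := h.sl_lt A hA i hi
    have c1 := h.sym A hA i hi'
    have hrB : rem < A.slots[i].exp.length := by omega
    have run : Run w prog m 6
        67 (regs p (ctr + 1) x.val rem y.val cur r₅ (sl A i) r₇ r₈ r₉ r₁₀ r₁₁ r₁₇ r₁₈)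
        73 (regs p ctr x.val rem y.val (sp A.slots[i]) r₅ (sl A i) r₇ r₈ r₉ r₁₀ r₁₁ r₁₇ r₁₈) := by
      refine Run.mono (Run.trans (n' := 1) (Run.trans (n' := 1) (Run.trans
        (Run.not_jeq rfl hpos.ne')
        (Run.code_eq (n := 3) (pc' := 71) (l' := regs p (ctr + 1) x.val rem y.val (sp A.slots[i])
          r₅ (sl A i) r₇ r₈ r₉ r₁₀ r₁₁ r₁₇ r₁₈) (ldField 4 6 15) rfl rfl ?_ ?_ rfl rfl))
        (Run.not_jeq rfl (Nat.succ_ne_zero ctr)))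
        (Run.code_eq (n := 1) [.op .sub 15 15 14] rfl rfl ?_ ?_ rfl rfl)) (le_refl 6)
      · simp [FitsAll, Instr.Fits, Instr.effect]
        omega
      · simp [Instr.effect, c1]
      · simp [FitsAll, Instr.Fits]
        omega
      · simp [Instr.effect]
    obtain ⟨u, us, huN, hcl, huf, hur, l', hl', run2⟩ := h.run_spine hS hAi (ctr := ctr)
      (acc := x.val) (pw := y.val) hpos hrB
      ⟨r₅, sl A i, r₇, r₈, r₉, r₁₀, r₁₁, r₁₇, r₁₈, rfl⟩
    have hup := hS.nonterminals u huN
    have hu := hS.ne_nil_of_mem huN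
    have hst := h.stops_gallop hc hS huN hn hnw (Nat.zero_le _)
      (N := (2605 + 300 * ctr) * (Nat.log 2 ℓ + 1)) (by rw [Sym.cum_zero]; omega) x y hl' (by
        intro i' _ hi1 hi2 hi3 x' y' r₅ r₇ r₈ r₉ r₁₀ r₁₁ r₁₇ r₁₈
        rw [Sym.cum_zero, zero_add] at hi2 hi3 ⊢
        refine ih (r + 1) (by omega) u huN i' hi1 (rem - u.cum i') (by omega) (by omega)
          (by omega) (fun hi4 => ?_) x' y' _ _ _ _ _ _ _ _ _
        exact (hpr hi').step hrℓ hcl hup hu huf hur hi4 hi2 (by omega))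
    rw [List.drop_zero, expand_slots] at hst
    have hv : (expand (A.slots.drop i)).take rem = u.exp.take rem := by
      rw [← List.getElem_cons_drop hi', expand_cons, List.take_append_of_le_length (by omega)]
      obtain ⟨z, hz⟩ := hcl.exp_prefix
      rw [← hz, List.take_append_of_le_length (by omega)]
    rw [hv]
    have hlog : Nat.log 2 rem ≤ Nat.log 2 ℓ := Nat.log_mono_right hrℓ
    -- The climb is charged to the length of `u.first`, at most `rem ≤ ℓ`; `u` itself may be much
    -- longer.
    have hh : u.first.height ≤ 8 * (Nat.log 2 ℓ + 1) + 1 := by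
      have h1 := (hup.first hu).height_le
      have h2 := Nat.log_mono_right (b := 2) (huf.trans hrℓ)
      omega
    refine hst.of_run (run.trans run2) ?_
    rw [show (2605 + 300 * (ctr + 1)) * (Nat.log 2 ℓ + 1) =
      300 * (Nat.log 2 ℓ + 1) + (2605 + 300 * ctr) * (Nat.log 2 ℓ + 1) by ring]
    omega

/-- The query program, from its first galloping search. -/
theorem Stores.stops_query [Fact p.Prime] (hc : (c : ZMod p) ≠ 0)
    (h : Stores w p c n S rk L R root sp sl ca m) (hS : S.Parsed π T) (hn : T.length ≤ n)
    (hnw : n < 2 ^ w) {A : Sym} (hA : A ∈ S.nonterminals) {s ℓ : ℕ} (hs : s ≤ A.slots.length)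
    (hr : A.cum s + ℓ ≤ A.exp.length) (x y : ZMod p) {l : List ℕ}
    (hl : Ready p 3 x.val ℓ y.val (sl A s) l) :
    Stops w m (4000 * (Nat.log 2 ℓ + 1)) 12 l
      (x + y * LCG.sig p c ((expand (A.slots.drop s)).take ℓ)).val := by
  obtain ⟨k, z, hocc⟩ := hS.nonterminals A hA
  obtain ⟨l', hl', run⟩ := h.stops_gallop hc hS hA hn hnw hs hr
    (N := (2605 + 300 * 3) * (Nat.log 2 ℓ + 1)) x y hl (by
      intro i hsi hi1 hi2 hi3 x' y' r₅ r₇ r₈ r₉ r₁₀ r₁₁ r₁₇ r₁₈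
      have := A.cum_monotone hsi
      exact h.stops_rounds hc hS hn hnw 3 0 rfl A hA i hi1 (A.cum s + ℓ - A.cum i) (by omega)
        (by omega) (by omega) (fun hi4 => hocc.progress_zero (hS.ne_nil_of_mem hA) hi4 (by omega))
        x' y' _ _ _ _ _ _ _ _ _)
  exact ⟨l', hl', run.mono (by omega)⟩

end

/-! ### Construction of the data structure -/

section

/-- Memory that consists of `r` rows of 32 words. -/
def ofRows (w r : ℕ) (row : ℕ → List ℕ) : List ℕ :=
  List.ofFn fun a : Fin (32 * r) => (row (a / 32)).getD (a % 32) 0 % 2 ^ w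

theorem getD_ofRows {w r : ℕ} {row : ℕ → List ℕ} {f i v : ℕ} (hf : f < 32) (hi : i < r)
    (hv : v < 2 ^ w) (h : (row i).getD f 0 = v) : (ofRows w r row).getD (f + 32 * i) 0 = v := by
  have h1 : f + 32 * i < 32 * r := by omega
  rw [ofRows, List.getD_eq_getElem _ _ (by simpa using h1)]
  simp only [List.getElem_ofFn]
  rw [show (f + 32 * i) / 32 = i by omega, show (f + 32 * i) % 32 = f by omega, h,
    Nat.mod_eq_of_lt hv]

/-- 1 for a run and 0 for other symbols. -/
def Sym.runFlag : Sym → ℕ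
  | .run _ _ => 1
  | _ => 0

variable {π : ℕ → Sym → ℕ} {T : List ℕ}

theorem Sym.Parsed.exists_searchTrees {S : Sym} (hS : S.Parsed π T) :
    ∃ (L R : Sym → ℕ → ℕ) (root : Sym → ℕ), ∀ A ∈ S.nonterminals,
      (root A < A.slots.length ∧
        ∀ i < A.slots.length, L A i < A.slots.length ∧ R A i < A.slots.length) ∧
      ∀ i < A.slots.length, ∃ d, 2 ^ d * (A.cum (i + 1) - A.cum i) ≤ A.exp.length ∧
        SearchPath 0 A.slots.length (L A) (R A) i d (root A) := by
  have key : ∀ A : Sym, ∃ (L R : ℕ → ℕ) (root : ℕ), A ∈ S.nonterminals →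
      (root < A.slots.length ∧
        ∀ i < A.slots.length, L i < A.slots.length ∧ R i < A.slots.length) ∧
      ∀ i < A.slots.length, ∃ d, 2 ^ d * (A.cum (i + 1) - A.cum i) ≤ A.exp.length ∧
        SearchPath 0 A.slots.length L R i d root := by
    intro A
    by_cases hA : A ∈ S.nonterminals
    · have hpos : 0 < A.slots.length := by
        cases A with
        | block Bs => exact List.length_pos_of_ne_nil (hS.ne_nil_of_mem hA)
        | _ => simp [Sym.slots]
      obtain ⟨L, R, r, -, h1, h2, h3⟩ := exists_searchTree A.cum_monotone A.slots.length 0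
        A.slots.length (by omega) hpos
      refine ⟨L, R, r, fun _ => ⟨⟨h1, fun i hi => h2 i (Nat.zero_le i) hi⟩, fun i hi => ?_⟩⟩
      obtain ⟨d, hd, hp⟩ := h3 i (Nat.zero_le i) hi
      rw [A.cum_length, A.cum_zero, Nat.sub_zero] at hd
      exact ⟨d, hd, hp⟩
    · exact ⟨id, id, 0, fun h => (hA h).elim⟩
  choose L R root h using key
  exact ⟨L, R, root, h⟩

theorem card_nonterminals_le (S : Sym) : S.nonterminals.card ≤ S.symbols.card :=
  Finset.card_le_card fun _ => mem_symbols_of_mem_nonterminals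

theorem exists_child_arrays {S : Sym} (hS : S.Parsed π T) {rk : Sym → ℕ}
    (hinj : ∀ u ∈ S.nonterminals, ∀ v ∈ S.nonterminals, u.first = v.first → rk u = rk v → u = v)
    (hrk : ∀ u ∈ S.nonterminals, rk u < {v ∈ S.nonterminals | v.first = u.first}.card) :
    ∃ (base : Sym → ℕ) (arr : ℕ → Sym), (∀ v ∈ S.symbols, base v ≤ S.symbols.card) ∧
      ∀ u ∈ S.nonterminals, base u.first + rk u < S.symbols.card ∧
        arr (base u.first + rk u) = u := by
  have : Inhabited Sym := ⟨.term 0⟩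
  obtain ⟨base, arr, h⟩ := exists_arrays S.symbols
    (fun v => {u ∈ S.nonterminals | u.first = v}.card)
    (fun v r => Classical.epsilon fun u => u ∈ S.nonterminals ∧ u.first = v ∧ rk u = r)
  have hsum : ∑ v ∈ S.symbols, {u ∈ S.nonterminals | u.first = v}.card ≤ S.symbols.card := by
    rw [← Finset.card_eq_sum_card_fiberwise fun u hu => first_mem_symbols hu (hS.ne_nil_of_mem hu)]
    exact card_nonterminals_le S
  refine ⟨base, arr, fun v hv => by have := (h v hv).1; omega, fun u hu => ?_⟩
  obtain ⟨h1, h2⟩ := h u.first (first_mem_symbols hu (hS.ne_nil_of_mem hu))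
  have h3 := hrk u hu
  refine ⟨by omega, ?_⟩
  rw [h2 _ h3]
  obtain ⟨h4, h5, h6⟩ := Classical.epsilon_spec
    (p := fun v => v ∈ S.nonterminals ∧ v.first = u.first ∧ rk v = rk u) ⟨u, hu, rfl, rfl⟩
  exact hinj _ h4 _ hu h5 h6

/-- The data structure. -/
theorem exists_stores {S : Sym} (hS : S.Parsed π T) {p c w : ℕ} [Fact p.Prime]
    (hcode : 2 ^ 11 * T.length ^ 9 < 2 ^ w) (hptr : 400 * (T.length + p) < 2 ^ w)
    (hmod : 4 * (p * p) < 2 ^ w) (hg : 0 < grammarSize S) (Ys : List (List ℕ))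
    (hY : ∀ y ∈ Ys, y ∈ multisetY S) (hYs : Ys.length ≤ grammarSize S) :
    ∃ D : List ℕ, D.length = 64 * grammarSize S ∧ (∀ x ∈ D, x < 2 ^ w) ∧
      ∃ rk L R root sp sl ca,
        Stores w p c T.length S rk L R root sp sl ca (fun a => D.getD a 0) ∧
        D.getD 21 0 = p ∧ ∀ (j : ℕ) (hj : j < Ys.length), ∃ A ∈ S.nonterminals,
          ∃ s < A.slots.length, Ys[j] <+: expand (A.slots.drop s) ∧
            D.getD (20 + 32 * j) 0 = sl A s := by
  have : Inhabited Sym := ⟨.term 0⟩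
  have hgT : grammarSize S ≤ 2 * T.length := by
    have h1 := grammarSize_le S hS
    have h2 := hS.length_le
    omega
  obtain ⟨rk, hinj, hrk⟩ := exists_spine_rank hS
  obtain ⟨bs, symAt, hbs⟩ := exists_arrays S.symbols (fun _ => 1) (fun A _ => A)
  obtain ⟨bl, slotAt, hbl⟩ := exists_arrays S.nonterminals (fun A => A.slots.length + 1)
    (fun A i => (A, i))
  obtain ⟨bc, childAt, hbc, hchild⟩ := exists_child_arrays hS hinj fun u hu => (hrk u hu).2
  obtain ⟨L, R, root, htree⟩ := hS.exists_searchTrees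
  have hsy := card_symbols_le hS
  have hsl := sum_slots_le hS
  rw [Finset.sum_const, smul_eq_mul, mul_one] at hbs
  have hbs' : ∀ A ∈ S.symbols, bs A < 2 * grammarSize S ∧ symAt (bs A) = A := fun A hA =>
    ⟨by have := (hbs A hA).1; omega, (hbs A hA).2 0 one_pos⟩
  have hbl' : ∀ A ∈ S.nonterminals, ∀ i ≤ A.slots.length,
      bl A + i < 2 * grammarSize S ∧ slotAt (bl A + i) = (A, i) := fun A hA i hi =>
    ⟨by have := (hbl A hA).1; omega, (hbl A hA).2 i (by omega)⟩
  have hex : ∀ j, ∃ (A : Sym) (s : ℕ), ∀ hj : j < Ys.length,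
      A ∈ S.nonterminals ∧ s < A.slots.length ∧ Ys[j] <+: expand (A.slots.drop s) := by
    intro j
    by_cases hj : j < Ys.length
    · obtain ⟨A, hA, s, hs, h⟩ := exists_slot_of_mem_multisetY (hY _ (List.getElem_mem hj))
      exact ⟨A, s, fun _ => ⟨hA, hs, h⟩⟩
    · exact ⟨default, 0, fun h => (hj h).elim⟩
  choose yA ys hys using hex
  set sp : Sym → ℕ := fun A => 32 * bs A with hsp
  set sl : Sym → ℕ → ℕ := fun A i => 32 * (bl A + i) with hsl'
  set ca : Sym → ℕ := fun A => 32 * bc A with hca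
  -- Row `r` holds unrelated records side by side: symbol number `r`, slot number `r`, entry number
  -- `r` of the arrays for climbing, and query number `r`. Each kind needs at most `2 * grammarSize
  -- S` rows, which bounds the whole structure. Columns without a record hold irrelevant values.
  set row : ℕ → List ℕ := fun r =>
    [(symAt r).exp.length, (symAt r).runFlag, sp (symAt r).first, sl (symAt r) 0,
      sl (symAt r) (root (symAt r)), sp (symAt r).leaf, codeFields ((symAt r).spine.map rk),
      codeMarks ((symAt r).spine.map rk), ca (symAt r), (LCG.sig p c (symAt r).exp).val,
      ((c : ZMod p) ^ (symAt r).exp.length).val,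
      (slotAt r).1.cum (slotAt r).2,
      (LCG.sig p c (expand ((slotAt r).1.slots.take (slotAt r).2))).val,
      ((c : ZMod p) ^ (slotAt r).1.cum (slotAt r).2).val,
      ((c : ZMod p) ^ (slotAt r).1.cum (slotAt r).2)⁻¹.val,
      sp ((slotAt r).1.slots.getD (slotAt r).2 default),
      sl (slotAt r).1 (L (slotAt r).1 (slotAt r).2),
      sl (slotAt r).1 (R (slotAt r).1 (slotAt r).2),
      sl (slotAt r).1 (slotAt r).1.slots.length, sp (childAt r), sl (yA r) (ys r), p] with hrow
  have hval : ∀ z : ZMod p, z.val < 2 ^ w := fun z => by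
    have := ZMod.val_lt z
    omega
  have hsps : ∀ A ∈ S.symbols, sp A + 32 < 2 ^ w := fun A hA => by
    have := (hbs' A hA).1
    simp only [hsp]
    omega
  have hsls : ∀ A ∈ S.nonterminals, ∀ i ≤ A.slots.length,
      sl A i + 64 * (T.length + 2) < 2 ^ w := fun A hA i hi => by
    have h1 := (hbl' A hA i hi).1
    have h2 := (Fact.out : p.Prime).two_le
    simp only [hsl']
    omega
  have hcodes : ∀ A ∈ S.symbols, 2 ^ codeBits (A.spine.map rk) < 2 ^ w := by
    intro A hA
    refine (two_pow_codeBits_le hS (fun u hu => (hrk u hu).1) hA).trans_lt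
      (lt_of_le_of_lt ?_ hcode)
    have hA' := hS.symbols A hA
    -- The logarithmic bound on heights makes the rounding factor of the codes polynomial, so that a
    -- code fits into a word.
    have h1 : 2 ^ A.height ≤ 2 ^ 9 * A.exp.length ^ 8 := by
      calc 2 ^ A.height ≤ 2 ^ (9 + Nat.log 2 A.exp.length * 8) :=
            Nat.pow_le_pow_right (by norm_num) (by have := hA'.height_le; omega)
        _ = 2 ^ 9 * (2 ^ Nat.log 2 A.exp.length) ^ 8 := by rw [pow_add, pow_mul]
        _ ≤ _ := Nat.mul_le_mul_left _ (Nat.pow_le_pow_left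
            (Nat.pow_log_le_self 2 (by have := hA'.length_pos; omega)) 8)
    calc 2 ^ A.height * S.symbols.card ≤ 2 ^ 9 * T.length ^ 8 * (4 * T.length) :=
          Nat.mul_le_mul (h1.trans (Nat.mul_le_mul_left _ (Nat.pow_le_pow_left hA'.length_le 8)))
            (by omega)
      _ = 2 ^ 11 * T.length ^ 9 := by ring
  have hlens : ∀ A ∈ S.symbols, A.exp.length < 2 ^ w := fun A hA => by
    have := (hS.symbols A hA).length_le
    omega
  have hsym : ∀ A ∈ S.symbols, ∀ f < 32, ∀ v < 2 ^ w, (row (bs A)).getD f 0 = v →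
      (ofRows w (2 * grammarSize S) row).getD (f + sp A) 0 = v :=
    fun A hA f hf v hv h => getD_ofRows hf (hbs' A hA).1 hv h
  have hslot : ∀ A ∈ S.nonterminals, ∀ i ≤ A.slots.length, ∀ f < 32, ∀ v < 2 ^ w,
      (row (bl A + i)).getD f 0 = v →
      (ofRows w (2 * grammarSize S) row).getD (f + sl A i) 0 = v :=
    fun A hA i hi f hf v hv h => getD_ofRows hf (hbl' A hA i hi).1 hv h
  have hsa : ∀ A ∈ S.symbols, symAt (bs A) = A := fun A hA => (hbs' A hA).2
  have hla : ∀ A ∈ S.nonterminals, ∀ i ≤ A.slots.length, slotAt (bl A + i) = (A, i) :=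
    fun A hA i hi => (hbl' A hA i hi).2
  have hNs : ∀ A ∈ S.nonterminals, A ∈ S.symbols := fun A => mem_symbols_of_mem_nonterminals
  have hslw : ∀ A ∈ S.nonterminals, ∀ i ≤ A.slots.length, sl A i < 2 ^ w := fun A hA i hi => by
    have := hsls A hA i hi
    omega
  have hspw : ∀ A ∈ S.symbols, sp A < 2 ^ w := fun A hA => by
    have := hsps A hA
    omega
  have hfirst : ∀ B t, Sym.run B t ∈ S.symbols → (Sym.run B t).first = B ∧ B ∈ S.symbols := by
    intro B t hA
    have hne := (hS.symbols _ hA).children_ne_nil (by simp)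
    have h1 := first_mem_symbols (mem_nonterminals_of_mem_symbols hA hne) hne
    have h2 : (Sym.run B t).first = B := by
      cases t with
      | zero => simp [Sym.children] at hne
      | succ t => rfl
    exact ⟨h2, h2 ▸ h1⟩
  refine ⟨ofRows w (2 * grammarSize S) row, by rw [ofRows, List.length_ofFn]; ring, ?_,
    rk, L, R, root, sp, sl, ca, ?_, ?_, ?_⟩
  · intro x hx
    obtain ⟨a, rfl⟩ := (List.mem_ofFn' _ _).1 hx
    exact Nat.mod_lt _ (by positivity)
  · constructor
    case len =>
      intro A hA
      have := hsym A hA 0 (by norm_num) _ (hlens A hA) (by simp [hrow, hsa A hA])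
      rwa [zero_add] at this
    case isRun =>
      intro B t hA
      exact hsym _ hA 1 (by norm_num) _ (by omega) (by simp [hrow, hsa _ hA, Sym.runFlag])
    case isBlock =>
      intro Bs hA
      exact hsym _ hA 1 (by norm_num) _ (by omega) (by simp [hrow, hsa _ hA, Sym.runFlag])
    case base =>
      intro B t hA
      exact hsym _ hA 2 (by norm_num) _ (hspw B (hfirst B t hA).2)
        (by simp [hrow, hsa _ hA, (hfirst B t hA).1])
    case slot =>
      intro A hA
      exact hsym _ (hNs A hA) 3 (by norm_num) _ (hslw A hA 0 (Nat.zero_le _))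
        (by simp [hrow, hsa _ (hNs A hA)])
    case treeRoot =>
      intro A hA
      exact hsym _ (hNs A hA) 4 (by norm_num) _ (hslw A hA _ (htree A hA).1.1.le)
        (by simp [hrow, hsa _ (hNs A hA)])
    case leaf =>
      intro A hA
      exact hsym _ hA 5 (by norm_num) _ (hspw _ (leaf_mem_symbols hS hA))
        (by simp [hrow, hsa _ hA])
    case fields =>
      intro A hA
      exact hsym _ hA 6 (by norm_num) _ ((codeFields_lt _).trans (hcodes A hA))
        (by simp [hrow, hsa _ hA])
    case marks =>
      intro A hA
      exact hsym _ hA 7 (by norm_num) _ ((codeMarks_lt _).trans (hcodes A hA))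
        (by simp [hrow, hsa _ hA])
    case array =>
      intro A hA
      exact hsym _ hA 8 (by norm_num) _ (by have := hbc A hA; simp only [hca]; omega)
        (by simp [hrow, hsa _ hA])
    case sig =>
      intro A hA
      exact hsym _ hA 9 (by norm_num) _ (hval _) (by simp [hrow, hsa _ hA])
    case pow =>
      intro A hA
      exact hsym _ hA 10 (by norm_num) _ (hval _) (by simp [hrow, hsa _ hA])
    case cum =>
      intro A hA i hi
      have h1 := A.cum_monotone hi
      rw [A.cum_length] at h1
      exact hslot A hA i hi 11 (by norm_num) _ (h1.trans_lt (hlens A (hNs A hA)))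
        (by simp [hrow, hla A hA i hi])
    case prefixSig =>
      intro A hA i hi
      exact hslot A hA i hi 12 (by norm_num) _ (hval _) (by simp [hrow, hla A hA i hi])
    case prefixPow =>
      intro A hA i hi
      exact hslot A hA i hi 13 (by norm_num) _ (hval _) (by simp [hrow, hla A hA i hi])
    case prefixInv =>
      intro A hA i hi
      exact hslot A hA i hi 14 (by norm_num) _ (hval _) (by simp [hrow, hla A hA i hi])
    case sym =>
      intro A hA i hi
      exact hslot A hA i hi.le 15 (by norm_num) _
        (hspw _ (mem_symbols_of_mem_slots hA (List.getElem_mem hi)))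
        (by simp [hrow, hla A hA i hi.le, hi])
    case left =>
      intro A hA i hi
      exact hslot A hA i hi.le 16 (by norm_num) _ (hslw A hA _ ((htree A hA).1.2 i hi).1.le)
        (by simp [hrow, hla A hA i hi.le])
    case right =>
      intro A hA i hi
      exact hslot A hA i hi.le 17 (by norm_num) _ (hslw A hA _ ((htree A hA).1.2 i hi).2.le)
        (by simp [hrow, hla A hA i hi.le])
    case last =>
      intro A hA i hi
      exact hslot A hA i hi 18 (by norm_num) _ (hslw A hA _ le_rfl)
        (by simp [hrow, hla A hA i hi])
    case entry =>
      intro A hA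
      have h1 := (hchild A hA).1
      rw [show ca A.first + rk A * 32 = 32 * (bc A.first + rk A) by simp only [hca]; ring]
      exact getD_ofRows (by norm_num) (by omega) (hspw A (hNs A hA))
        (by simp [hrow, (hchild A hA).2])
    case sl_add =>
      intro A i
      simp only [hsl']
      ring
    case ca_lt =>
      intro A hA
      have h1 := (hchild A hA).1
      simp only [hca]
      omega
    case sp_lt => exact hsps
    case sl_lt => exact hsls
    case code_lt => exact hcodes
    case mod_lt => exact hmod
    case tree_lt => exact fun A hA => (htree A hA).1
    case search => exact fun A hA => (htree A hA).2
  · exact getD_ofRows (f := 21) (i := 0) (by norm_num) (by omega) (by omega) (by simp [hrow])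
  · intro j hj
    obtain ⟨h1, h2, h3⟩ := hys j hj
    refine ⟨yA j, h1, ys j, h2, h3, getD_ofRows (by norm_num) (by omega) (hslw _ h1 _ h2.le) ?_⟩
    simp [hrow]

end

/-! ### Start of the program and proof of the theorem -/

theorem IsGrammar.parsed {π : ℕ → Sym → ℕ} {T : List ℕ} {S : Sym} (h : IsGrammar π T S) :
    S.Parsed π T ∧ S.exp.length = T.length := by
  obtain ⟨k, hk⟩ := h.final
  refine ⟨⟨k, 0, [], [], by simpa using hk, rfl⟩, ?_⟩
  have := expand_level π T k
  rw [hk] at this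
  rw [← this]
  simp [expand]

theorem run_init {w : ℕ} {m : ℕ → ℕ} {j ℓ q p : ℕ} (hw : 32 < 2 ^ w) (hj : 20 + 32 * j < 2 ^ w)
    (hp : m 21 = p) (hq : m (20 + 32 * j) = q) :
    ∃ l, Ready p 3 0 ℓ 1 q l ∧
      Run w prog m 12 0 [j, ℓ, 0, 0, 0, 0, 0, 0, 0, 0, 0, 0, 0, 0, 0, 0, 0, 0, 0] 12 l := by
  rw [mul_comm] at hq hj
  refine ⟨_, ⟨0, 0, 0, 0, 20 + j * 32, 0, 0, 0, 0, rfl⟩, Run.code_eq codeInit rfl rfl ?_ ?_ rfl rfl⟩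
  · simp only [FitsAll, Instr.Fits]
    generalize 2 ^ w = W at hw hj
    simp [Instr.effect]
    omega
  · simp [Instr.effect, hp, hq]

theorem Stops.answers {w N v j ℓ : ℕ} {D : List ℕ}
    (h : Stops w (fun a => D.getD a 0) N 0
      [j, ℓ, 0, 0, 0, 0, 0, 0, 0, 0, 0, 0, 0, 0, 0, 0, 0, 0, 0] v) :
    Answers w prog D j ℓ v N := by
  obtain ⟨l, hl, t, ht, hrun⟩ := h
  have hstart : start D j ℓ =
      ⟨0, rg [j, ℓ, 0, 0, 0, 0, 0, 0, 0, 0, 0, 0, 0, 0, 0, 0, 0, 0, 0], fun a => D.getD a 0⟩ := by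
    have : ∀ r, (if r = 0 then j else if r = 1 then ℓ else 0) =
        rg [j, ℓ, 0, 0, 0, 0, 0, 0, 0, 0, 0, 0, 0, 0, 0, 0, 0, 0, 0] r := by
      intro r
      rcases r with _ | _ | r
      · rfl
      · rfl
      · have h0 (k : ℕ) : (List.replicate k 0).getD r 0 = 0 := by
          rw [List.getD_eq_getElem?_getD, List.getElem?_replicate]
          split_ifs <;> rfl
        exact (h0 17).symm
    rw [start, funext this]
  refine ⟨t, ht, ?_, ?_⟩
  · rw [hstart, hrun]
    rfl
  · rw [hstart, hrun]
    exact hl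

end LCG

end

/-- One program and one constant `K` serve all texts `T`, all orders `π`, all moduli `p` and
bases `c`, and all word lengths `w` of at least `K log (|T| + p)` bits: for every enumeration `Ys`
of the multiset `𝒴` there is a data structure of at most `K g` words, where `g` is the size of the
grammar, on which the program, given `j` and `ℓ`, computes the signature of the prefix of length
`ℓ` of the `j`-th string of `𝒴` in time `K (1 + log ℓ)`. -/
theorem lemma2 :
    ∃ (P : List LCG.Instr) (K : ℕ),
      ∀ (T : List ℕ) (π : ℕ → LCG.Sym → ℕ) (S : LCG.Sym), LCG.IsGrammar π T S →
      ∀ (p c w : ℕ), p.Prime → 0 < c → c < p → K * Nat.clog 2 (T.length + p) ≤ w →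
      ∀ Ys : List (List ℕ), (Ys : Multiset (List ℕ)) = LCG.multisetY S →
      ∃ D : List ℕ, D.length ≤ K * LCG.grammarSize S ∧ (∀ x ∈ D, x < 2 ^ w) ∧
        ∀ (j : ℕ) (hj : j < Ys.length) (ℓ : ℕ), 1 ≤ ℓ → ℓ ≤ Ys[j].length →
          LCG.Answers w P D j ℓ (LCG.karpRabin p c (Ys[j].take ℓ)) (K * (1 + Nat.log 2 ℓ)) := by
  refine ⟨LCG.prog, 8000, fun T π S hG p c w hp hc hcp hw Ys hY => ?_⟩
  obtain ⟨hS, hlen⟩ := hG.parsed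
  have : Fact p.Prime := ⟨hp⟩
  rcases Nat.eq_zero_or_pos Ys.length with h0 | h0
  -- Without queries, for example for a text of one letter, the empty structure suffices; otherwise
  -- the grammar has positive size, as `exists_stores` requires.
  · exact ⟨[], by simp, by simp, fun j hj => by omega⟩
  have hcard : Ys.length ≤ LCG.grammarSize S := by
    rw [← Multiset.coe_card, hY]
    exact LCG.card_multisetY_le S
  -- The exponent 16 dominates the three size conditions, of degree at most 9; since `T.length + p`
  -- is at least 3, the spare powers absorb the constants.
  have hX : (T.length + p) ^ 16 ≤ 2 ^ w := by
    calc (T.length + p) ^ 16 ≤ (2 ^ Nat.clog 2 (T.length + p)) ^ 16 :=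
          Nat.pow_le_pow_left (Nat.le_pow_clog (by norm_num) _) 16
      _ = 2 ^ (Nat.clog 2 (T.length + p) * 16) := (pow_mul _ _ _).symm
      _ ≤ 2 ^ w := Nat.pow_le_pow_right (by norm_num) (by omega)
  have hp2 := hp.two_le
  have hT : 1 ≤ T.length := hlen ▸ hS.length_pos
  generalize hXdef : T.length + p = X at hX
  have h3 : 3 ≤ X := by omega
  have hpow : ∀ k, 3 ^ k ≤ X ^ k := fun k => Nat.pow_le_pow_left h3 k
  have hcode : 2 ^ 11 * T.length ^ 9 < 2 ^ w :=
    calc 2 ^ 11 * T.length ^ 9 < 3 ^ 7 * X ^ 9 :=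
          Nat.mul_lt_mul_of_lt_of_le (by norm_num) (Nat.pow_le_pow_left (by omega) 9)
            (by positivity)
      _ ≤ X ^ 7 * X ^ 9 := Nat.mul_le_mul_right _ (hpow 7)
      _ = X ^ 16 := by ring
      _ ≤ 2 ^ w := hX
  have hptr : 400 * (T.length + p) < 2 ^ w :=
    calc 400 * (T.length + p) < 3 ^ 15 * X := by omega
      _ ≤ X ^ 15 * X := Nat.mul_le_mul_right _ (hpow 15)
      _ = X ^ 16 := by ring
      _ ≤ 2 ^ w := hX
  have hmod : 4 * (p * p) < 2 ^ w :=
    calc 4 * (p * p) < 3 ^ 14 * (X * X) :=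
          Nat.mul_lt_mul_of_lt_of_le (by norm_num) (Nat.mul_le_mul (by omega) (by omega))
            (by positivity)
      _ ≤ X ^ 14 * (X * X) := Nat.mul_le_mul_right _ (hpow 14)
      _ = X ^ 16 := by ring
      _ ≤ 2 ^ w := hX
  obtain ⟨D, hD, hDw, rk, L, R, root, sp, sl, ca, hst, hDp, hDy⟩ := LCG.exists_stores hS (c := c)
    hcode hptr hmod (by omega) Ys (fun y hy => by rw [← hY]; exact hy) hcard
  refine ⟨D, by rw [hD]; omega, hDw, fun j hj ℓ h1 h2 => ?_⟩
  obtain ⟨A, hA, s, hs, hpre, hptr'⟩ := hDy j hj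
  have hc0 : (c : ZMod p) ≠ 0 := by
    rw [Ne, ZMod.natCast_eq_zero_iff]
    exact Nat.not_dvd_of_pos_of_lt hc hcp
  have hgT := LCG.grammarSize_le S hS
  obtain ⟨l, hl, hrun⟩ := LCG.run_init (w := w) (ℓ := ℓ) (m := fun a => D.getD a 0) (by omega)
    (by omega)     hDp hptr'
  have hlenY := hpre.length_le
  have hsum : A.cum s + (LCG.expand (A.slots.drop s)).length = A.exp.length := by
    rw [LCG.Sym.cum, ← List.length_append, ← LCG.expand_append, List.take_append_drop,
      LCG.expand_slots]
  have : Fact (1 < p) := ⟨hp.one_lt⟩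
  have hq := hst.stops_query hc0 hS le_rfl (by omega) hA (ℓ := ℓ) hs.le (by omega) 0 1
    (by rw [ZMod.val_zero, ZMod.val_one]; exact hl)
  have hv : (LCG.expand (A.slots.drop s)).take ℓ = Ys[j].take ℓ := by
    obtain ⟨z, hz⟩ := hpre
    rw [← hz, List.take_append_of_le_length h2]
  rw [zero_add, one_mul, hv, ← LCG.karpRabin_eq] at hq
  exact (hq.of_run hrun (by omega)).answers
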